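/- Let $n\ge 3$, $d\ge 2$, and let $f\in\mathbf Z[x_1,\dots,x_n]$ be a homogeneous polynomial of degree $d$ with coprime coefficients such that the hypersurface $f=0$ in $\mathbf P^{n-1}_{\mathbf C}$ is smooth. For a prime $p$ and $\mathbf x\in\mathbf Q_p^n$ put $\|\mathbf x\|_p=\max_i|x_i|_p$, $$H_{D_1,p}(\mathbf x)^{-1}=\max\Big(\frac1{\max(1,\|\mathbf x\|_p)},\frac{|f(\mathbf x)|_p}{\max(1,\|\mathbf x\|_p)^d}\Big),\qquad H_{D_0,p}(\mathbf x)^{-1}=\frac{H_{D_1,p}(\mathbf x)}{\max(1,\|\mathbf x\|_p)},$$ and for $\mathbf x\in\mathbf R^n$, with $\rho(\mathbf x)=(1+x_1^2+\dots+x_n^2)^{1/2}$, put $$H_{D_1,\infty}(\mathbf x)^{-1}=\Big(\frac1{\rho(\mathbf x)^2}+\frac{f(\mathbf x)^2}{\rho(\mathbf x)^{2d}}\Big)^{1/2},\qquad H_{D_0,\infty}(\mathbf x)^{-1}=\frac{H_{D_1,\infty}(\mathbf x)}{\rho(\mathbf x)}.$$ For $\mathbf s=(s_0,s_1)\in\mathbf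 C^2$ and a place $v$ of $\mathbf Q$ let $H_v(\mathbf s;\mathbf x)=H_{D_0,v}(\mathbf x)^{s_0}H_{D_1,v}(\mathbf x)^{s_1}$, and let $H(\mathbf s;\mathbf x)=\prod_vH_v(\mathbf s;\mathbf x_v)$ for $\mathbf x\in\mathbf A_{\mathbf Q}^n$. Let $\psi=\prod_v\psi_v$ be the standard additive character of $\mathbf A_{\mathbf Q}$, given by $\psi_p(x)=e^{2\pi i\{x\}_p}$ (where $\{x\}_p$ is the $p$-adic fractional part) and $\psi_\infty(x)=e^{-2\pi ix}$. For $\mathbf a\in\mathbf Z^n$ let $\psi_{\mathbf a}(\mathbf x)=\psi(\langle\mathbf a,\mathbf x\rangle)$, with local components $\psi_{\mathbf a,v}$. With self-dual Haar measures, define $$\hat H_v(\mathbf s;\psi_{\mathbf a})=\int_{\mathbf Q_v^n}H_v(\mathbf s;\mathbf x)^{-1}\psi_{\mathbf a,v}(\mathbf x)\,d\mathbf x,\qquad \hat H(\mathbf s;\psi_{\mathbf a})=\hat H_\infty(\mathbf s;\psi_{\mathbf a})\prod_p\hat H_p(\mathbf s;\psi_{\mathbf a}).$$ Fix $\varepsilon>0$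 and let $\Omega=\{\mathbf s\in\mathbf C^2:\ \mathrm{Re}(s_0)>n+\varepsilon,\ \mathrm{Re}(s_1)>n-1+\varepsilon\}$. **Proposition.** Let $\mathbf a\in\mathbf Z^n\setminus\{0\}$. 1. If $\mathrm{Re}(s_0)>n+1$ and $\mathrm{Re}(s_1)>n$, then $\mathbf x\mapsto H(\mathbf s;\mathbf x)^{-1}\psi_{\mathbf a}(\mathbf x)$ is integrable on $\mathbf A_{\mathbf Q}^n$ and its integral is $\hat H(\mathbf s;\psi_{\mathbf a})$. 2. For all $\mathbf s\in\Omega$ the integrals defining $\hat H_v(\mathbf s;\psi_{\mathbf a})$ converge absolutely for every place $v$, the product $\prod_p\hat H_p(\mathbf s;\psi_{\mathbf a})$ converges unconditionally, and $\mathbf s\mapsto\hat H(\mathbf s;\psi_{\mathbf a})$ is holomorphic on $\Omega$. 3. There is polynomial growth in vertical strips, uniformly in $\mathbf a$: there is a real number $\nu$, independent of $\mathbf s$ and $\mathbf a$, and for every $R\in\mathbf R$ there is a constant $C>0$, independent of $\mathbf s$ and $\mathbf a$, such that $$|\hat H(\mathbf s;\psi_{\mathbf a})|\le C\,(1+\|\mathrm{Im}(\mathbf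 s)\|)^{\nu}\,(1+\|\mathbf a\|)^{-n-1}$$ for all $\mathbf a\in\mathbf Z^n\setminus\{0\}$ and all $\mathbf s\in\Omega$ with $\mathrm{Re}(s_0)\le R$ and $\mathrm{Re}(s_1)\le R$. Here $\|\cdot\|$ denotes the maximum norm. -/

import Mathlib

open scoped RestrictedProduct
open MeasureTheory

noncomputable section

namespace BlowupHeight

/-! ### Measures on `ℚ_p` -/

section Local

variable (p : ℕ) [Fact p.Prime]

instance : MeasurableSpace ℚ_[p] := borel _

instance : BorelSpace ℚ_[p] := ⟨rfl⟩

/-- The ring of `p`-adic integers as a compact subset of `ℚ_p` with nonempty interior. -/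
def padicUnitBall : TopologicalSpace.PositiveCompacts ℚ_[p] where
  carrier := Metric.closedBall 0 1
  isCompact' := isCompact_closedBall 0 1
  interior_nonempty' :=
    ⟨0, mem_interior_iff_mem_nhds.2 (Metric.closedBall_mem_nhds 0 one_pos)⟩

/-- The self-dual Haar measure of `ℚ_p`: the one giving mass `1` to `ℤ_p`.
The measure `volume` on `Fin n → ℚ_p` is then the product measure. -/
instance : MeasureSpace ℚ_[p] := ⟨Measure.addHaarMeasure (padicUnitBall p)⟩

/-! ### The standard additive character -/

/-- Every `x ∈ ℚ_p` is congruent modulo `ℤ_p` to an element of `ℤ[1/p] ∩ [0,1)`. -/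
theorem exists_padicFract (x : ℚ_[p]) :
    ∃ r : ℚ, 0 ≤ r ∧ r < 1 ∧ (∃ (m : ℤ) (k : ℕ), r = m / (p : ℚ) ^ k) ∧
      ‖x - (r : ℚ_[p])‖ ≤ 1 := by
  have hp : (1 : ℝ) < p := by exact_mod_cast (Fact.out : p.Prime).one_lt
  have hp0 : (0 : ℚ) < p := by exact_mod_cast (Fact.out : p.Prime).pos
  obtain ⟨k, hk⟩ := pow_unbounded_of_one_lt ‖x‖ hp
  have hpk : (0 : ℝ) < (p : ℝ) ^ k := by positivity
  have hnorm : ‖(p : ℚ_[p]) ^ k‖ = ((p : ℝ) ^ k)⁻¹ := by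
    rw [norm_pow, Padic.norm_p, inv_pow]
  have hy : ‖(p : ℚ_[p]) ^ k * x‖ ≤ 1 := by
    rw [norm_mul, hnorm, inv_mul_le_iff₀ hpk, mul_one]
    exact hk.le
  let y : ℤ_[p] := ⟨(p : ℚ_[p]) ^ k * x, hy⟩
  have hne : (p : ℚ_[p]) ^ k ≠ 0 :=
    pow_ne_zero _ (by exact_mod_cast (Fact.out : p.Prime).ne_zero)
  refine ⟨(y.appr k : ℚ) / (p : ℚ) ^ k, by positivity, ?_, ⟨y.appr k, k, by simp⟩, ?_⟩
  · rw [div_lt_one (by positivity)]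
    exact_mod_cast y.appr_lt k
  · have h1 : ‖y - (y.appr k : ℤ_[p])‖ ≤ (p : ℝ) ^ (-k : ℤ) :=
      (PadicInt.norm_le_pow_iff_mem_span_pow _ _).2 (PadicInt.appr_spec k y)
    have h2 : x - (((y.appr k : ℚ) / (p : ℚ) ^ k : ℚ) : ℚ_[p])
        = ((p : ℚ_[p]) ^ k)⁻¹ * ((y - (y.appr k : ℤ_[p]) : ℤ_[p]) : ℚ_[p]) := by
      push_cast
      change _ = ((p : ℚ_[p]) ^ k)⁻¹ * ((p : ℚ_[p]) ^ k * x - _)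
      field_simp
    rw [h2, norm_mul, norm_inv, hnorm, inv_inv, PadicInt.padic_norm_e_of_padicInt]
    calc (p : ℝ) ^ k * ‖y - (y.appr k : ℤ_[p])‖ ≤ (p : ℝ) ^ k * (p : ℝ) ^ (-k : ℤ) := by gcongr
      _ = 1 := by rw [zpow_neg, zpow_natCast, mul_inv_cancel₀ hpk.ne']

/-- The fractional part of `x ∈ ℚ_p`: the (unique) `r ∈ ℤ[1/p] ∩ [0,1)` with `x - r ∈ ℤ_p`. -/
def padicFract (x : ℚ_[p]) : ℚ := (exists_padicFract p x).choose

/-- The standard additive character `ψ_p(x) = exp(2πi {x}_p)` of `ℚ_p`. -/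
def psiPadic (x : ℚ_[p]) : ℂ :=
  Complex.exp (2 * Real.pi * Complex.I * (padicFract p x : ℂ))

/-- The local component at `p` of the character `ψ_a`, for `a ∈ ℤⁿ`. -/
def charPadic {n : ℕ} (a : Fin n → ℤ) (x : Fin n → ℚ_[p]) : ℂ :=
  psiPadic p (∑ i, (a i : ℚ_[p]) * x i)

/-! ### Local heights and Fourier transforms at `p`

The norm `‖x‖` on `Fin n → ℚ_p` is the maximum of the norms of the coordinates. -/

variable {n : ℕ} (d : ℕ) (f : MvPolynomial (Fin n) ℤ)

/-- `H_{D₁,p}(x)`, with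
`H_{D₁,p}(x)⁻¹ = max (1 / max(1,‖x‖)) (|f(x)| / max(1,‖x‖)^d)`. -/
def heightD1Padic (x : Fin n → ℚ_[p]) : ℝ :=
  (max (1 / max 1 ‖x‖) (‖MvPolynomial.aeval x f‖ / max 1 ‖x‖ ^ d))⁻¹

/-- `H_{D₀,p}(x)`, with `H_{D₀,p}(x)⁻¹ = H_{D₁,p}(x) / max(1,‖x‖)`. -/
def heightD0Padic (x : Fin n → ℚ_[p]) : ℝ :=
  (heightD1Padic p d f x / max 1 ‖x‖)⁻¹

/-- The local height `H_p(s;x) = H_{D₀,p}(x)^{s₀} H_{D₁,p}(x)^{s₁}`, where `s = (s₀,s₁)`. -/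
def heightPadic (s : ℂ × ℂ) (x : Fin n → ℚ_[p]) : ℂ :=
  (heightD0Padic p d f x : ℂ) ^ s.1 * (heightD1Padic p d f x : ℂ) ^ s.2

/-- The integrand `H_p(s;x)⁻¹ ψ_{a,p}(x)`. -/
def integrandPadic (a : Fin n → ℤ) (s : ℂ × ℂ) (x : Fin n → ℚ_[p]) : ℂ :=
  (heightPadic p d f s x)⁻¹ * charPadic p a x

/-- The local Fourier transform `Ĥ_p(s;ψ_a)`. -/
def fourierPadic (a : Fin n → ℤ) (s : ℂ × ℂ) : ℂ :=
  ∫ x : Fin n → ℚ_[p], integrandPadic p d f a s x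

end Local

/-! ### The archimedean place -/

section Real

variable {n : ℕ} (d : ℕ) (f : MvPolynomial (Fin n) ℤ)

/-- `(1 + x₁² + ⋯ + xₙ²)^{1/2}`, the archimedean analogue of `max(1,‖x‖)`. -/
def realSize (x : Fin n → ℝ) : ℝ := √(1 + ∑ i, x i ^ 2)

/-- `H_{D₁,∞}(x)`, with
`H_{D₁,∞}(x)⁻¹ = ((1 / realSize x)² + (|f(x)| / realSize x ^ d)²)^{1/2}`. -/
def heightD1Real (x : Fin n → ℝ) : ℝ :=
  (√((1 / realSize x) ^ 2 + (|MvPolynomial.aeval x f| / realSize x ^ d) ^ 2))⁻¹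

/-- `H_{D₀,∞}(x)`, with `H_{D₀,∞}(x)⁻¹ = H_{D₁,∞}(x) / realSize x`. -/
def heightD0Real (x : Fin n → ℝ) : ℝ := (heightD1Real d f x / realSize x)⁻¹

/-- The local height `H_∞(s;x) = H_{D₀,∞}(x)^{s₀} H_{D₁,∞}(x)^{s₁}`. -/
def heightReal (s : ℂ × ℂ) (x : Fin n → ℝ) : ℂ :=
  (heightD0Real d f x : ℂ) ^ s.1 * (heightD1Real d f x : ℂ) ^ s.2

/-- The archimedean component of `ψ_a`; the standard character of `ℝ` is `x ↦ exp(-2πi x)`, so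
that the product over all places is trivial on `ℚ`. -/
def charReal (a : Fin n → ℤ) (x : Fin n → ℝ) : ℂ :=
  Complex.exp (-(2 * Real.pi * Complex.I * ((∑ i, (a i : ℝ) * x i : ℝ) : ℂ)))

/-- The integrand `H_∞(s;x)⁻¹ ψ_{a,∞}(x)`. -/
def integrandReal (a : Fin n → ℤ) (s : ℂ × ℂ) (x : Fin n → ℝ) : ℂ :=
  (heightReal d f s x)⁻¹ * charReal a x

/-- The local Fourier transform `Ĥ_∞(s;ψ_a)`. -/
def fourierReal (a : Fin n → ℤ) (s : ℂ × ℂ) : ℂ :=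
  ∫ x : Fin n → ℝ, integrandReal d f a s x

end Real

/-! ### Adelic points of the vector group -/

section Adelic

instance (p : Nat.Primes) : Fact (p : ℕ).Prime := ⟨p.2⟩

variable (n : ℕ)

/-- `ℤ_pⁿ` as a subgroup of `ℚ_pⁿ`. -/
def integralPoints (p : Nat.Primes) : AddSubgroup (Fin n → ℚ_[p]) :=
  AddSubgroup.pi Set.univ fun _ ↦ (PadicInt.subring (p : ℕ)).toAddSubgroup

theorem coe_integralPoints (p : Nat.Primes) :
    (integralPoints n p : Set (Fin n → ℚ_[p])) =
      Set.univ.pi fun _ ↦ Metric.closedBall 0 1 := by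
  ext x
  simp only [integralPoints, AddSubgroup.coe_pi, Set.mem_pi, Metric.mem_closedBall,
    dist_zero_right]
  rfl

instance : Fact (∀ p : Nat.Primes,
    IsOpen (integralPoints n p : Set (Fin n → ℚ_[p]))) := ⟨fun p ↦ by
  rw [coe_integralPoints]
  exact isOpen_set_pi Set.finite_univ fun _ _ ↦
    IsUltrametricDist.isOpen_closedBall _ one_ne_zero⟩

instance (p : Nat.Primes) : CompactSpace (integralPoints n p) :=
  isCompact_iff_compactSpace.1 (by
    rw [coe_integralPoints]
    exact isCompact_univ_pi fun _ ↦ isCompact_closedBall 0 1)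

/-- The points of the vector group of dimension `n` over the finite adeles of `ℚ`: the restricted
product of the groups `ℚ_pⁿ` with respect to the compact open subgroups `ℤ_pⁿ`. -/
abbrev FiniteAdelicPoints : Type := Πʳ p : Nat.Primes, [Fin n → ℚ_[p], integralPoints n p]

instance : MeasurableSpace (FiniteAdelicPoints n) := borel _

instance : BorelSpace (FiniteAdelicPoints n) := ⟨rfl⟩

theorem isOpenEmbedding_integral : Topology.IsOpenEmbedding (RestrictedProduct.structureMap
    (fun p : Nat.Primes ↦ Fin n → ℚ_[p])
    (fun p ↦ (integralPoints n p : Set (Fin n → ℚ_[p]))) Filter.cofinite) :=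
  RestrictedProduct.isOpenEmbedding_structureMap
    (R := fun p : Nat.Primes ↦ Fin n → ℚ_[p])
    (A := fun p ↦ (integralPoints n p : Set (Fin n → ℚ_[p]))) Fact.out

/-- The compact open subgroup `∏_p ℤ_pⁿ`. -/
def integralAdelicPoints : TopologicalSpace.PositiveCompacts (FiniteAdelicPoints n) where
  carrier := Set.range (RestrictedProduct.structureMap
    (fun p : Nat.Primes ↦ Fin n → ℚ_[p])
    (fun p ↦ (integralPoints n p : Set (Fin n → ℚ_[p]))) Filter.cofinite)
  isCompact' :=
    haveI : ∀ p : Nat.Primes, CompactSpace (integralPoints n p : Set (Fin n → ℚ_[p])) :=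
      fun p ↦ inferInstanceAs (CompactSpace (integralPoints n p))
    isCompact_range (isOpenEmbedding_integral n).continuous
  interior_nonempty' :=
    ⟨_, (isOpenEmbedding_integral n).isOpen_range.interior_eq.symm ▸
      Set.mem_range_self (fun p ↦ (0 : integralPoints n p))⟩

/-- The Haar measure on the finite adelic points with mass `1` on `∏_p ℤ_pⁿ`. -/
instance : MeasureSpace (FiniteAdelicPoints n) :=
  ⟨Measure.addHaarMeasure (integralAdelicPoints n)⟩

/-- The adelic points of the vector group of dimension `n` over `ℚ`. The measure `volume` is the
product of Lebesgue measure on `ℝⁿ` and the above measure, i.e. the self-dual Haar measure. -/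
abbrev AdelicPoints : Type := (Fin n → ℝ) × FiniteAdelicPoints n

variable {n} (d : ℕ) (f : MvPolynomial (Fin n) ℤ)

/-- The global height `H(s;x) = ∏_v H_v(s;x_v)`; almost all factors are `1`. -/
def heightAdelic (s : ℂ × ℂ) (x : AdelicPoints n) : ℂ :=
  heightReal d f s x.1 * ∏ᶠ p : Nat.Primes, heightPadic p d f s (x.2 p)

/-- The character `ψ_a` of the adelic points; almost all factors are `1`. -/
def charAdelic (a : Fin n → ℤ) (x : AdelicPoints n) : ℂ :=
  charReal a x.1 * ∏ᶠ p : Nat.Primes, charPadic p a (x.2 p)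

/-- The integrand `H(s;x)⁻¹ ψ_a(x)` of the global Fourier transform. -/
def integrandAdelic (a : Fin n → ℤ) (s : ℂ × ℂ) (x : AdelicPoints n) : ℂ :=
  (heightAdelic d f s x)⁻¹ * charAdelic a x

/-- The Euler product `Ĥ_∞(s;ψ_a) ∏_p Ĥ_p(s;ψ_a)`. -/
def fourierEuler (a : Fin n → ℤ) (s : ℂ × ℂ) : ℂ :=
  fourierReal d f a s * ∏' p : Nat.Primes, fourierPadic p d f a s

end Adelic

/-- The domain `Ω` defined by `Re s₀ > n + ε` and `Re s₁ > n - 1 + ε`. -/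
def domainOmega (n : ℕ) (ε : ℝ) : Set (ℂ × ℂ) :=
  {s | (n : ℝ) + ε < s.1.re ∧ (n : ℝ) - 1 + ε < s.2.re}

/-- The hypersurface `f = 0` in `ℙ^{n-1}` over `ℂ` is smooth: the partial derivatives of `f` do
not vanish simultaneously at any point of the hypersurface. -/
def IsSmoothHypersurface {n : ℕ} (f : MvPolynomial (Fin n) ℤ) : Prop :=
  ∀ z : Fin n → ℂ, z ≠ 0 → MvPolynomial.aeval z f = 0 →
    ∃ i, MvPolynomial.aeval z (MvPolynomial.pderiv i f) ≠ 0

/-- The coefficients of `f` are coprime. -/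
def HasCoprimeCoeffs {n : ℕ} (f : MvPolynomial (Fin n) ℤ) : Prop :=
  ∀ k : ℤ, (∀ m, k ∣ f.coeff m) → IsUnit k

end BlowupHeight

end

/-!
Why the theorem is true. Write `ρ` for the size of a point, that is `max(1, ‖x‖_p)` at a prime `p`
and `(1 + ∑ xᵢ²)^{1/2}` at the real place. Since `H_{D₀} = ρ / H_{D₁}`, the absolute value of
`H_v(s;x)⁻¹` on the domain `Ω` is at most a constant (equal to `1` at finite places, and bounded in
vertical strips at the real place) times its value at the corner `(n + ε, n - 1 + ε)`, which is
`ρ(x) ^ (-(n + ε)) H_{D₁,v}(x)`. Here `H_{D₁,v}` is large only near the zeros of `f` at infinity: on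
the shell of size `R` it is comparable to `min(R, 1 / |f(y)|)`, where `y` is the rescaling of `x` to
size `1`.

*Tubes.* Smoothness gives, by the Nullstellensatz, integral identities `D Xᵢ ^ N = g f + ∑ⱼ hⱼ ∂ⱼf`
with `D ≠ 0` (`exists_smoothness_identity`). Hence near a zero of `f` of size `1` some partial
derivative is bounded below, and translating the tube `{|f| ≤ τ}` in that direction produces about
`1 / τ` disjoint copies of it inside a bounded set. So the tube has volume `O(τ)`
(`volume_padicTube_inter_le`, `exists_volume_realTube_le`). The integral of the corner value over
the shell of size `R` is then `O(R ^ (-ε) log R)`, which proves local integrability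
(`outerIntegral_ne_top`, `integrable_majorantReal`), and holomorphy of each local factor follows by
differentiation under the integral sign (`differentiableOn_integral_cpow`).

*Good primes.* If `p` does not divide `D`, the same argument is combined with counting zeros of `f`
modulo `p`, and the integral over `‖x‖ > 1` is `O(p ^ (-ε))` uniformly in `p`
(`outerIntegral_le_of_good`). If moreover `a` is not divisible by `p`, one gains a factor `p`. The
height is invariant under scalar units, and averaging the character over them shows that, up to a
relative error `O(1 / p)`, only points with `a · x` integral contribute
(`norm_setIntegral_charPadic_le`). Rescaled to the unit sphere these satisfy `a · y ≡ 0` modulo `p`,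
and a smooth form of degree at least `2` in at least `3` variables does not vanish on a hyperplane
(`exists_aeval_ne_zero_of_mem_hyperplane`), so that imposing the congruence saves a factor `p` in
the count (`card_zeros_hyperplane_le`). Therefore `Ĥ_p(s;ψ_a) = 1 + O(p ^ (-1 - ε))`
(`norm_fourierPadic_sub_one_le_of_good`), the product over `p` converges normally on `Ω`, and its
limit is holomorphic (`differentiableOn_tprod_of_summable`).

*Growth.* The exceptional primes divide `D aᵢ` for any nonzero coordinate `aᵢ`. There are at most
`log₂ |D aᵢ|` of them, and each contributes a bounded factor, so the finite part of `Ĥ(s;ψ_a)` is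
bounded by a power of `1 + ‖a‖` (`exists_norm_tprod_fourierPadic_le`). At the real place
`H_∞(s;x)⁻¹` is a product of complex powers of two positive polynomials which dominate all their
derivatives (`isTame_heightPolys`), so that each integration by parts gains a factor `‖a‖⁻¹` at the
cost of a factor linear in `s` (`exists_norm_fourierReal_le`). Sufficiently many integrations by
parts outweigh the finite part.

*The adelic integral.* The adelic Haar measure, restricted to points integral outside a finite set
`S` of primes, projects to the product measure at `S` (`map_projFinset`), and these sets exhaust the
adeles. Integrability reduces to the convergence of `∏ₚ ∫ |H_p(s;x)|⁻¹ dx`, where there is no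
cancellation and the factors are only `1 + O(p ^ (-ε))`; this needs `ε > 1`, which is the stronger
condition on `s` in the first assertion (`integrable_integrandAdelic_and_integral_eq`).
-/

namespace BlowupHeight

/-! ### Polynomial identities -/

open MvPolynomial in
/-- Taylor expansion to second order in the direction of a coordinate, with a remainder that is
an integral polynomial in the point and the increment. -/
theorem exists_taylor_remainder {σ : Type} [DecidableEq σ] (f : MvPolynomial σ ℤ) (i : σ) :
    ∃ r : MvPolynomial (Option σ) ℤ, ∀ (R : Type) [CommRing R] (y : σ → R) (t : R),
      aeval (y + Pi.single i t) f =
        aeval y f + t * aeval y (pderiv i f) + t ^ 2 * aeval (fun o : Option σ ↦ o.elim t y) r := by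
  induction f using MvPolynomial.induction_on with
  | C c => exact ⟨0, fun R _ y t ↦ by simp⟩
  | add p q hp hq =>
    obtain ⟨r₁, h₁⟩ := hp
    obtain ⟨r₂, h₂⟩ := hq
    refine ⟨r₁ + r₂, fun R _ y t ↦ ?_⟩
    simp only [map_add, h₁, h₂]
    ring
  | mul_X p j hp =>
    obtain ⟨r, h⟩ := hp
    by_cases hij : j = i
    · subst hij
      refine ⟨r * X (some j) + rename some (pderiv j p) + r * X none, fun R _ y t ↦ ?_⟩
      have h3 : (fun o : Option σ ↦ o.elim t y) ∘ some = y := rfl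
      simp only [map_mul, map_add, h, aeval_X, pderiv_mul, pderiv_X_self, Pi.add_apply,
        Pi.single_eq_same, aeval_rename, h3, map_one, Option.elim_some, Option.elim_none]
      ring
    · refine ⟨r * X (some j), fun R _ y t ↦ ?_⟩
      simp only [map_mul, map_add, h, aeval_X, pderiv_mul, pderiv_X_of_ne hij, Pi.add_apply,
        Pi.single_eq_of_ne hij, Option.elim_some, map_zero]
      ring

open MvPolynomial in
theorem aeval_smul_of_isHomogeneous {σ R : Type*} [CommRing R] {f : MvPolynomial σ ℤ} {d : ℕ}
    (hf : f.IsHomogeneous d) (c : R) (y : σ → R) :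
    aeval (c • y) f = c ^ d * aeval y f := by
  rw [aeval_def, aeval_def, eval₂_eq, eval₂_eq, Finset.mul_sum]
  refine Finset.sum_congr rfl fun m hm ↦ ?_
  rw [hf.degree_eq_sum_deg_support hm]
  simp only [Pi.smul_apply, smul_eq_mul, mul_pow, Finset.prod_mul_distrib,
    Finset.prod_pow_eq_pow_sum]
  ring

open MvPolynomial in
/-- For a smooth hypersurface, a nonzero integer multiple of a power of each variable is a
combination of the equation and its partial derivatives with integral coefficients. -/
theorem exists_smoothness_identity {n : ℕ} {f : MvPolynomial (Fin n) ℤ}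
    (hsm : IsSmoothHypersurface f) :
    ∃ D : ℤ, D ≠ 0 ∧ ∃ N : ℕ, ∀ i, ∃ (g : MvPolynomial (Fin n) ℤ)
      (h : Fin n → MvPolynomial (Fin n) ℤ),
      C D * X i ^ N = g * f + ∑ j, h j * pderiv j f := by
  set I : Ideal (MvPolynomial (Fin n) ℤ) :=
    Ideal.span (Set.range fun o : Option (Fin n) ↦ o.elim f fun j ↦ pderiv j f) with hI
  have key : ∀ i, ∃ D : ℤ, D ≠ 0 ∧ ∃ N : ℕ, C D * X i ^ N ∈ I := by
    intro i
    -- The Nullstellensatz is applied over `ℚ`, with zeros in `ℂ`; then denominators are cleared.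
    let _ := algebraMvPolynomial (R := ℤ) (S := ℚ) (σ := Fin n)
    set J : Ideal (MvPolynomial (Fin n) ℚ) := I.map (algebraMap _ _) with hJ
    have hrad : (X i : MvPolynomial (Fin n) ℚ) ∈ J.radical := by
      rw [← vanishingIdeal_zeroLocus_eq_radical (K := ℂ), mem_vanishingIdeal_iff]
      intro z hz
      rw [mem_zeroLocus_iff] at hz
      have hz' : ∀ q ∈ I, aeval z q = 0 := by
        intro q hq
        have := hz _ (Ideal.mem_map_of_mem (algebraMap _ (MvPolynomial (Fin n) ℚ)) hq)
        rwa [algebraMap_def, aeval_map_algebraMap] at this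
      by_contra hne
      have hz0 : z ≠ 0 := by
        rintro rfl
        simp at hne
      obtain ⟨j, hj⟩ := hsm z hz0 (hz' f (Ideal.subset_span ⟨none, rfl⟩))
      exact hj (hz' _ (Ideal.subset_span ⟨some j, rfl⟩))
    obtain ⟨N, hN⟩ := hrad
    rw [hJ, IsLocalization.mem_map_algebraMap_iff
      ((nonZeroDivisors ℤ).map (C (σ := Fin n)))] at hN
    obtain ⟨⟨⟨q, hq⟩, ⟨m, D, hD, hm⟩⟩, h⟩ := hN
    refine ⟨D, nonZeroDivisors.ne_zero hD, N, ?_⟩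
    have hinj : Function.Injective (algebraMap (MvPolynomial (Fin n) ℤ)
        (MvPolynomial (Fin n) ℚ)) := by
      rw [algebraMap_def]
      exact map_injective _ (RingHom.injective_int _)
    have : C D * X i ^ N = q := by
      apply hinj
      rw [map_mul, map_pow, mul_comm]
      subst hm
      rw [show algebraMap (MvPolynomial (Fin n) ℤ) (MvPolynomial (Fin n) ℚ) (X i) = X i by
        rw [algebraMap_def, map_X]]
      exact h
    rwa [this]
  choose D hD N hN using key
  refine ⟨∏ i, D i, Finset.prod_ne_zero_iff.2 fun i _ ↦ hD i, ∑ i, N i, fun i ↦ ?_⟩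
  have h1 : C (∏ i, D i) * X i ^ (∑ i, N i) ∈ I := by
    rw [← Finset.mul_prod_erase _ _ (Finset.mem_univ i),
      ← Finset.add_sum_erase _ _ (Finset.mem_univ i), pow_add, C_mul]
    have : (C (D i) * C (∏ j ∈ Finset.univ.erase i, D j) *
        (X i ^ N i * X i ^ ∑ j ∈ Finset.univ.erase i, N j) : MvPolynomial (Fin n) ℤ) =
        (C (∏ j ∈ Finset.univ.erase i, D j) * X i ^ ∑ j ∈ Finset.univ.erase i, N j) *
          (C (D i) * X i ^ N i) := by ring
    rw [this]
    exact I.mul_mem_left _ (hN i)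
  rw [hI, Ideal.mem_span_range_iff_exists_fun] at h1
  obtain ⟨c, hc⟩ := h1
  refine ⟨c none, fun j ↦ c (some j), ?_⟩
  rw [← hc, Fintype.sum_option]
  rfl

open MvPolynomial in
theorem eval_aeval_line {n : ℕ} {K : Type*} [CommRing K] (f : MvPolynomial (Fin n) ℤ)
    (y v : Fin n → K) (t : K) :
    Polynomial.eval t (aeval (fun j ↦ Polynomial.C (y j) + Polynomial.X * Polynomial.C (v j)) f) =
      aeval (y + t • v) f := by
  induction f using MvPolynomial.induction_on with
  | C c => simp
  | add p q hp hq => simp only [map_add, Polynomial.eval_add, hp, hq]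
  | mul_X p k hp => simp only [map_mul, Polynomial.eval_mul, hp, aeval_X]; simp [mul_comm t]

open MvPolynomial in
/-- The derivative of `f` along the line through `y` in the direction `v`, computed formally so that
it is available over every commutative ring. -/
theorem derivative_aeval_line {n : ℕ} {K : Type*} [CommRing K] (f : MvPolynomial (Fin n) ℤ)
    (y v : Fin n → K) :
    Polynomial.eval 0 (Polynomial.derivative
      (aeval (fun j ↦ Polynomial.C (y j) + Polynomial.X * Polynomial.C (v j)) f)) =
      ∑ j, v j * aeval y (pderiv j f) := by
  have hev : ∀ p : MvPolynomial (Fin n) ℤ, Polynomial.eval 0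
      (aeval (fun j ↦ Polynomial.C (y j) + Polynomial.X * Polynomial.C (v j)) p) = aeval y p := by
    intro p
    rw [eval_aeval_line, zero_smul, add_zero]
  induction f using MvPolynomial.induction_on with
  | C c => simp
  | add p q hp hq =>
    simp only [map_add, Polynomial.eval_add, hp, hq, mul_add, Finset.sum_add_distrib]
  | mul_X p k hp =>
    have h1 : ∑ j, v j * (aeval y p * aeval y (pderiv j (X k : MvPolynomial (Fin n) ℤ))) =
        aeval y p * v k := by
      rw [Finset.sum_eq_single k (fun j _ hj ↦ by simp [pderiv_X_of_ne hj.symm]) (by simp)]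
      simp [mul_comm]
    simp only [map_mul, aeval_X, Polynomial.derivative_mul, Polynomial.eval_add,
      Polynomial.eval_mul, hp, hev, pderiv_mul, map_add, mul_add, Finset.sum_add_distrib, h1]
    simp [mul_comm, Finset.mul_sum, mul_left_comm]

/-! ### Zeros of forms over finite fields -/

open MvPolynomial in
/-- A smooth form of degree at least two in at least three variables over an algebraically closed
field does not vanish identically on any hyperplane. Otherwise its derivatives along the hyperplane
vanish there, while the remaining one has a nontrivial zero on the hyperplane. -/
theorem exists_aeval_ne_zero_of_mem_hyperplane {n d : ℕ} (hn : 3 ≤ n) (hd : 2 ≤ d)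
    {f : MvPolynomial (Fin n) ℤ} (hf : f.IsHomogeneous d) {K : Type} [Field K] [IsAlgClosed K]
    (hsm : ∀ y : Fin n → K, aeval y f = 0 → (∀ j, aeval y (pderiv j f) = 0) → y = 0)
    {a : Fin n → K} (ha : a ≠ 0) : ∃ y : Fin n → K, ∑ i, a i * y i = 0 ∧ aeval y f ≠ 0 := by
  classical
  by_contra! hcon
  obtain ⟨i, hi⟩ : ∃ i, a i ≠ 0 := by
    by_contra! h
    exact ha (funext h)
  -- If `f` vanishes on the hyperplane, so do its derivatives in the directions of the hyperplane.
  have hdir : ∀ y v : Fin n → K, ∑ i, a i * y i = 0 → ∑ i, a i * v i = 0 →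
      ∑ j, v j * aeval y (pderiv j f) = 0 := by
    intro y v hy hv
    rw [← derivative_aeval_line]
    have h0 : aeval (fun j ↦ Polynomial.C (y j) + Polynomial.X * Polynomial.C (v j)) f = 0 := by
      refine Polynomial.funext fun t ↦ ?_
      rw [eval_aeval_line, Polynomial.eval_zero]
      refine hcon _ ?_
      simp only [Pi.add_apply, Pi.smul_apply, smul_eq_mul, mul_add, Finset.sum_add_distrib, hy,
        zero_add]
      rw [← mul_zero t, ← hv, Finset.mul_sum]
      exact Finset.sum_congr rfl fun j _ ↦ by ring
    rw [h0, Polynomial.derivative_zero, Polynomial.eval_zero]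
  -- The vectors `e j` with `j ≠ i` form a basis of the hyperplane, and `e i = 0`.
  let e : Fin n → Fin n → K := fun j ↦ Pi.single j 1 - Pi.single i (a j / a i)
  have he : ∀ j, ∑ k, a k * e j k = 0 := by
    intro j
    simp only [e, Pi.sub_apply, mul_sub, Finset.sum_sub_distrib]
    simp [Pi.single_apply]
    field_simp
    simp
  -- Smoothness says that `∂ᵢf` has no nontrivial zero on the hyperplane. This is impossible on the
  -- plane spanned by `e j` and `e k`, since `∂ᵢf` has positive degree.
  have hsing : ∀ y : Fin n → K, ∑ i, a i * y i = 0 → aeval y (pderiv i f) = 0 → y = 0 := by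
    intro y hy h
    refine hsm y (hcon y hy) fun j ↦ ?_
    have := hdir y (e j) hy (he j)
    simp only [e, Pi.sub_apply, sub_mul, Finset.sum_sub_distrib] at this
    simpa [Pi.single_apply, h] using this
  obtain ⟨j, hj⟩ : ∃ j : Fin n, j ≠ i := by
    have : Nontrivial (Fin n) := Fin.nontrivial_iff_two_le.2 (by omega)
    exact exists_ne i
  obtain ⟨k, hk⟩ : ∃ k : Fin n, k ∉ ({i, j} : Finset (Fin n)) := by
    have : ({i, j} : Finset (Fin n)).card < (Finset.univ : Finset (Fin n)).card := by
      have := Finset.card_le_two (a := i) (b := j)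
      simp only [Finset.card_univ, Fintype.card_fin]
      omega
    obtain ⟨k, -, hk⟩ := Finset.exists_mem_notMem_of_card_lt_card this
    exact ⟨k, hk⟩
  simp only [Finset.mem_insert, Finset.mem_singleton, not_or] at hk
  set h := pderiv i f with hh
  have hhom : h.IsHomogeneous (d - 1) := hf.pderiv
  have hej : e j ≠ 0 := fun h0 ↦ by
    have := congrFun h0 j
    simp [e, hj] at this
  let q : Polynomial K :=
    aeval (fun l ↦ Polynomial.C (e k l) + Polynomial.X * Polynomial.C (e j l)) h
  have hq : ∀ t, q.eval t = aeval (e k + t • e j) h := fun t ↦ eval_aeval_line _ _ _ _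
  have hmem : ∀ t : K, ∑ l, a l * (e k + t • e j) l = 0 := by
    intro t
    simp only [Pi.add_apply, Pi.smul_apply, smul_eq_mul, mul_add, Finset.sum_add_distrib, he k,
      zero_add]
    rw [← mul_zero t, ← he j, Finset.mul_sum]
    exact Finset.sum_congr rfl fun l _ ↦ by ring
  have hq0 : ∀ t, q.eval t ≠ 0 := by
    intro t ht
    rw [hq] at ht
    have := congrFun (hsing _ (hmem t) ht) k
    simp [e, hk.1, hk.2] at this
  -- A polynomial without roots is constant; homogeneity then forces `h (e j) = 0`.
  obtain ⟨c, hc⟩ : ∃ c, q = Polynomial.C c := by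
    refine ⟨q.coeff 0, Polynomial.eq_C_of_degree_le_zero ?_⟩
    by_contra! hdeg
    obtain ⟨t, ht⟩ := IsAlgClosed.exists_root q hdeg.ne'
    exact hq0 t ht
  have hpoly : aeval (fun l ↦ Polynomial.C (e j l) + Polynomial.X * Polynomial.C (e k l)) h =
      Polynomial.C c * Polynomial.X ^ (d - 1) := by
    refine Polynomial.eq_of_infinite_eval_eq _ _ ?_
    refine Set.Infinite.mono (s := {0}ᶜ) ?_ (Set.Finite.infinite_compl (Set.finite_singleton 0))
    intro t ht
    have ht0 : t ≠ 0 := ht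
    have h3 : aeval (t • (e k + t⁻¹ • e j)) h = t ^ (d - 1) * c := by
      rw [aeval_smul_of_isHomogeneous hhom, ← hq, hc, Polynomial.eval_C]
    rw [Set.mem_ofPred_eq, Polynomial.eval_mul, Polynomial.eval_C, Polynomial.eval_pow,
      Polynomial.eval_X, mul_comm, ← h3, eval_aeval_line, smul_add, smul_inv_smul₀ ht0, add_comm]
  refine hej (hsing (e j) (he j) ?_)
  have := eval_aeval_line h (e j) (e k) 0
  rwa [hpoly, Polynomial.eval_mul, Polynomial.eval_pow, Polynomial.eval_X, zero_pow (by omega),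
    mul_zero, zero_smul, add_zero, eq_comm] at this

open MvPolynomial in
/-- The smoothness identity transfers smoothness from `ℂ` to every domain in which `D` is nonzero;
in particular `f` has good reduction at the primes not dividing `D`. -/
theorem eq_zero_of_singular {n : ℕ} {f : MvPolynomial (Fin n) ℤ} {D : ℤ} {N : ℕ}
    (hD : ∀ i, ∃ (g : MvPolynomial (Fin n) ℤ) (h : Fin n → MvPolynomial (Fin n) ℤ),
      C D * X i ^ N = g * f + ∑ j, h j * pderiv j f)
    {K : Type*} [CommRing K] [IsDomain K] (hDK : (D : K) ≠ 0) (y : Fin n → K)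
    (h0 : aeval y f = 0) (h1 : ∀ j, aeval y (pderiv j f) = 0) : y = 0 := by
  funext i
  obtain ⟨g, h, hi⟩ := hD i
  have := congrArg (aeval y) hi
  simp only [map_mul, map_add, map_pow, aeval_X, h0, map_sum, h1, mul_zero, Finset.sum_const_zero,
    add_zero, aeval_C] at this
  simp only [algebraMap_int_eq, eq_intCast, mul_eq_zero, hDK, false_or] at this
  exact eq_zero_of_pow_eq_zero this

open MvPolynomial in
/-- The Schwartz–Zippel bound for the zeros of a nonzero form over `𝔽_p`. -/
theorem card_zeros_le {m d p : ℕ} [Fact p.Prime] {g : MvPolynomial (Fin m) (ZMod p)}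
    (hg : g.IsHomogeneous d) (hg0 : g ≠ 0) :
    Nat.card {y : Fin m → ZMod p // eval y g = 0} * p ≤ d * p ^ m := by
  classical
  have h := schwartz_zippel_totalDegree hg0 (Finset.univ : Finset (ZMod p))
  have hp : (0 : ℚ≥0) < p := by exact_mod_cast (Fact.out : p.Prime).pos
  rw [hg.totalDegree hg0] at h
  simp only [Fintype.piFinset_univ, Finset.card_univ, ZMod.card] at h
  rw [div_le_div_iff₀ (by positivity) hp] at h
  rw [Nat.card_eq_fintype_card, Fintype.card_subtype]
  exact_mod_cast h

open MvPolynomial in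
/-- The number of zeros modulo `p` of a form, when `p` is a prime of good reduction. -/
theorem card_zeros_mod_le {n d p : ℕ} [Fact p.Prime] (hn : 3 ≤ n)
    {f : MvPolynomial (Fin n) ℤ} (hf : f.IsHomogeneous d) {D : ℤ} {N : ℕ}
    (hD : ∀ i, ∃ (g : MvPolynomial (Fin n) ℤ) (h : Fin n → MvPolynomial (Fin n) ℤ),
      C D * X i ^ N = g * f + ∑ j, h j * pderiv j f)
    (hDp : (D : ZMod p) ≠ 0) :
    Nat.card {y : Fin n → ZMod p // aeval y f = 0} * p ≤ d * p ^ n := by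
  have hmap : ∀ y : Fin n → ZMod p, eval y (map (Int.castRingHom _) f) = aeval y f := by
    intro y
    rw [eval_map]
    rfl
  have h0 : map (Int.castRingHom (ZMod p)) f ≠ 0 := by
    intro h0
    have h1 : ∀ y : Fin n → ZMod p, aeval y f = 0 := fun y ↦ by rw [← hmap, h0, map_zero]
    have h2 : ∀ (y : Fin n → ZMod p) j, aeval y (pderiv j f) = 0 := fun y j ↦ by
      have : eval y (map (Int.castRingHom (ZMod p)) (pderiv j f)) = aeval y (pderiv j f) := by
        rw [eval_map]
        rfl
      rw [← this, ← pderiv_map, h0, map_zero, map_zero]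
    have := congrFun (eq_zero_of_singular hD hDp (fun _ ↦ 1) (h1 _) (h2 _)) ⟨0, by omega⟩
    simp at this
  have := card_zeros_le (hf.map (Int.castRingHom (ZMod p))) h0
  simpa only [hmap] using this

open MvPolynomial in
/-- The number of zeros modulo `p` of a form on a hyperplane, when `p` is a prime of good
reduction: the restriction of the form to the hyperplane is a nonzero form in one variable less. -/
theorem card_zeros_hyperplane_le {n d p : ℕ} [Fact p.Prime] (hn : 3 ≤ n) (hd : 2 ≤ d)
    {f : MvPolynomial (Fin n) ℤ} (hf : f.IsHomogeneous d) {D : ℤ} {N : ℕ}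
    (hD : ∀ i, ∃ (g : MvPolynomial (Fin n) ℤ) (h : Fin n → MvPolynomial (Fin n) ℤ),
      C D * X i ^ N = g * f + ∑ j, h j * pderiv j f)
    (hDp : (D : ZMod p) ≠ 0) {a : Fin n → ZMod p} (ha : a ≠ 0) :
    Nat.card {y : Fin n → ZMod p // aeval y f = 0 ∧ ∑ i, a i * y i = 0} * p ^ 2 ≤ d * p ^ n := by
  classical
  obtain ⟨m, rfl⟩ : ∃ m, n = m + 1 := ⟨n - 1, by omega⟩
  obtain ⟨i, hi⟩ : ∃ i, a i ≠ 0 := by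
    by_contra! h
    exact ha (funext h)
  -- The substitution `φ` eliminates the `i`-th variable by means of the equation of the hyperplane.
  let φ : Fin (m + 1) → MvPolynomial (Fin m) (ZMod p) :=
    i.insertNth (-∑ j, C (a (i.succAbove j) / a i) * X j) X
  have hφ : ∀ k, (φ k).IsHomogeneous 1 := by
    intro k
    refine Fin.succAboveCases i ?_ (fun j ↦ ?_) k
    · simp only [φ, Fin.insertNth_apply_same]
      exact (IsHomogeneous.sum _ _ _ fun j _ ↦ isHomogeneous_C_mul_X _ _).neg
    · simp only [φ, Fin.insertNth_apply_succAbove]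
      exact isHomogeneous_X _ _
  set g : MvPolynomial (Fin m) (ZMod p) := aeval φ f with hgdef
  have hg : g.IsHomogeneous d := by simpa using hf.aeval φ hφ
  have hgev : ∀ (K : Type) [Field K] [Algebra (ZMod p) K] (y : Fin (m + 1) → K),
      ∑ i, algebraMap _ K (a i) * y i = 0 →
      aeval (fun j ↦ y (i.succAbove j)) g = aeval y f := by
    intro K _ _ y hy
    have h1 : (aeval (fun j ↦ y (i.succAbove j)) : MvPolynomial (Fin m) (ZMod p) →ₐ[ZMod p] K) g =
      aeval (fun k ↦ aeval (fun j ↦ y (i.succAbove j)) (φ k)) f := by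
      rw [hgdef]
      have := map_aeval φ (aeval (fun j ↦ y (i.succAbove j)) :
        MvPolynomial (Fin m) (ZMod p) →ₐ[ZMod p] K).toRingHom f
      simp only [AlgHom.toRingHom_eq_coe, RingHom.coe_coe] at this
      rw [this, aeval_def, coe_eval₂Hom]
      congr 1
      exact RingHom.ext_int _ _
    rw [h1]
    congr 2
    funext k
    refine Fin.succAboveCases i ?_ (fun j ↦ ?_) k
    · have hi' : algebraMap (ZMod p) K (a i) ≠ 0 := by simpa using hi
      simp only [φ, Fin.insertNth_apply_same, map_neg, map_sum, map_mul, aeval_X, aeval_C, map_div₀]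
      rw [Fin.sum_univ_succAbove _ i] at hy
      rw [eq_comm, ← mul_right_inj' hi', eq_neg_of_add_eq_zero_left hy, mul_neg, Finset.mul_sum]
      congr 1
      refine Finset.sum_congr rfl fun j _ ↦ ?_
      field_simp
    · simp only [φ, Fin.insertNth_apply_succAbove, aeval_X]
  -- Over `𝔽_p` a nonzero form may vanish at all points, so the algebraic closure is needed here.
  have hg0 : g ≠ 0 := by
    intro h0
    let K := AlgebraicClosure (ZMod p)
    have hDK : (D : K) ≠ 0 := by
      rw [← map_intCast (algebraMap (ZMod p) K) D]
      exact (map_ne_zero_iff _ (algebraMap (ZMod p) K).injective).2 hDp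
    obtain ⟨y, hy, hy'⟩ := exists_aeval_ne_zero_of_mem_hyperplane hn hd hf
      (fun y ↦ eq_zero_of_singular hD hDK y) (a := fun j ↦ algebraMap (ZMod p) K (a j))
      (fun h ↦ hi (by simpa using congrFun h i))
    exact hy' (by rw [← hgev K y hy, h0, map_zero])
  have hcard : Nat.card {y : Fin (m + 1) → ZMod p // aeval y f = 0 ∧ ∑ i, a i * y i = 0} ≤
      Nat.card {z : Fin m → ZMod p // eval z g = 0} := by
    refine Nat.card_le_card_of_injective
      (fun y ↦ ⟨fun j ↦ y.1 (i.succAbove j), ?_⟩) ?_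
    · have := hgev (ZMod p) y.1 (by simpa using y.2.2)
      rwa [y.2.1, aeval_def, Algebra.algebraMap_self, eval₂_id] at this
    · rintro ⟨y, hy⟩ ⟨z, hz⟩ h
      have h' : ∀ j, y (i.succAbove j) = z (i.succAbove j) := fun j ↦
        congrFun (congrArg Subtype.val h) j
      ext k
      refine Fin.succAboveCases i ?_ (fun j ↦ h' j) k
      have h1 := hy.2
      rw [← hz.2, Fin.sum_univ_succAbove _ i, Fin.sum_univ_succAbove _ i] at h1
      simp only [h', add_left_inj] at h1
      exact mul_left_cancel₀ hi h1
  calc _ ≤ Nat.card {z : Fin m → ZMod p // eval z g = 0} * p ^ 2 := by gcongr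
    _ = (Nat.card {z : Fin m → ZMod p // eval z g = 0} * p) * p := by ring
    _ ≤ (d * p ^ m) * p := Nat.mul_le_mul_right _ (card_zeros_le hg hg0)
    _ = _ := by ring

/-! ### Haar measure on `ℚ_pⁿ` -/

section PadicMeasure

variable (p : ℕ) [hp : Fact p.Prime]

instance : (volume : Measure ℚ_[p]).IsAddHaarMeasure := Measure.isAddHaarMeasure_addHaarMeasure _

theorem one_lt_prime_real : (1 : ℝ) < p := by exact_mod_cast hp.out.one_lt

theorem norm_sub_le_max_padic (x y : ℚ_[p]) : ‖x - y‖ ≤ max ‖x‖ ‖y‖ := by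
  simpa [sub_eq_add_neg] using Padic.nonarchimedean x (-y)

theorem volume_padic_closedBall_one : volume (Metric.closedBall (0 : ℚ_[p]) 1) = 1 :=
  Measure.addHaarMeasure_self (K₀ := padicUnitBall p)

theorem volume_padic_closedBall_inv :
    (p : ENNReal) * volume (Metric.closedBall (0 : ℚ_[p]) (p : ℝ)⁻¹) = 1 := by
  have hp1 := one_lt_prime_real p
  rw [← volume_padic_closedBall_one p]
  have hU : Metric.closedBall (0 : ℚ_[p]) 1 =
      ⋃ r ∈ Finset.range p, (fun x ↦ -(r : ℚ_[p]) + x) ⁻¹' Metric.closedBall 0 (p : ℝ)⁻¹ := by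
    ext x
    simp only [Metric.mem_closedBall, dist_zero_right, Finset.mem_range, Set.mem_iUnion,
      Set.mem_preimage, exists_prop]
    constructor
    · intro hx
      refine ⟨PadicInt.zmodRepr ⟨x, hx⟩, PadicInt.zmodRepr_lt_p _, ?_⟩
      have h := PadicInt.norm_sub_zmodRepr_lt_one (⟨x, hx⟩ : ℤ_[p])
      rw [PadicInt.norm_def] at h
      have h2 := (Padic.norm_lt_pow_iff_norm_le_pow_sub_one _ 0).1 (h.trans_eq (zpow_zero _).symm)
      rw [neg_add_eq_sub]
      rw [zero_sub, zpow_neg_one] at h2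
      exact h2
    · rintro ⟨r, -, h⟩
      calc ‖x‖ = ‖(r : ℚ_[p]) + (-(r : ℚ_[p]) + x)‖ := by ring_nf
        _ ≤ max ‖(r : ℚ_[p])‖ ‖-(r : ℚ_[p]) + x‖ := Padic.nonarchimedean _ _
        _ ≤ 1 := max_le (by simpa using Padic.norm_int_le_one (p := p) r)
          (h.trans (inv_le_one_of_one_le₀ hp1.le))
  rw [hU, measure_biUnion_finset]
  · simp only [measure_preimage_add, Finset.sum_const, Finset.card_range, nsmul_eq_mul]
  · intro r hr s hs hrs
    refine Set.disjoint_left.2 fun x hx hx' ↦ hrs ?_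
    simp only [Set.mem_preimage, Metric.mem_closedBall, dist_zero_right] at hx hx'
    have h : ‖((r - s : ℤ) : ℚ_[p])‖ ≤ (p : ℝ) ^ (-(1 : ℕ) : ℤ) := by
      have : ((r - s : ℤ) : ℚ_[p]) = (-(s : ℚ_[p]) + x) - (-(r : ℚ_[p]) + x) := by push_cast; ring
      rw [this]
      simpa [zpow_neg] using (norm_sub_le_max_padic p _ _).trans (max_le hx' hx)
    rw [Padic.norm_int_le_pow_iff_dvd, pow_one] at h
    simp only [Finset.coe_range, Set.mem_Iio] at hr hs
    have := (Nat.modEq_iff_dvd.2 (by simpa using h) : s ≡ r [MOD p])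
    exact (Nat.ModEq.eq_of_lt_of_lt this hs hr).symm
  · intro r _
    exact Metric.isClosed_closedBall.measurableSet.preimage (measurable_const_add _)

variable (n : ℕ)

/-- The unit ball of `ℚ_pⁿ` for the maximum norm. -/
def padicUnitPolyball : TopologicalSpace.PositiveCompacts (Fin n → ℚ_[p]) where
  carrier := Metric.closedBall 0 1
  isCompact' := isCompact_closedBall 0 1
  interior_nonempty' :=
    ⟨0, mem_interior_iff_mem_nhds.2 (Metric.closedBall_mem_nhds 0 one_pos)⟩

theorem volume_pi_padic_closedBall_one :
    volume (Metric.closedBall (0 : Fin n → ℚ_[p]) 1) = 1 := by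
  rw [MeasureTheory.volume_pi_closedBall _ zero_le_one]
  simp [volume_padic_closedBall_one]

variable {n}

/-- Uniqueness of Haar measure on `ℚ_pⁿ`, normalized on `ℤ_pⁿ`. -/
theorem measure_padic_eq_smul (ν : Measure (Fin n → ℚ_[p])) [SigmaFinite ν]
    [ν.IsAddLeftInvariant] : ν = ν (Metric.closedBall 0 1) • volume := by
  have h1 := Measure.addHaarMeasure_unique ν (padicUnitPolyball p n)
  have h2 := Measure.addHaarMeasure_unique (volume : Measure (Fin n → ℚ_[p]))
    (padicUnitPolyball p n)
  have h3 : volume (padicUnitPolyball p n : Set (Fin n → ℚ_[p])) = 1 :=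
    volume_pi_padic_closedBall_one p n
  rw [h3, one_smul] at h2
  rw [← h2] at h1
  exact h1

theorem map_smul_padic_volume {c : ℚ_[p]} (hc : c ≠ 0) :
    Measure.map (fun x : Fin n → ℚ_[p] ↦ c • x) volume =
      volume (Metric.closedBall (0 : Fin n → ℚ_[p]) ‖c‖⁻¹) • volume := by
  have he : MeasurableEmbedding (fun x : Fin n → ℚ_[p] ↦ c • x) :=
    (Homeomorph.smulOfNeZero c hc).measurableEmbedding
  have hinv : (Measure.map (fun x : Fin n → ℚ_[p] ↦ c • x) volume).IsAddLeftInvariant := by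
    refine ⟨fun g ↦ ?_⟩
    rw [Measure.map_map (measurable_const_add g) he.measurable]
    have : (fun x ↦ g + x) ∘ (fun x : Fin n → ℚ_[p] ↦ c • x) =
        (fun x ↦ c • x) ∘ (fun x ↦ c⁻¹ • g + x) := by
      funext x
      simp [smul_add, smul_smul, mul_inv_cancel₀ hc]
    rw [this, ← Measure.map_map he.measurable (measurable_const_add _),
      map_add_left_eq_self]
  have hs : SigmaFinite (Measure.map (fun x : Fin n → ℚ_[p] ↦ c • x) volume) :=
    (Homeomorph.smulOfNeZero c hc).toMeasurableEquiv.sigmaFinite_map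
  conv_lhs => rw [measure_padic_eq_smul p (Measure.map (fun x : Fin n → ℚ_[p] ↦ c • x) volume)]
  rw [he.map_apply]
  congr 2
  ext x
  simp only [Set.mem_preimage, Metric.mem_closedBall, dist_zero_right, norm_smul]
  rw [← le_div_iff₀' (norm_pos_iff.2 hc), one_div]

theorem measurePreserving_smul_padic {c : ℚ_[p]} (hc : ‖c‖ = 1) :
    MeasurePreserving (fun x : Fin n → ℚ_[p] ↦ c • x) := by
  have hc0 : c ≠ 0 := by
    rintro rfl
    simp at hc
  refine ⟨measurable_const_smul c, ?_⟩
  rw [map_smul_padic_volume p hc0, hc, inv_one, volume_pi_padic_closedBall_one, one_smul]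

theorem volume_pi_padic_closedBall_inv :
    (p : ENNReal) ^ n * volume (Metric.closedBall (0 : Fin n → ℚ_[p]) (p : ℝ)⁻¹) = 1 := by
  rw [MeasureTheory.volume_pi_closedBall _ (by positivity)]
  simp [← mul_pow, volume_padic_closedBall_inv]

theorem norm_prime_pow (k : ℕ) : ‖(p : ℚ_[p]) ^ k‖ = ((p : ℝ) ^ k)⁻¹ := by
  rw [norm_pow, Padic.norm_p, inv_pow]

theorem prime_ne_zero_padic : (p : ℚ_[p]) ≠ 0 := by exact_mod_cast hp.out.ne_zero

/-- Change of variables for the dilation by `p ^ (-k)`. -/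
theorem lintegral_padic_dilation (k : ℕ) (g : (Fin n → ℚ_[p]) → ENNReal) :
    ∫⁻ x, g x = ((p : ENNReal) ^ n) ^ k * ∫⁻ y, g (((p : ℚ_[p]) ^ k)⁻¹ • y) := by
  have hp0 := prime_ne_zero_padic p
  have key : ∀ g : (Fin n → ℚ_[p]) → ENNReal,
      ∫⁻ x, g x = (p : ENNReal) ^ n * ∫⁻ y, g ((p : ℚ_[p])⁻¹ • y) := by
    intro g
    have he : MeasurableEmbedding (fun x : Fin n → ℚ_[p] ↦ (p : ℚ_[p])⁻¹ • x) :=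
      (Homeomorph.smulOfNeZero _ (inv_ne_zero hp0)).measurableEmbedding
    rw [← he.lintegral_map, map_smul_padic_volume p (inv_ne_zero hp0), lintegral_smul_measure,
      norm_inv, inv_inv, Padic.norm_p, smul_eq_mul, ← mul_assoc, volume_pi_padic_closedBall_inv,
      one_mul]
  induction k generalizing g with
  | zero => simp
  | succ k ih =>
    rw [ih, key, ← mul_assoc, ← pow_succ]
    simp only [smul_smul, pow_succ, mul_inv]

theorem exists_norm_apply_eq {E : Type*} [NormedAddCommGroup E] {x : Fin n → E} (hx : x ≠ 0) :
    ∃ i, ‖x i‖ = ‖x‖ := by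
  by_contra! h
  exact lt_irrefl _ ((pi_norm_lt_iff (norm_pos_iff.2 hx)).2 fun i ↦
    (norm_le_pi_norm x i).lt_of_ne (h i))

theorem exists_norm_eq_pow {x : Fin n → ℚ_[p]} (hx : 1 ≤ ‖x‖) : ∃ k : ℕ, ‖x‖ = (p : ℝ) ^ k := by
  have hp1 := one_lt_prime_real p
  obtain ⟨i, hi⟩ := exists_norm_apply_eq (show x ≠ 0 by rintro rfl; norm_num at hx)
  have hxi : x i ≠ 0 := by
    intro h
    rw [h, norm_zero] at hi
    linarith
  rw [Padic.norm_eq_zpow_neg_valuation hxi] at hi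
  rw [← hi] at hx ⊢
  have h0 : 0 ≤ -(x i).valuation := by
    rwa [← zpow_zero (p : ℝ), zpow_le_zpow_iff_right₀ hp1] at hx
  obtain ⟨k, hk⟩ := Int.eq_ofNat_of_zero_le h0
  exact ⟨k, by rw [hk]; simp⟩

theorem norm_aeval_le_one (f : MvPolynomial (Fin n) ℤ) {x : Fin n → ℚ_[p]} (hx : ‖x‖ ≤ 1) :
    ‖MvPolynomial.aeval x f‖ ≤ 1 := by
  have hx' : ∀ i, ‖x i‖ ≤ 1 := fun i ↦ (norm_le_pi_norm x i).trans hx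
  induction f using MvPolynomial.induction_on with
  | C c => simpa using Padic.norm_int_le_one c
  | add f g hf hg => rw [map_add]; exact (Padic.nonarchimedean _ _).trans (max_le hf hg)
  | mul_X f i hf =>
    rw [map_mul, MvPolynomial.aeval_X, norm_mul]
    exact mul_le_one₀ hf (norm_nonneg _) (hx' i)

end PadicMeasure

/-! ### The standard character of `ℚ_p` -/

section Character

variable (p : ℕ) [hp : Fact p.Prime]

/-- An element of `ℤ[1/p]` that is `p`-adically integral is an integer. -/
theorem isInt_of_norm_le_one {r : ℚ} {m : ℤ} {k : ℕ} (hr : r = m / (p : ℚ) ^ k)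
    (h : ‖(r : ℚ_[p])‖ ≤ 1) : ∃ j : ℤ, r = j := by
  have hp0 : (p : ℚ) ≠ 0 := by exact_mod_cast hp.out.ne_zero
  have h1 : ‖(m : ℚ_[p])‖ ≤ (p : ℝ) ^ (-k : ℤ) := by
    have : (m : ℚ_[p]) = (p : ℚ_[p]) ^ k * (r : ℚ_[p]) := by
      rw [hr]
      push_cast
      rw [mul_div_cancel₀ _ (pow_ne_zero _ (prime_ne_zero_padic p))]
    rw [this, norm_mul, norm_prime_pow, zpow_neg, zpow_natCast]
    exact mul_le_of_le_one_right (by positivity) h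
  rw [Padic.norm_int_le_pow_iff_dvd] at h1
  obtain ⟨j, hj⟩ := h1
  refine ⟨j, ?_⟩
  rw [hr, hj]
  push_cast
  field_simp

theorem padicFract_spec (x : ℚ_[p]) : 0 ≤ padicFract p x ∧ padicFract p x < 1 ∧
    (∃ (m : ℤ) (k : ℕ), padicFract p x = m / (p : ℚ) ^ k) ∧
      ‖x - (padicFract p x : ℚ_[p])‖ ≤ 1 :=
  (exists_padicFract p x).choose_spec

/-- The character may be computed from any representative of `x` modulo `ℤ_p` in `ℤ[1/p]`, not only
from the fractional part. -/
theorem psiPadic_eq_of_sub (x : ℚ_[p]) {r : ℚ} {m : ℤ} {k : ℕ} (hr : r = m / (p : ℚ) ^ k)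
    (h : ‖x - (r : ℚ_[p])‖ ≤ 1) :
    psiPadic p x = Complex.exp (2 * Real.pi * Complex.I * (r : ℂ)) := by
  have hp0 : (p : ℚ) ≠ 0 := by exact_mod_cast hp.out.ne_zero
  obtain ⟨-, -, ⟨m', k', h3⟩, h4⟩ := padicFract_spec p x
  obtain ⟨j, hj⟩ : ∃ j : ℤ, padicFract p x - r = j := by
    refine isInt_of_norm_le_one p (m := m' * p ^ k - m * p ^ k') (k := k' + k) ?_ ?_
    · rw [h3, hr]
      push_cast
      field_simp
      ring
    · have : ((padicFract p x - r : ℚ) : ℚ_[p]) = (x - r) - (x - padicFract p x) := by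
        push_cast
        ring
      rw [this]
      exact (norm_sub_le_max_padic p _ _).trans (max_le h h4)
  have : padicFract p x = r + j := by linarith
  rw [psiPadic, this]
  push_cast
  rw [mul_add, Complex.exp_add, mul_comm (2 * (Real.pi : ℂ) * Complex.I) (j : ℂ),
    Complex.exp_int_mul_two_pi_mul_I, mul_one]

theorem psiPadic_add (x y : ℚ_[p]) : psiPadic p (x + y) = psiPadic p x * psiPadic p y := by
  have hp0 : (p : ℚ) ≠ 0 := by exact_mod_cast hp.out.ne_zero
  obtain ⟨-, -, ⟨m, k, h3⟩, h4⟩ := padicFract_spec p x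
  obtain ⟨-, -, ⟨m', k', h3'⟩, h4'⟩ := padicFract_spec p y
  rw [psiPadic_eq_of_sub p (x + y) (r := padicFract p x + padicFract p y)
    (m := m * p ^ k' + m' * p ^ k) (k := k + k'), psiPadic, psiPadic, ← Complex.exp_add]
  · push_cast
    ring_nf
  · rw [h3, h3']
    push_cast
    field_simp
    ring
  · have : x + y - ((padicFract p x + padicFract p y : ℚ) : ℚ_[p]) =
      (x - padicFract p x) + (y - padicFract p y) := by
      push_cast
      ring
    rw [this]
    exact (Padic.nonarchimedean _ _).trans (max_le h4 h4')

theorem psiPadic_eq_one {x : ℚ_[p]} (hx : ‖x‖ ≤ 1) : psiPadic p x = 1 := by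
  rw [psiPadic_eq_of_sub p x (r := 0) (m := 0) (k := 0) (by simp) (by simpa using hx)]
  simp

theorem psiPadic_ne_one {x : ℚ_[p]} (hx : 1 < ‖x‖) : psiPadic p x ≠ 1 := by
  obtain ⟨h1, h2, -, h4⟩ := padicFract_spec p x
  intro h
  rw [psiPadic, Complex.exp_eq_one_iff] at h
  obtain ⟨j, hj⟩ := h
  have h5 : (padicFract p x : ℂ) = (j : ℂ) := by
    have : (2 * Real.pi * Complex.I : ℂ) ≠ 0 := Complex.two_pi_I_ne_zero
    rw [mul_comm] at hj
    exact mul_right_cancel₀ this hj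
  have h6 : padicFract p x = j := by exact_mod_cast h5
  rw [h6] at h4
  push_cast at h4
  have : ‖x‖ ≤ 1 := by
    calc ‖x‖ = ‖(x - (j : ℚ_[p])) + (j : ℚ_[p])‖ := by ring_nf
      _ ≤ _ := Padic.nonarchimedean _ _
      _ ≤ 1 := max_le h4 (Padic.norm_int_le_one j)
  linarith

theorem norm_psiPadic (x : ℚ_[p]) : ‖psiPadic p x‖ = 1 := by
  rw [psiPadic, Complex.norm_exp]
  simp

theorem continuous_psiPadic : Continuous (psiPadic p) := by
  rw [continuous_iff_continuousAt]
  intro x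
  refine ContinuousAt.congr (f := fun _ ↦ psiPadic p x) continuousAt_const ?_
  filter_upwards [Metric.closedBall_mem_nhds x one_pos] with y hy
  have : y = x + (y - x) := by ring
  rw [this, psiPadic_add, psiPadic_eq_one p (x := y - x) (by simpa [dist_eq_norm] using hy),
    mul_one]

theorem psiPadic_natCast_mul (l : ℕ) (x : ℚ_[p]) : psiPadic p (l * x) = psiPadic p x ^ l := by
  induction l with
  | zero => simp [psiPadic_eq_one]
  | succ l ih => rw [Nat.cast_succ, add_mul, one_mul, psiPadic_add, ih, pow_succ]

/-- The character `l ↦ ψ_p(l x)` of `ℤ / p` is nontrivial, so it sums to zero. -/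
theorem sum_psiPadic {x : ℚ_[p]} (hx : ‖x‖ = p) :
    ∑ l ∈ Finset.range p, psiPadic p (l * x) = 0 := by
  have h1 : psiPadic p x ≠ 1 := psiPadic_ne_one p (by rw [hx]; exact one_lt_prime_real p)
  have h2 : psiPadic p x ^ p = 1 := by
    rw [← psiPadic_natCast_mul]
    refine psiPadic_eq_one p ?_
    rw [norm_mul, Padic.norm_p, hx, inv_mul_cancel₀]
    exact_mod_cast hp.out.ne_zero
  simp only [psiPadic_natCast_mul]
  rw [geom_sum_eq h1, h2, sub_self, zero_div]

end Character

/-! ### Volumes of `p`-adic tubes -/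

section PadicVolume

variable (p : ℕ) [hp : Fact p.Prime] {n : ℕ}

open MvPolynomial in
/-- The smoothness identity on the unit sphere: where `f` is `p`-adically smaller than `D`,
some partial derivative is at least as large as `D`. -/
theorem exists_le_norm_pderiv {f : MvPolynomial (Fin n) ℤ} {D : ℤ} {N c : ℕ}
    (hD : ∀ i, ∃ (g : MvPolynomial (Fin n) ℤ) (h : Fin n → MvPolynomial (Fin n) ℤ),
      C D * X i ^ N = g * f + ∑ j, h j * pderiv j f)
    (hc : ‖(D : ℚ_[p])‖ = (p : ℝ) ^ (-c : ℤ)) {y : Fin n → ℚ_[p]} (hy : ‖y‖ = 1)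
    (hfy : ‖aeval y f‖ < (p : ℝ) ^ (-c : ℤ)) :
    ∃ i, (p : ℝ) ^ (-c : ℤ) ≤ ‖aeval y (pderiv i f)‖ := by
  by_contra! hcon
  obtain ⟨k, hk⟩ := exists_norm_apply_eq (show y ≠ 0 by rintro rfl; simp at hy)
  rw [hy] at hk
  obtain ⟨g, h, hi⟩ := hD k
  have h1 := congrArg (fun q ↦ ‖aeval y q‖) hi
  simp only [map_mul, map_add, map_pow, aeval_X, map_sum, norm_mul, norm_pow, hk,
    one_pow, mul_one, eq_intCast, map_intCast, hc] at h1
  have hlt : ∀ q r : MvPolynomial (Fin n) ℤ, ‖aeval y q‖ < (p : ℝ) ^ (-c : ℤ) →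
      ‖aeval y r * aeval y q‖ ≤ (p : ℝ) ^ (-c - 1 : ℤ) := by
    intro q r hq
    rw [Padic.norm_lt_pow_iff_norm_le_pow_sub_one] at hq
    rw [norm_mul]
    exact (mul_le_of_le_one_left (norm_nonneg _) (norm_aeval_le_one p r hy.le)).trans hq
  have h2 : ‖aeval y g * aeval y f + ∑ j, aeval y (h j) * aeval y (pderiv j f)‖ ≤
      (p : ℝ) ^ (-c - 1 : ℤ) := by
    refine (Padic.nonarchimedean _ _).trans (max_le (hlt _ _ hfy) ?_)
    refine IsUltrametricDist.norm_sum_le_of_forall_le_of_nonneg (by positivity) fun j _ ↦ ?_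
    exact hlt _ _ (hcon j)
  rw [← h1, zpow_le_zpow_iff_right₀ (one_lt_prime_real p)] at h2
  omega

open MvPolynomial in
/-- Where a partial derivative is bounded below, points on a short segment in its direction at
which the form is small must be close to each other. -/
theorem norm_increment_le (f : MvPolynomial (Fin n) ℤ) (i : Fin n) {c j : ℕ}
    {y : Fin n → ℚ_[p]} (hy : ‖y‖ ≤ 1) {t : ℚ_[p]} (ht : ‖t‖ ≤ (p : ℝ) ^ (-c - 1 : ℤ))
    (hd : (p : ℝ) ^ (-c : ℤ) ≤ ‖aeval y (pderiv i f)‖)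
    (h0 : ‖aeval y f‖ ≤ (p : ℝ) ^ (-j : ℤ))
    (h1 : ‖aeval (y + Pi.single i t) f‖ ≤ (p : ℝ) ^ (-j : ℤ)) :
    ‖t‖ ≤ (p : ℝ) ^ (c - j : ℤ) := by
  have hp1 := one_lt_prime_real p
  have hp0 : (0 : ℝ) < p := by linarith
  rcases eq_or_ne t 0 with rfl | ht0
  · rw [norm_zero]; positivity
  have htpos : 0 < ‖t‖ := norm_pos_iff.2 ht0
  obtain ⟨r, hr⟩ := exists_taylor_remainder f i
  have ht1 : ‖t‖ ≤ 1 := ht.trans (zpow_le_one_of_nonpos₀ hp1.le (by omega))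
  -- the remainder is an integral polynomial, so it has integral values
  have hr1 : ‖aeval (fun o : Option (Fin n) ↦ o.elim t y) r‖ ≤ 1 := by
    have hx : ∀ o : Option (Fin n), ‖o.elim t y‖ ≤ 1 := by
      rintro (_ | o)
      · exact ht1
      · exact (norm_le_pi_norm y o).trans hy
    clear hr
    induction r using MvPolynomial.induction_on with
    | C c => simpa using Padic.norm_int_le_one c
    | add f g hf hg => rw [map_add]; exact (Padic.nonarchimedean _ _).trans (max_le hf hg)
    | mul_X f i hf =>
      rw [map_mul, aeval_X, norm_mul]
      exact mul_le_one₀ hf (norm_nonneg _) (hx i)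
  have hT : t * aeval y (pderiv i f) = (aeval (y + Pi.single i t) f - aeval y f) -
      t ^ 2 * aeval (fun o : Option (Fin n) ↦ o.elim t y) r := by
    rw [hr _ y t]
    ring
  have h2 : ‖t‖ * (p : ℝ) ^ (-c : ℤ) ≤ max ((p : ℝ) ^ (-j : ℤ)) (‖t‖ ^ 2) := by
    calc _ ≤ ‖t‖ * ‖aeval y (pderiv i f)‖ := by gcongr
      _ = ‖t * aeval y (pderiv i f)‖ := (norm_mul _ _).symm
      _ ≤ _ := by
        rw [hT]
        refine (norm_sub_le_max_padic p _ _).trans (max_le_max ?_ ?_)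
        · exact (norm_sub_le_max_padic p _ _).trans (max_le h1 h0)
        · rw [norm_mul, norm_pow]
          exact mul_le_of_le_one_right (by positivity) hr1
  rcases le_max_iff.1 h2 with h3 | h3
  · rw [sub_eq_add_neg, zpow_add₀ hp0.ne']
    rw [← div_le_iff₀' (by positivity), div_eq_mul_inv, ← zpow_neg]
    simpa using h3
  · exfalso
    rw [pow_two] at h3
    have h4 := (le_of_mul_le_mul_left h3 htpos).trans ht
    rw [zpow_le_zpow_iff_right₀ hp1] at h4
    omega

/-- The points of the unit sphere of `ℚ_pⁿ` at which the form is at most `p ^ (-j)`. -/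
def padicTube (f : MvPolynomial (Fin n) ℤ) (j : ℕ) : Set (Fin n → ℚ_[p]) :=
  {y | ‖y‖ = 1 ∧ ‖MvPolynomial.aeval y f‖ ≤ (p : ℝ) ^ (-j : ℤ)}

theorem continuous_aeval_padic (f : MvPolynomial (Fin n) ℤ) :
    Continuous fun y : Fin n → ℚ_[p] ↦ MvPolynomial.aeval y f := by
  simp only [MvPolynomial.aeval_def, MvPolynomial.eval₂_eq]
  fun_prop

theorem measurableSet_padicTube (f : MvPolynomial (Fin n) ℤ) (j : ℕ) :
    MeasurableSet (padicTube p f j) :=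
  ((isClosed_eq continuous_norm continuous_const).inter
    (isClosed_le (continuous_aeval_padic p f).norm continuous_const)).measurableSet

open MvPolynomial in
/-- Disjoint translates of a tube in the direction of a large partial derivative bound its
volume. -/
theorem volume_padicTube_inter_le {f : MvPolynomial (Fin n) ℤ} {D : ℤ} {N c : ℕ}
    (hD : ∀ i, ∃ (g : MvPolynomial (Fin n) ℤ) (h : Fin n → MvPolynomial (Fin n) ℤ),
      C D * X i ^ N = g * f + ∑ j, h j * pderiv j f)
    (hc : ‖(D : ℚ_[p])‖ = (p : ℝ) ^ (-c : ℤ)) {V : Set (Fin n → ℚ_[p])} (hVm : MeasurableSet V)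
    (hV1 : V ⊆ Metric.closedBall 0 1)
    (hV : ∀ y ∈ V, ∀ i, ∀ t : ℚ_[p], ‖t‖ ≤ (p : ℝ) ^ (-c - 1 : ℤ) → y + Pi.single i t ∈ V)
    (m : ℕ) :
    (p : ENNReal) ^ m * volume (padicTube p f (m + (2 * c + 1)) ∩ V) ≤ n * volume V := by
  have hp1 := one_lt_prime_real p
  have hp0 : (0 : ℝ) < p := by linarith
  set j := m + (2 * c + 1) with hj
  let B : Fin n → Set (Fin n → ℚ_[p]) := fun i ↦ V ∩ ({y | ‖aeval y f‖ ≤ (p : ℝ) ^ (-j : ℤ)} ∩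
    {y | (p : ℝ) ^ (-c : ℤ) ≤ ‖aeval y (pderiv i f)‖})
  have hBm : ∀ i, MeasurableSet (B i) := fun i ↦ hVm.inter
    ((isClosed_le (continuous_aeval_padic p f).norm continuous_const).inter
      (isClosed_le continuous_const (continuous_aeval_padic p _).norm)).measurableSet
  have hsub : padicTube p f j ∩ V ⊆ ⋃ i, B i := by
    rintro y ⟨⟨hy1, hy2⟩, hyV⟩
    obtain ⟨i, hi⟩ := exists_le_norm_pderiv p hD hc hy1 (hy2.trans_lt (by
      rw [zpow_lt_zpow_iff_right₀ hp1]; omega))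
    exact Set.mem_iUnion.2 ⟨i, hyV, hy2, hi⟩
  have hB : ∀ i, (p : ENNReal) ^ m * volume (B i) ≤ volume V := by
    intro i
    -- The translations by `l p ^ (c + 1)` for `l < p ^ m` are short enough for `norm_increment_le`,
    -- which shows that the translates are disjoint.
    let v : ℕ → Fin n → ℚ_[p] := fun l ↦ Pi.single i ((l : ℚ_[p]) * (p : ℚ_[p]) ^ (c + 1))
    have hnorm : ∀ x : ℚ_[p], ‖x * (p : ℚ_[p]) ^ (c + 1)‖ = ‖x‖ * (p : ℝ) ^ (-c - 1 : ℤ) := by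
      intro x
      rw [norm_mul, norm_prime_pow, ← zpow_natCast, ← zpow_neg]
      congr 2
      push_cast
      ring
    have hsum : ∑ l ∈ Finset.range (p ^ m), volume ((fun x ↦ -v l + x) ⁻¹' B i) ≤ volume V := by
      rw [← measure_biUnion_finset]
      · refine measure_mono (Set.iUnion₂_subset fun l _ x hx ↦ ?_)
        have h := hV _ hx.1 i ((l : ℚ_[p]) * (p : ℚ_[p]) ^ (c + 1)) (by
          rw [hnorm]
          exact mul_le_of_le_one_left (by positivity)
            (by simpa using Padic.norm_int_le_one (p := p) l))
        simpa [v, add_comm] using h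
      · intro l hl l' hl' hll
        refine Set.disjoint_left.2 fun x hx hx' ↦ hll ?_
        simp only [Set.mem_preimage] at hx hx'
        have hy' : -v l' + x = (-v l + x) +
            Pi.single i (((l - l' : ℤ) : ℚ_[p]) * (p : ℚ_[p]) ^ (c + 1)) := by
          funext k
          by_cases hk : k = i
          · subst hk; simp [v]; ring
          · simp [v, hk]
        have h3 := hx'.2.1
        rw [Set.mem_ofPred_eq, hy'] at h3
        have h := norm_increment_le p f i (c := c) (j := j) (by simpa using hV1 hx.1) (by
          rw [hnorm]
          exact mul_le_of_le_one_left (by positivity) (Padic.norm_int_le_one _)) hx.2.2 hx.2.1 h3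
        rw [hnorm, ← le_div_iff₀ (by positivity), ← zpow_sub₀ hp0.ne',
          show (c - j - (-c - 1) : ℤ) = -(m : ℤ) by rw [hj]; push_cast; ring,
          Padic.norm_int_le_pow_iff_dvd] at h
        simp only [Finset.coe_range, Set.mem_Iio] at hl hl'
        have := (Nat.modEq_iff_dvd.2 (by simpa using h) : l' ≡ l [MOD p ^ m])
        exact (Nat.ModEq.eq_of_lt_of_lt this hl' hl).symm
      · intro l _
        exact (hBm i).preimage (measurable_const_add _)
    simpa only [measure_preimage_add, Finset.sum_const, Finset.card_range, nsmul_eq_mul,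
      Nat.cast_pow] using hsum
  calc (p : ENNReal) ^ m * volume (padicTube p f j ∩ V)
      ≤ (p : ENNReal) ^ m * ∑ i, volume (B i) := by
        gcongr
        exact (measure_mono hsub).trans (measure_iUnion_fintype_le _ _)
    _ = ∑ i, (p : ENNReal) ^ m * volume (B i) := Finset.mul_sum _ _ _
    _ ≤ ∑ i : Fin n, volume V := Finset.sum_le_sum fun i _ ↦ hB i
    _ = n * volume V := by simp

/-- Each residue class modulo `p` in `ℤ_pⁿ` has volume `p ^ (-n)`. -/
theorem volume_le_card_reductions (T : Set (Fin n → ZMod p)) {V : Set (Fin n → ℚ_[p])}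
    (hV : ∀ y ∈ V, ∃ z : Fin n → ℤ_[p], (∀ i, y i = z i) ∧ (fun i ↦ PadicInt.toZMod (z i)) ∈ T) :
    (p : ENNReal) ^ n * volume V ≤ Nat.card T := by
  classical
  have hfin : Fintype T := Fintype.ofFinite T
  let w : (Fin n → ZMod p) → Fin n → ℚ_[p] := fun t i ↦ ((t i).val : ℚ_[p])
  have hsub : V ⊆ ⋃ t : T, (fun x ↦ -w t + x) ⁻¹' Metric.closedBall 0 (p : ℝ)⁻¹ := by
    intro y hy
    obtain ⟨z, hz, hT⟩ := hV y hy
    refine Set.mem_iUnion.2 ⟨⟨_, hT⟩, ?_⟩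
    simp only [Set.mem_preimage, Metric.mem_closedBall, dist_zero_right]
    rw [pi_norm_le_iff_of_nonneg (by positivity)]
    intro i
    have h := PadicInt.norm_sub_zmodRepr_lt_one (z i)
    rw [PadicInt.norm_def] at h
    have h2 := (Padic.norm_lt_pow_iff_norm_le_pow_sub_one _ 0).1 (h.trans_eq (zpow_zero _).symm)
    rw [zero_sub, zpow_neg_one] at h2
    simp only [w, Pi.add_apply, Pi.neg_apply, PadicInt.val_toZMod_eq_zmodRepr]
    rw [neg_add_eq_sub, hz i]
    exact h2
  calc (p : ENNReal) ^ n * volume V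
      ≤ (p : ENNReal) ^ n * ∑ t : T, volume (Metric.closedBall (0 : Fin n → ℚ_[p]) (p : ℝ)⁻¹) := by
        gcongr
        refine (measure_mono hsub).trans ((measure_iUnion_fintype_le _ _).trans_eq ?_)
        simp only [measure_preimage_add]
    _ = Nat.card T := by
        rw [Finset.sum_const, Finset.card_univ, ← Nat.card_eq_fintype_card, nsmul_eq_mul,
          mul_left_comm, volume_pi_padic_closedBall_inv, mul_one]

open MvPolynomial in
/-- Small values of an integral polynomial at an integral point are zeros of its reduction. -/
theorem aeval_toZMod_eq_zero (f : MvPolynomial (Fin n) ℤ) {y : Fin n → ℚ_[p]}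
    {z : Fin n → ℤ_[p]} (hz : ∀ i, y i = z i) (h : ‖aeval y f‖ < 1) :
    aeval (fun i ↦ PadicInt.toZMod (z i)) f = 0 := by
  have h1 : aeval y f = ((aeval z f : ℤ_[p]) : ℚ_[p]) := by
    have := map_aeval z PadicInt.Coe.ringHom f
    rw [show ((aeval z f : ℤ_[p]) : ℚ_[p]) = PadicInt.Coe.ringHom (aeval z f) from rfl, this,
      funext hz, aeval_def, coe_eval₂Hom]
    congr 1
  have h2 : PadicInt.toZMod (aeval z f) = aeval (fun i ↦ PadicInt.toZMod (z i)) f := by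
    rw [map_aeval, aeval_def, coe_eval₂Hom]
    congr 1
    exact RingHom.ext_int _ _
  rw [← h2, ← RingHom.mem_ker, PadicInt.ker_toZMod]
  rw [h1] at h
  exact PadicInt.mem_nonunits.2 h

end PadicVolume

/-! ### Tubes at good primes -/

section PadicIntegral

variable (p : ℕ) [hp : Fact p.Prime] {n : ℕ}

theorem exists_padicInt_lift {y : Fin n → ℚ_[p]} (hy : ‖y‖ ≤ 1) :
    ∃ z : Fin n → ℤ_[p], ∀ i, y i = z i :=
  ⟨fun i ↦ ⟨y i, (norm_le_pi_norm y i).trans hy⟩, fun _ ↦ rfl⟩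

theorem ennreal_le_of_pow_mul_le {m k l B : ℕ} {v : ENNReal}
    (h : (p : ENNReal) ^ m * v ≤ B) (hB : B * p ^ k ≤ l * p ^ m) :
    (p : ENNReal) ^ k * v ≤ l := by
  have h0 : (p : ENNReal) ^ m ≠ 0 := pow_ne_zero _ (by exact_mod_cast hp.out.ne_zero)
  have h1 : (p : ENNReal) ^ m ≠ ⊤ := ENNReal.pow_ne_top (ENNReal.natCast_ne_top p)
  rw [← ENNReal.mul_le_mul_iff_right h0 h1]
  calc (p : ENNReal) ^ m * (p ^ k * v) = p ^ k * (p ^ m * v) := by ring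
    _ ≤ p ^ k * B := by gcongr
    _ ≤ p ^ m * l := by
      rw [mul_comm, mul_comm ((p : ENNReal) ^ m)]
      exact_mod_cast hB

theorem norm_aeval_sub_aeval_le (f : MvPolynomial (Fin n) ℤ) {x y : Fin n → ℚ_[p]}
    (hx : ‖x‖ ≤ 1) (hy : ‖y‖ ≤ 1) :
    ‖MvPolynomial.aeval x f - MvPolynomial.aeval y f‖ ≤ ‖x - y‖ := by
  induction f using MvPolynomial.induction_on with
  | C c => simp
  | add f g hf hg =>
    rw [map_add, map_add, add_sub_add_comm]
    exact (Padic.nonarchimedean _ _).trans (max_le hf hg)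
  | mul_X f i hf =>
    have h : ∀ a b c d : ℚ_[p], a * c - b * d = (a - b) * c + b * (c - d) := by intros; ring
    rw [map_mul, map_mul, MvPolynomial.aeval_X, MvPolynomial.aeval_X, h]
    refine (Padic.nonarchimedean _ _).trans (max_le ?_ ?_)
    · rw [norm_mul]
      exact (mul_le_of_le_one_right (norm_nonneg _) ((norm_le_pi_norm x i).trans hx)).trans hf
    · rw [norm_mul]
      exact (mul_le_of_le_one_left (norm_nonneg _) (norm_aeval_le_one p f hy)).trans
        (norm_le_pi_norm (x - y) i)

theorem norm_aeval_lt_one_of_norm_sub_lt_one (f : MvPolynomial (Fin n) ℤ) {x y : Fin n → ℚ_[p]}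
    (hx : ‖x‖ ≤ 1) (hy : ‖y‖ ≤ 1) (hxy : ‖x - y‖ < 1) (h : ‖MvPolynomial.aeval y f‖ < 1) :
    ‖MvPolynomial.aeval x f‖ < 1 := by
  rw [← sub_add_cancel (MvPolynomial.aeval x f) (MvPolynomial.aeval y f)]
  exact (Padic.nonarchimedean _ _).trans_lt
    (max_lt ((norm_aeval_sub_aeval_le p f hx hy).trans_lt hxy) h)

/-- The norm of `D` at a good prime, in the form `p ^ (-c)` with `c = 0` required by
`volume_padicTube_inter_le`. -/
theorem norm_eq_one_of_good {D : ℤ} (hDp : (D : ZMod p) ≠ 0) :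
    ‖(D : ℚ_[p])‖ = (p : ℝ) ^ (-(0 : ℕ) : ℤ) := by
  have h1 : ¬ ‖(D : ℚ_[p])‖ < 1 := by
    rw [Padic.norm_intCast_lt_one_iff]
    rwa [Ne, ZMod.intCast_zmod_eq_zero_iff_dvd] at hDp
  simpa using le_antisymm (Padic.norm_int_le_one D) (not_lt.1 h1)

open MvPolynomial in
/-- At a prime of good reduction, the volume of the part of a tube on which another polynomial
`l` vanishes modulo `p` is controlled by the number of common zeros modulo `p`. -/
theorem volume_padicTube_inter_le_of_card {f l : MvPolynomial (Fin n) ℤ} {D : ℤ} {N d s : ℕ}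
    (hD : ∀ i, ∃ (g : MvPolynomial (Fin n) ℤ) (h : Fin n → MvPolynomial (Fin n) ℤ),
      C D * X i ^ N = g * f + ∑ j, h j * pderiv j f)
    (hDp : (D : ZMod p) ≠ 0)
    (hcard : Nat.card {y : Fin n → ZMod p // aeval y f = 0 ∧ aeval y l = 0} * p ^ s ≤ d * p ^ n)
    {j : ℕ} (hj : 1 ≤ j) :
    (p : ENNReal) ^ (j - 1) * (p ^ s * volume (padicTube p f j ∩ {y | ‖aeval y l‖ < 1})) ≤
      (n * d : ℕ) := by
  obtain ⟨m, rfl⟩ : ∃ m, j = m + 1 := ⟨j - 1, by omega⟩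
  set V : Set (Fin n → ℚ_[p]) := Metric.closedBall 0 1 ∩
    ({y | ‖aeval y f‖ < 1} ∩ {y | ‖aeval y l‖ < 1}) with hV
  have hVm : MeasurableSet V := Metric.isClosed_closedBall.measurableSet.inter
    ((isOpen_lt (continuous_aeval_padic p f).norm continuous_const).inter
      (isOpen_lt (continuous_aeval_padic p l).norm continuous_const)).measurableSet
  have hV2 : (p : ENNReal) ^ s * volume V ≤ d := by
    refine ennreal_le_of_pow_mul_le p (volume_le_card_reductions p
      {t : Fin n → ZMod p | aeval t f = 0 ∧ aeval t l = 0} ?_) hcard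
    rintro y ⟨hy1, hy2, hy3⟩
    obtain ⟨z, hz⟩ := exists_padicInt_lift p (y := y) (by simpa using hy1)
    exact ⟨z, hz, aeval_toZMod_eq_zero p f hz hy2, aeval_toZMod_eq_zero p l hz hy3⟩
  have hmain := volume_padicTube_inter_le p hD (norm_eq_one_of_good p hDp) hVm
    Set.inter_subset_left (by
    rintro y ⟨hy1, hy2, hy3⟩ i t ht
    have hp1 := inv_lt_one_of_one_lt₀ (one_lt_prime_real p)
    have ht1 : ‖(Pi.single i t : Fin n → ℚ_[p])‖ < 1 := by
      rw [Pi.norm_single]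
      refine ht.trans_lt ?_
      simpa using hp1
    have hy1' : ‖y‖ ≤ 1 := by simpa using hy1
    have hyt : ‖y + Pi.single i t‖ ≤ 1 :=
      (IsUltrametricDist.norm_add_le_max _ _).trans (max_le hy1' ht1.le)
    exact ⟨by simpa using hyt,
      norm_aeval_lt_one_of_norm_sub_lt_one p f hyt hy1' (by simpa using ht1) hy2,
      norm_aeval_lt_one_of_norm_sub_lt_one p l hyt hy1' (by simpa using ht1) hy3⟩) m
  have hsub : padicTube p f (m + 1) ∩ {y | ‖aeval y l‖ < 1} ⊆
      padicTube p f (m + (2 * 0 + 1)) ∩ V := by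
    rintro y ⟨hy1, hy2⟩
    refine ⟨hy1, by simpa using hy1.1.le, hy1.2.trans_lt ?_, hy2⟩
    rw [← zpow_zero (p : ℝ), zpow_lt_zpow_iff_right₀ (one_lt_prime_real p)]
    omega
  calc _ ≤ (p : ENNReal) ^ m * (p ^ s * volume (padicTube p f (m + (2 * 0 + 1)) ∩ V)) := by
        rw [Nat.add_sub_cancel]
        gcongr
    _ = p ^ s * ((p : ENNReal) ^ m * volume (padicTube p f (m + (2 * 0 + 1)) ∩ V)) := by ring
    _ ≤ p ^ s * (n * volume V) := by gcongr
    _ = n * (p ^ s * volume V) := by ring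
    _ ≤ n * d := by gcongr
    _ = (n * d : ℕ) := by push_cast; rfl

/-- The linear form with given integral coefficients. -/
noncomputable def linForm (a : Fin n → ℤ) : MvPolynomial (Fin n) ℤ :=
  ∑ i, MvPolynomial.C (a i) * MvPolynomial.X i

theorem aeval_linForm {R : Type*} [CommRing R] (a : Fin n → ℤ) (y : Fin n → R) :
    MvPolynomial.aeval y (linForm a) = ∑ i, (a i : R) * y i := by
  simp [linForm]

open MvPolynomial in
/-- At a prime of good reduction, the tube of radius `p ^ (-j)` has volume `O(p ^ (-j))`, uniformly
in `p`. -/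
theorem volume_padicTube_le {d : ℕ} (hn : 3 ≤ n) {f : MvPolynomial (Fin n) ℤ}
    (hf : f.IsHomogeneous d) {D : ℤ} {N : ℕ}
    (hD : ∀ i, ∃ (g : MvPolynomial (Fin n) ℤ) (h : Fin n → MvPolynomial (Fin n) ℤ),
      C D * X i ^ N = g * f + ∑ j, h j * pderiv j f)
    (hDp : (D : ZMod p) ≠ 0) {j : ℕ} (hj : 1 ≤ j) :
    (p : ENNReal) ^ j * volume (padicTube p f j) ≤ (n * d : ℕ) := by
  have h := volume_padicTube_inter_le_of_card p (l := 0) (d := d) (s := 1) hD hDp (by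
    simpa using card_zeros_mod_le hn hf hD hDp) hj
  obtain ⟨m, rfl⟩ : ∃ m, j = m + 1 := ⟨j - 1, by omega⟩
  rw [Nat.add_sub_cancel, ← mul_assoc, ← pow_add] at h
  simpa using h

open MvPolynomial in
/-- At a prime of good reduction, imposing a congruence `a · y ≡ 0` modulo `p` with `a ≢ 0` saves
another factor `p`. -/
theorem volume_padicTube_hyperplane_le {d : ℕ} (hn : 3 ≤ n) (hd : 2 ≤ d)
    {f : MvPolynomial (Fin n) ℤ} (hf : f.IsHomogeneous d) {D : ℤ} {N : ℕ}
    (hD : ∀ i, ∃ (g : MvPolynomial (Fin n) ℤ) (h : Fin n → MvPolynomial (Fin n) ℤ),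
      C D * X i ^ N = g * f + ∑ j, h j * pderiv j f)
    (hDp : (D : ZMod p) ≠ 0) {a : Fin n → ℤ} (ha : (fun i ↦ (a i : ZMod p)) ≠ 0)
    {j : ℕ} (hj : 1 ≤ j) :
    (p : ENNReal) ^ (j + 1) * volume (padicTube p f j ∩ {y | ‖aeval y (linForm a)‖ < 1}) ≤
      (n * d : ℕ) := by
  have h := volume_padicTube_inter_le_of_card p (l := linForm a) (d := d) (s := 2) hD hDp (by
    simpa only [aeval_linForm] using card_zeros_hyperplane_le hn hd hf hD hDp ha) hj
  obtain ⟨m, rfl⟩ : ∃ m, j = m + 1 := ⟨j - 1, by omega⟩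
  rw [Nat.add_sub_cancel, ← mul_assoc, ← pow_add] at h
  simpa using h

open MvPolynomial in
/-- A congruence `a · y ≡ 0` modulo `p` with `a ≢ 0` cuts out a set of volume at most `1 / p`. -/
theorem volume_hyperplane_le {a : Fin n → ℤ} (ha : (fun i ↦ (a i : ZMod p)) ≠ 0) :
    (p : ENNReal) * volume (Metric.sphere (0 : Fin n → ℚ_[p]) 1 ∩
      {y | ‖aeval y (linForm a)‖ < 1}) ≤ 1 := by
  have hl : (map (Int.castRingHom (ZMod p)) (linForm a)).IsHomogeneous 1 :=
    (IsHomogeneous.sum _ _ _ fun j _ ↦ isHomogeneous_C_mul_X _ _).map _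
  have hev : ∀ y : Fin n → ZMod p, eval y (map (Int.castRingHom _) (linForm a)) =
      aeval y (linForm a) := by
    intro y
    rw [eval_map]
    rfl
  have hl0 : map (Int.castRingHom (ZMod p)) (linForm a) ≠ 0 := by
    intro h0
    refine ha (funext fun i ↦ ?_)
    have := hev (Pi.single i 1)
    rw [h0, map_zero, aeval_linForm] at this
    simpa [Pi.single_apply] using this.symm
  have hcard := card_zeros_le hl hl0
  simp only [hev] at hcard
  have := ennreal_le_of_pow_mul_le p (k := 1) (l := 1) (volume_le_card_reductions p
      {t : Fin n → ZMod p | aeval t (linForm a) = 0}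
      (V := Metric.sphere (0 : Fin n → ℚ_[p]) 1 ∩ {y | ‖aeval y (linForm a)‖ < 1}) (by
    rintro y ⟨hy1, hy2⟩
    obtain ⟨z, hz⟩ := exists_padicInt_lift p (y := y) (le_of_eq (by simpa using hy1))
    exact ⟨z, hz, aeval_toZMod_eq_zero p _ hz hy2⟩)) (by rw [pow_one]; exact hcard)
  simpa using this

open MvPolynomial in
/-- At every prime the tube of radius `p ^ (-j)` has volume `O(p ^ (-j))`. -/
theorem volume_padicTube_le_of_norm {f : MvPolynomial (Fin n) ℤ} (hn : 3 ≤ n) {D : ℤ} {N c : ℕ}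
    (hD : ∀ i, ∃ (g : MvPolynomial (Fin n) ℤ) (h : Fin n → MvPolynomial (Fin n) ℤ),
      C D * X i ^ N = g * f + ∑ j, h j * pderiv j f)
    (hc : ‖(D : ℚ_[p])‖ = (p : ℝ) ^ (-c : ℤ)) (j : ℕ) :
    (p : ENNReal) ^ j * volume (padicTube p f j) ≤ (n * p ^ (2 * c + 1) : ℕ) := by
  have hp1 : (1 : ENNReal) ≤ p := by exact_mod_cast hp.out.one_lt.le
  have hsub : padicTube p f j ⊆ Metric.closedBall 0 1 := fun y hy ↦ by simpa using hy.1.le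
  rcases le_or_gt (2 * c + 1) j with hj | hj
  · obtain ⟨m, rfl⟩ : ∃ m, j = m + (2 * c + 1) := ⟨j - (2 * c + 1), by omega⟩
    have h := volume_padicTube_inter_le p hD hc Metric.isClosed_closedBall.measurableSet
      subset_rfl (by
        intro y hy i t ht
        have ht1 : ‖t‖ ≤ 1 :=
          ht.trans (zpow_le_one_of_nonpos₀ (one_lt_prime_real p).le (by omega))
        have hy1' : ‖y‖ ≤ 1 := by simpa using hy
        have hyt : ‖y + Pi.single i t‖ ≤ 1 := (IsUltrametricDist.norm_add_le_max _ _).trans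
          (max_le hy1' (by rwa [Pi.norm_single]))
        simpa using hyt) m
    rw [volume_pi_padic_closedBall_one, mul_one, Set.inter_eq_self_of_subset_left hsub] at h
    calc _ = (p : ENNReal) ^ (2 * c + 1) *
          (p ^ m * volume (padicTube p f (m + (2 * c + 1)))) := by ring
      _ ≤ (p : ENNReal) ^ (2 * c + 1) * n := by gcongr
      _ = _ := by push_cast; ring
  · have hv : volume (padicTube p f j) ≤ 1 :=
      (measure_mono hsub).trans_eq (volume_pi_padic_closedBall_one p n)
    calc (p : ENNReal) ^ j * volume (padicTube p f j)
        ≤ (p : ENNReal) ^ (2 * c + 1) * 1 := by gcongr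
      _ ≤ (n * p ^ (2 * c + 1) : ℕ) := by
        rw [mul_one]
        exact_mod_cast Nat.le_mul_of_pos_left _ (by omega)

end PadicIntegral

/-! ### The local heights at `p` -/

section PadicHeight

variable (p : ℕ) [hp : Fact p.Prime] {n d : ℕ} {f : MvPolynomial (Fin n) ℤ}

/-- Every point is the dilation by a factor of norm `max(1, ‖x‖)` of an integral point. -/
theorem exists_smul_norm_le_one (x : Fin n → ℚ_[p]) :
    ∃ c : ℚ_[p], ‖c‖ = max 1 ‖x‖ ∧ ∃ y : Fin n → ℚ_[p], ‖y‖ ≤ 1 ∧ x = c • y := by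
  rcases le_total ‖x‖ 1 with h | h
  · exact ⟨1, by simpa using h, x, h, by simp⟩
  · obtain ⟨k, hk⟩ := exists_norm_eq_pow p h
    have hp0 := pow_ne_zero k (prime_ne_zero_padic p)
    refine ⟨((p : ℚ_[p]) ^ k)⁻¹, ?_, (p : ℚ_[p]) ^ k • x, ?_, ?_⟩
    · rw [norm_inv, norm_prime_pow, inv_inv, ← hk, max_eq_right h]
    · rw [norm_smul, norm_prime_pow, hk, inv_mul_cancel₀]
      have := one_lt_prime_real p
      positivity
    · rw [smul_smul, inv_mul_cancel₀ hp0, one_smul]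

theorem norm_aeval_le_max_pow (hf : f.IsHomogeneous d) (x : Fin n → ℚ_[p]) :
    ‖MvPolynomial.aeval x f‖ ≤ max 1 ‖x‖ ^ d := by
  obtain ⟨c, hc, y, hy, rfl⟩ := exists_smul_norm_le_one p x
  rw [aeval_smul_of_isHomogeneous hf, norm_mul, norm_pow, hc]
  exact mul_le_of_le_one_right (by positivity) (norm_aeval_le_one p f hy)

theorem heightD1Padic_pos (x : Fin n → ℚ_[p]) : 0 < heightD1Padic p d f x := by
  have : (0 : ℝ) < max 1 ‖x‖ := lt_max_of_lt_left one_pos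
  exact inv_pos.2 (lt_max_of_lt_left (by positivity))

theorem one_le_heightD1Padic (hf : f.IsHomogeneous d) (x : Fin n → ℚ_[p]) :
    1 ≤ heightD1Padic p d f x := by
  have h1 : (1 : ℝ) ≤ max 1 ‖x‖ := le_max_left _ _
  have h0 : (0 : ℝ) < max 1 ‖x‖ := by linarith
  refine one_le_inv_iff₀.2 ⟨lt_max_of_lt_left (by positivity), max_le ?_ ?_⟩
  · rw [div_le_one h0]; exact h1
  · rw [div_le_one (by positivity)]; exact norm_aeval_le_max_pow p hf x

theorem heightD1Padic_le (x : Fin n → ℚ_[p]) : heightD1Padic p d f x ≤ max 1 ‖x‖ := by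
  have h0 : (0 : ℝ) < max 1 ‖x‖ := lt_max_of_lt_left one_pos
  rw [heightD1Padic]
  refine inv_le_of_inv_le₀ h0 ?_
  rw [← one_div]
  exact le_max_left _ _

theorem one_le_heightD0Padic (x : Fin n → ℚ_[p]) : 1 ≤ heightD0Padic p d f x := by
  have h0 : (0 : ℝ) < max 1 ‖x‖ := lt_max_of_lt_left one_pos
  have := heightD1Padic_pos p (d := d) (f := f) x
  refine one_le_inv_iff₀.2 ⟨by positivity, ?_⟩
  rw [div_le_one h0]
  exact heightD1Padic_le p x

theorem heightD0Padic_eq (x : Fin n → ℚ_[p]) :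
    heightD0Padic p d f x = max 1 ‖x‖ / heightD1Padic p d f x := by
  rw [heightD0Padic, inv_div]

theorem heightD1Padic_eq_one {x : Fin n → ℚ_[p]} (hx : ‖x‖ ≤ 1) : heightD1Padic p d f x = 1 := by
  rw [heightD1Padic, max_eq_left hx]
  simp [norm_aeval_le_one p f hx]

theorem heightD0Padic_eq_one {x : Fin n → ℚ_[p]} (hx : ‖x‖ ≤ 1) : heightD0Padic p d f x = 1 := by
  rw [heightD0Padic_eq, heightD1Padic_eq_one p hx, max_eq_left hx, div_one]

theorem continuous_heightD1Padic : Continuous (heightD1Padic p d f) := by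
  have h := continuous_aeval_padic p f
  have h0 : ∀ x : Fin n → ℚ_[p], (0 : ℝ) < max 1 ‖x‖ := fun x ↦ lt_max_of_lt_left one_pos
  unfold heightD1Padic
  refine Continuous.inv₀ (Continuous.max (continuous_const.div (by fun_prop) fun x ↦ (h0 x).ne')
    (h.norm.div (by fun_prop) fun x ↦ (pow_pos (h0 x) d).ne')) fun x ↦ ?_
  exact (lt_max_of_lt_left (by have := h0 x; positivity)).ne'

theorem continuous_heightD0Padic : Continuous (heightD0Padic p d f) := by
  have h0 : ∀ x : Fin n → ℚ_[p], (0 : ℝ) < max 1 ‖x‖ := fun x ↦ lt_max_of_lt_left one_pos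
  unfold heightD0Padic
  refine Continuous.inv₀ ((continuous_heightD1Padic p).div (by fun_prop) fun x ↦ (h0 x).ne')
    fun x ↦ ?_
  exact (div_pos (heightD1Padic_pos p x) (h0 x)).ne'

theorem norm_charPadic (a : Fin n → ℤ) (x : Fin n → ℚ_[p]) : ‖charPadic p a x‖ = 1 :=
  norm_psiPadic p _

theorem continuous_charPadic (a : Fin n → ℤ) : Continuous (charPadic p a) := by
  unfold charPadic
  exact (continuous_psiPadic p).comp (by fun_prop)

theorem norm_heightPadic_inv (s : ℂ × ℂ) (x : Fin n → ℚ_[p]) :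
    ‖(heightPadic p d f s x)⁻¹‖ =
      heightD0Padic p d f x ^ (-s.1.re) * heightD1Padic p d f x ^ (-s.2.re) := by
  have h1 := heightD1Padic_pos p (d := d) (f := f) x
  have h0 : 0 < heightD0Padic p d f x := one_pos.trans_le (one_le_heightD0Padic p x)
  rw [heightPadic, norm_inv, norm_mul, Complex.norm_cpow_eq_rpow_re_of_pos h0,
    Complex.norm_cpow_eq_rpow_re_of_pos h1, Real.rpow_neg h0.le, Real.rpow_neg h1.le, mul_inv]

theorem continuous_heightPadic_inv (s : ℂ × ℂ) :
    Continuous fun x ↦ (heightPadic p d f s x)⁻¹ := by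
  have h1 : ∀ x, 0 < heightD1Padic p d f x := heightD1Padic_pos p (d := d) (f := f)
  have h0 : ∀ x, 0 < heightD0Padic p d f x :=
    fun x ↦ one_pos.trans_le (one_le_heightD0Padic p (d := d) (f := f) x)
  unfold heightPadic
  refine Continuous.inv₀ (Continuous.mul ?_ ?_) fun x ↦ ?_
  · exact (Complex.continuous_ofReal.comp (continuous_heightD0Padic p)).cpow continuous_const
      fun x ↦ Complex.ofReal_mem_slitPlane.2 (h0 x)
  · exact (Complex.continuous_ofReal.comp (continuous_heightD1Padic p)).cpow continuous_const
      fun x ↦ Complex.ofReal_mem_slitPlane.2 (h1 x)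
  · refine mul_ne_zero ?_ ?_ <;>
    exact Complex.cpow_ne_zero_iff.2 (Or.inl (by
      exact_mod_cast (by first | exact (h0 x).ne' | exact (h1 x).ne')))

theorem continuous_integrandPadic (a : Fin n → ℤ) (s : ℂ × ℂ) :
    Continuous (integrandPadic p d f a s) :=
  (continuous_heightPadic_inv p s).mul (continuous_charPadic p a)

/-- The inverse of the local height at the corner `(n + ε, n - 1 + ε)` of the domain, which
dominates all the inverse heights on the domain. -/
noncomputable def majorantPadic (d : ℕ) (f : MvPolynomial (Fin n) ℤ) (ε : ℝ)
    (x : Fin n → ℚ_[p]) : ℝ :=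
  max 1 ‖x‖ ^ (-(n + ε)) * heightD1Padic p d f x

theorem majorantPadic_nonneg (ε : ℝ) (x : Fin n → ℚ_[p]) : 0 ≤ majorantPadic p d f ε x := by
  have := heightD1Padic_pos p (d := d) (f := f) x
  unfold majorantPadic
  positivity

theorem continuous_majorantPadic (ε : ℝ) : Continuous (majorantPadic p d f ε) := by
  unfold majorantPadic
  refine Continuous.mul (Continuous.rpow_const (by fun_prop) fun x ↦ Or.inl ?_)
    (continuous_heightD1Padic p)
  exact (lt_max_of_lt_left one_pos).ne'

/-- Both heights are at least `1`, so increasing the real parts of the exponents decreases the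
absolute value of the integrand. -/
theorem norm_integrandPadic_le (hf : f.IsHomogeneous d) {ε : ℝ} {s : ℂ × ℂ}
    (hs : s ∈ domainOmega n ε) (a : Fin n → ℤ) (x : Fin n → ℚ_[p]) :
    ‖integrandPadic p d f a s x‖ ≤ majorantPadic p d f ε x := by
  have h1 := one_le_heightD1Padic p hf x
  have h0 := one_le_heightD0Padic p (d := d) (f := f) x
  have h1' := one_pos.trans_le h1
  have hM : (0 : ℝ) < max 1 ‖x‖ := lt_max_of_lt_left one_pos
  rw [integrandPadic, norm_mul, norm_charPadic, mul_one, norm_heightPadic_inv]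
  calc _ ≤ heightD0Padic p d f x ^ (-(n + ε)) * heightD1Padic p d f x ^ (-(n - 1 + ε)) := by
        gcongr
        · exact hs.1.le
        · exact hs.2.le
    _ = majorantPadic p d f ε x := by
      rw [heightD0Padic_eq, majorantPadic, Real.div_rpow hM.le h1'.le, div_mul_eq_mul_div,
        div_eq_iff (by positivity), mul_assoc]
      congr 1
      nth_rewrite 2 [← Real.rpow_one (heightD1Padic p d f x)]
      rw [← Real.rpow_add h1']
      congr 1
      ring

/-- On the shell of radius `p ^ k` the height `H_{D₁,p}` is `min(p ^ k, |f(y)|⁻¹)`, where `y` is the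
rescaling of the point to the unit sphere. -/
theorem heightD1Padic_dilation (hf : f.IsHomogeneous d) (k : ℕ) {y : Fin n → ℚ_[p]}
    (hy : ‖y‖ = 1) : heightD1Padic p d f (((p : ℚ_[p]) ^ k)⁻¹ • y) =
      (max ((p : ℝ) ^ k)⁻¹ ‖MvPolynomial.aeval y f‖)⁻¹ := by
  have hp1 := one_lt_prime_real p
  have hx : max 1 ‖((p : ℚ_[p]) ^ k)⁻¹ • y‖ = (p : ℝ) ^ k := by
    rw [norm_smul, norm_inv, norm_prime_pow, inv_inv, hy, mul_one,
      max_eq_right (one_le_pow₀ hp1.le)]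
  rw [heightD1Padic, hx, aeval_smul_of_isHomogeneous hf, norm_mul, norm_pow, norm_inv,
    norm_prime_pow, inv_inv, one_div, mul_comm, mul_div_assoc, div_self, mul_one]
  positivity

/-- Decomposition of the height `H_{D₁,p}` along the tubes around the hypersurface, by the powers of
`p`. -/
theorem heightD1Padic_dilation_le (hf : f.IsHomogeneous d) (k : ℕ) {y : Fin n → ℚ_[p]}
    (hy : ‖y‖ = 1) : ENNReal.ofReal (heightD1Padic p d f (((p : ℚ_[p]) ^ k)⁻¹ • y)) ≤
      1 + ∑ j ∈ Finset.Icc 1 k, (padicTube p f j).indicator (fun _ ↦ (p : ENNReal) ^ j) y := by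
  have hp1 := one_lt_prime_real p
  have hp0 : (0 : ℝ) < p := by linarith
  rw [heightD1Padic_dilation p hf k hy]
  have key : ∀ j ≤ k, ((p : ℝ) ^ j)⁻¹ ≤ max ((p : ℝ) ^ k)⁻¹ ‖MvPolynomial.aeval y f‖ →
      ‖MvPolynomial.aeval y f‖ ≤ (p : ℝ) ^ (-j : ℤ) →
      ENNReal.ofReal (max ((p : ℝ) ^ k)⁻¹ ‖MvPolynomial.aeval y f‖)⁻¹ ≤
      1 + ∑ j ∈ Finset.Icc 1 k, (padicTube p f j).indicator (fun _ ↦ (p : ENNReal) ^ j) y := by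
    intro j hj h1 h2
    have h3 : ENNReal.ofReal (max ((p : ℝ) ^ k)⁻¹ ‖MvPolynomial.aeval y f‖)⁻¹ ≤
        (p : ENNReal) ^ j := by
      rw [show (p : ENNReal) ^ j = ENNReal.ofReal ((p : ℝ) ^ j) by
        rw [ENNReal.ofReal_pow hp0.le, ENNReal.ofReal_natCast]]
      exact ENNReal.ofReal_le_ofReal (inv_le_of_inv_le₀ (by positivity) h1)
    rcases Nat.eq_zero_or_pos j with rfl | hj0
    · exact h3.trans (by simp)
    · refine h3.trans (le_add_left ?_)
      refine le_trans ?_ (Finset.single_le_sum (fun _ _ ↦ zero_le) (Finset.mem_Icc.2 ⟨hj0, hj⟩))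
      rw [Set.indicator_of_mem (show y ∈ padicTube p f j from ⟨hy, h2⟩)]
  rcases le_or_gt ‖MvPolynomial.aeval y f‖ ((p : ℝ) ^ (-k : ℤ)) with h | h
  · exact key k le_rfl (le_max_left _ _) h
  · have hne : MvPolynomial.aeval y f ≠ 0 := by
      intro h0
      rw [h0, norm_zero] at h
      exact absurd h (not_lt.2 (by positivity))
    have hv := Padic.norm_eq_zpow_neg_valuation hne
    have hle := norm_aeval_le_one p f hy.le
    rw [hv, ← zpow_zero (p : ℝ), zpow_le_zpow_iff_right₀ hp1] at hle
    rw [hv, zpow_lt_zpow_iff_right₀ hp1] at h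
    obtain ⟨j, hj⟩ := Int.eq_ofNat_of_zero_le (by omega : 0 ≤ (MvPolynomial.aeval y f).valuation)
    rw [hj] at hv h
    refine key j (by omega) ?_ hv.le
    rw [hv, zpow_neg, zpow_natCast]
    exact le_max_right _ _

/-- The points of norm `p ^ k` in `ℚ_pⁿ` whose rescaling to the unit sphere lies in `V`. -/
def padicShell (V : Set (Fin n → ℚ_[p])) (k : ℕ) : Set (Fin n → ℚ_[p]) :=
  {x | ‖x‖ = (p : ℝ) ^ k ∧ (p : ℚ_[p]) ^ k • x ∈ V}

theorem measurableSet_padicShell {V : Set (Fin n → ℚ_[p])} (hV : MeasurableSet V) (k : ℕ) :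
    MeasurableSet (padicShell p V k) :=
  (isClosed_eq continuous_norm continuous_const).measurableSet.inter
    (hV.preimage (measurable_const_smul _))

/-- The change of variables `x = p ^ (-k) y` contributes `p ^ (n k)` and the size of `x` contributes
`p ^ (-(n + ε) k)`, which leaves `p ^ (-ε k)` times an integral over the unit sphere. -/
theorem lintegral_padicShell_le (hf : f.IsHomogeneous d) {ε : ℝ} {V : Set (Fin n → ℚ_[p])}
    (hV : MeasurableSet V) (k : ℕ) :
    ∫⁻ x in padicShell p V k, ENNReal.ofReal (majorantPadic p d f ε x) ≤
      ENNReal.ofReal ((p : ℝ) ^ (-ε)) ^ k * (volume (Metric.sphere 0 1 ∩ V) +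
        ∑ j ∈ Finset.Icc 1 k, (p : ENNReal) ^ j * volume (padicTube p f j ∩ V)) := by
  have hp1 := one_lt_prime_real p
  have hp0 : (0 : ℝ) < p := by linarith
  have hpk := pow_ne_zero k (prime_ne_zero_padic p)
  have hVs : MeasurableSet (Metric.sphere (0 : Fin n → ℚ_[p]) 1 ∩ V) :=
    Metric.isClosed_sphere.measurableSet.inter hV
  rw [← lintegral_indicator (measurableSet_padicShell p hV k), lintegral_padic_dilation p k]
  have hpt : ∀ y : Fin n → ℚ_[p], (padicShell p V k).indicator
      (fun x ↦ ENNReal.ofReal (majorantPadic p d f ε x)) (((p : ℚ_[p]) ^ k)⁻¹ • y) ≤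
      ENNReal.ofReal ((p : ℝ) ^ (-(n + ε))) ^ k *
        ((Metric.sphere 0 1 ∩ V).indicator (fun _ ↦ (1 : ENNReal)) y +
        ∑ j ∈ Finset.Icc 1 k, (padicTube p f j ∩ V).indicator (fun _ ↦ (p : ENNReal) ^ j) y) := by
    intro y
    by_cases hy : ((p : ℚ_[p]) ^ k)⁻¹ • y ∈ padicShell p V k
    · rw [Set.indicator_of_mem hy]
      have hy1 : ‖y‖ = 1 := by
        have := hy.1
        rw [norm_smul, norm_inv, norm_prime_pow, inv_inv] at this
        exact mul_left_cancel₀ (pow_pos hp0 k).ne' (by rw [this, mul_one])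
      have hyV : y ∈ V := by
        have := hy.2
        rwa [smul_smul, mul_inv_cancel₀ hpk, one_smul] at this
      rw [majorantPadic, ENNReal.ofReal_mul (by positivity), hy.1,
        max_eq_right (one_le_pow₀ hp1.le), ← Real.rpow_natCast, ← Real.rpow_mul hp0.le,
        mul_comm (k : ℝ), Real.rpow_mul hp0.le, Real.rpow_natCast,
        ENNReal.ofReal_pow (by positivity)]
      gcongr
      refine (heightD1Padic_dilation_le p hf k hy1).trans_eq ?_
      rw [Set.indicator_of_mem (show y ∈ Metric.sphere 0 1 ∩ V from ⟨by simpa using hy1, hyV⟩)]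
      congr 1
      refine Finset.sum_congr rfl fun j _ ↦ ?_
      rw [Set.inter_comm, ← Set.indicator_indicator, Set.indicator_of_mem hyV]
    · rw [Set.indicator_of_notMem hy]
      exact zero_le
  refine (mul_le_mul_right (lintegral_mono hpt) _).trans_eq ?_
  rw [lintegral_const_mul' _ _ (ENNReal.pow_ne_top ENNReal.ofReal_ne_top), ← mul_assoc, ← mul_pow]
  congr 1
  · rw [← ENNReal.ofReal_natCast, ← ENNReal.ofReal_pow hp0.le, ← ENNReal.ofReal_mul (by positivity),
      ← Real.rpow_natCast, ← Real.rpow_add hp0]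
    congr 3
    ring
  · rw [lintegral_add_left (measurable_const.indicator hVs), lintegral_indicator hVs,
      setLIntegral_const, one_mul, lintegral_finsetSum]
    · congr 1
      refine Finset.sum_congr rfl fun j _ ↦ ?_
      have hm := (measurableSet_padicTube p f j).inter hV
      rw [lintegral_indicator hm, setLIntegral_const]
    · intro j _
      exact measurable_const.indicator ((measurableSet_padicTube p f j).inter hV)

/-- The series bounding the integral of the height over all shells. The base is `2`, the smallest
prime, so that it does not depend on `p`. -/
noncomputable def shellSeries (ε : ℝ) : ENNReal :=
  ∑' k : ℕ, ((k : ENNReal) + 2) * ENNReal.ofReal ((2 : ℝ) ^ (-ε)) ^ k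

theorem shellSeries_ne_top {ε : ℝ} (hε : 0 < ε) : shellSeries ε ≠ ⊤ := by
  set q : ℝ := (2 : ℝ) ^ (-ε) with hq
  have hq0 : 0 < q := by positivity
  have hq1 : q < 1 := Real.rpow_lt_one_of_one_lt_of_neg one_lt_two (by linarith)
  have hsum : Summable fun k : ℕ ↦ ((k : ℝ) + 2) * q ^ k := by
    simp only [add_mul]
    refine Summable.add ?_ ((summable_geometric_of_lt_one hq0.le hq1).mul_left 2)
    simpa using summable_pow_mul_geometric_of_norm_lt_one 1
      (show ‖q‖ < 1 by rwa [Real.norm_of_nonneg hq0.le])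
  have : shellSeries ε = ∑' k : ℕ, ENNReal.ofReal (((k : ℝ) + 2) * q ^ k) := by
    refine tsum_congr fun k ↦ ?_
    rw [ENNReal.ofReal_mul (by positivity), ENNReal.ofReal_pow hq0.le,
      ENNReal.ofReal_add (by positivity) (by positivity), ENNReal.ofReal_natCast,
      ENNReal.ofReal_ofNat]
  rw [this]
  exact hsum.tsum_ofReal_ne_top

/-- If the part of the unit sphere in `V` and all the tubes in `V`, the latter weighted by `p ^ j`,
have volume at most `B`, then the shells over `V` contribute `O(B p ^ (-ε))` uniformly in `p`. -/
theorem lintegral_outer_le (hf : f.IsHomogeneous d) {ε : ℝ} (hε : 0 < ε)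
    {V : Set (Fin n → ℚ_[p])} (hV : MeasurableSet V) {B : ENNReal}
    (h0 : volume (Metric.sphere 0 1 ∩ V) ≤ B)
    (hB : ∀ j, 1 ≤ j → (p : ENNReal) ^ j * volume (padicTube p f j ∩ V) ≤ B) :
    ∫⁻ x in ⋃ k, padicShell p V (k + 1), ENNReal.ofReal (majorantPadic p d f ε x) ≤
      B * ENNReal.ofReal ((p : ℝ) ^ (-ε)) * shellSeries ε := by
  have hp2 : (2 : ℝ) ≤ p := by exact_mod_cast hp.out.two_le
  refine (lintegral_iUnion_le _ _).trans ?_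
  rw [shellSeries, ← ENNReal.tsum_mul_left]
  refine ENNReal.tsum_le_tsum fun k ↦ (lintegral_padicShell_le p hf hV _).trans ?_
  calc _ ≤ ENNReal.ofReal ((p : ℝ) ^ (-ε)) ^ (k + 1) * (B + ∑ j ∈ Finset.Icc 1 (k + 1), B) := by
        gcongr with j hj
        exact hB j (Finset.mem_Icc.1 hj).1
    _ = B * ENNReal.ofReal ((p : ℝ) ^ (-ε)) * ((k + 2) * ENNReal.ofReal ((p : ℝ) ^ (-ε)) ^ k) := by
        rw [Finset.sum_const, Nat.card_Icc, nsmul_eq_mul, Nat.add_sub_cancel]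
        push_cast
        ring
    _ ≤ _ := by
        have := Real.rpow_le_rpow_of_nonpos two_pos hp2 (neg_nonpos.2 hε.le)
        gcongr

theorem compl_closedBall_eq_iUnion_padicShell :
    (Metric.closedBall (0 : Fin n → ℚ_[p]) 1)ᶜ = ⋃ k, padicShell p Set.univ (k + 1) := by
  have hp1 := one_lt_prime_real p
  ext x
  simp only [Set.mem_compl_iff, Metric.mem_closedBall, dist_zero_right, not_le, Set.mem_iUnion,
    padicShell, Set.mem_univ, and_true, Set.mem_ofPred_eq]
  constructor
  · intro h
    obtain ⟨k, hk⟩ := exists_norm_eq_pow p h.le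
    rcases Nat.eq_zero_or_pos k with rfl | hk0
    · rw [hk, pow_zero] at h
      exact absurd h (lt_irrefl _)
    · exact ⟨k - 1, by rwa [Nat.sub_add_cancel hk0]⟩
  · rintro ⟨k, hk⟩
    rw [hk]
    exact one_lt_pow₀ hp1 (Nat.succ_ne_zero k)

end PadicHeight

/-! ### Oscillatory integrals over `ℚ_pⁿ` -/

section PadicFourier

variable (p : ℕ) [hp : Fact p.Prime] {n d : ℕ} {f : MvPolynomial (Fin n) ℤ}

theorem charPadic_eq (a : Fin n → ℤ) (x : Fin n → ℚ_[p]) :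
    charPadic p a x = psiPadic p (MvPolynomial.aeval x (linForm a)) := by
  rw [charPadic, aeval_linForm]

theorem aeval_linForm_smul (a : Fin n → ℤ) (u : ℚ_[p]) (x : Fin n → ℚ_[p]) :
    MvPolynomial.aeval (u • x) (linForm a) = u * MvPolynomial.aeval x (linForm a) := by
  rw [aeval_linForm, aeval_linForm, Finset.mul_sum]
  exact Finset.sum_congr rfl fun i _ ↦ by simp; ring

/-- Averaging an oscillatory integral of a function invariant under scalar units over a finite
set of units. -/
theorem card_mul_setIntegral_charPadic {F : (Fin n → ℚ_[p]) → ℂ}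
    (hF : ∀ u : ℚ_[p], ‖u‖ = 1 → ∀ x, F (u • x) = F x) (a : Fin n → ℤ)
    {R : Set (Fin n → ℚ_[p])} (hRm : MeasurableSet R)
    (hR : ∀ u : ℚ_[p], ‖u‖ = 1 → ∀ x, u • x ∈ R ↔ x ∈ R)
    (hint : IntegrableOn (fun x ↦ F x * charPadic p a x) R)
    (U : Finset ℕ) (g : ℕ → ℚ_[p]) (hg : ∀ l ∈ U, ‖g l‖ = 1) (κ : ℂ)
    (hsum : ∀ x ∈ R, ∑ l ∈ U, psiPadic p (g l * MvPolynomial.aeval x (linForm a)) = κ) :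
    (U.card : ℂ) * ∫ x in R, F x * charPadic p a x = κ * ∫ x in R, F x := by
  have hemb : ∀ l ∈ U, MeasurableEmbedding (fun x : Fin n → ℚ_[p] ↦ g l • x) := fun l hl ↦
    (Homeomorph.smulOfNeZero (g l) (norm_ne_zero_iff.1 (by
      rw [hg l hl]; exact one_ne_zero))).measurableEmbedding
  have hpre : ∀ l ∈ U, (fun x : Fin n → ℚ_[p] ↦ g l • x) ⁻¹' R = R := fun l hl ↦
    Set.ext fun x ↦ hR _ (hg l hl) x
  have hfun : ∀ l ∈ U, ∀ x : Fin n → ℚ_[p], F (g l • x) * charPadic p a (g l • x) =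
      F x * psiPadic p (g l * MvPolynomial.aeval x (linForm a)) := fun l hl x ↦ by
    rw [hF _ (hg l hl), charPadic_eq, aeval_linForm_smul]
  have h1 : ∀ l ∈ U, ∫ x in R, F x * charPadic p a x =
      ∫ x in R, F x * psiPadic p (g l * MvPolynomial.aeval x (linForm a)) := by
    intro l hl
    have := (measurePreserving_smul_padic p (hg l hl)).setIntegral_preimage_emb (hemb l hl)
      (fun x ↦ F x * charPadic p a x) R
    rw [hpre l hl] at this
    rw [← this]
    simp only [hfun l hl]
  have h2 : ∀ l ∈ U, IntegrableOn
      (fun x ↦ F x * psiPadic p (g l * MvPolynomial.aeval x (linForm a))) R := by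
    intro l hl
    have := ((measurePreserving_smul_padic p (hg l hl)).integrableOn_comp_preimage
      (hemb l hl)).2 hint
    rw [hpre l hl] at this
    refine this.congr_fun (fun x _ ↦ ?_) hRm
    exact hfun l hl x
  calc (U.card : ℂ) * ∫ x in R, F x * charPadic p a x
      = ∑ l ∈ U, ∫ x in R, F x * psiPadic p (g l * MvPolynomial.aeval x (linForm a)) := by
        rw [← Finset.sum_congr rfl h1, Finset.sum_const, nsmul_eq_mul]
    _ = ∫ x in R, ∑ l ∈ U, F x * psiPadic p (g l * MvPolynomial.aeval x (linForm a)) :=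
        (integral_finsetSum _ h2).symm
    _ = ∫ x in R, κ * F x := by
        refine setIntegral_congr_fun hRm fun x hx ↦ ?_
        rw [← Finset.mul_sum, hsum x hx, mul_comm]
    _ = κ * ∫ x in R, F x := integral_const_mul _ _

/-- The Ramanujan sum of the units modulo `p`. -/
theorem sum_psiPadic_units {t : ℚ_[p]} (ht : ‖t‖ = p) :
    ∑ l ∈ Finset.Ico 1 p, psiPadic p (l * t) = -1 := by
  have h := sum_psiPadic p ht
  rw [Finset.range_eq_Ico, Finset.sum_eq_sum_Ico_succ_bot hp.out.pos] at h
  rw [Nat.cast_zero, zero_mul, psiPadic_eq_one p (by simp)] at h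
  linear_combination h

/-- An oscillatory integral of a function invariant under scalar units only sees the region where
the phase is integral, up to a term of relative size `1 / (p - 1)`. -/
theorem norm_setIntegral_charPadic_le {F : (Fin n → ℚ_[p]) → ℂ}
    (hF : ∀ u : ℚ_[p], ‖u‖ = 1 → ∀ x, F (u • x) = F x) (a : Fin n → ℤ)
    {O : Set (Fin n → ℚ_[p])} (hOm : MeasurableSet O)
    (hO : ∀ u : ℚ_[p], ‖u‖ = 1 → ∀ x, u • x ∈ O ↔ x ∈ O)
    (hint : IntegrableOn (fun x ↦ F x * charPadic p a x) O) :
    ‖∫ x in O, F x * charPadic p a x‖ ≤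
      (∫ x in O ∩ {x | ‖MvPolynomial.aeval x (linForm a)‖ ≤ 1}, ‖F x‖) +
        ((p : ℝ) - 1)⁻¹ * ∫ x in O, ‖F x‖ := by
  have hp1 := one_lt_prime_real p
  have hp0 : (0 : ℝ) < p := by linarith
  set t : (Fin n → ℚ_[p]) → ℚ_[p] := fun x ↦ MvPolynomial.aeval x (linForm a) with ht
  have htc : Continuous t := continuous_aeval_padic p _
  -- Besides the region where the phase `t` is integral, `O` is the union of the sets `Q m` on which
  -- `‖t‖ = p ^ (m + 1)`.
  let Q : ℕ → Set (Fin n → ℚ_[p]) := fun m ↦ O ∩ {x | ‖t x‖ = (p : ℝ) ^ (m + 1)}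
  have hQm : ∀ m, MeasurableSet (Q m) := fun m ↦
    hOm.inter (isClosed_eq htc.norm continuous_const).measurableSet
  have hQ : ∀ m, ∀ u : ℚ_[p], ‖u‖ = 1 → ∀ x, u • x ∈ Q m ↔ x ∈ Q m := by
    intro m u hu x
    simp only [Q, Set.mem_inter_iff, Set.mem_ofPred_eq, hO u hu, ht, aeval_linForm_smul, norm_mul,
      hu, one_mul]
  have hQint : ∀ m, IntegrableOn (fun x ↦ F x * charPadic p a x) (Q m) := fun m ↦
    hint.mono_set Set.inter_subset_left
  have hdisj : Pairwise (Function.onFun Disjoint Q) := by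
    intro m m' hmm
    refine Set.disjoint_left.2 fun x hx hx' ↦ hmm ?_
    have h := hx.2.symm.trans hx'.2
    have := pow_right_injective₀ hp0 hp1.ne' h
    omega
  have hcover : O = (O ∩ {x | ‖t x‖ ≤ 1}) ∪ ⋃ m, Q m := by
    ext x
    simp only [Set.mem_union, Set.mem_inter_iff, Set.mem_iUnion, Q, Set.mem_ofPred_eq]
    constructor
    · intro hx
      rcases le_or_gt ‖t x‖ 1 with h | h
      · exact Or.inl ⟨hx, h⟩
      · refine Or.inr ?_
        have hne : t x ≠ 0 := by
          intro h0
          rw [h0, norm_zero] at h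
          linarith
        have hv := Padic.norm_eq_zpow_neg_valuation hne
        rw [hv, ← zpow_zero (p : ℝ), zpow_lt_zpow_iff_right₀ hp1] at h
        obtain ⟨m, hm⟩ := Int.eq_ofNat_of_zero_le (by omega : 0 ≤ -(t x).valuation - 1)
        refine ⟨m, hx, ?_⟩
        rw [hv, show -(t x).valuation = ((m + 1 : ℕ) : ℤ) by push_cast; omega, zpow_natCast]
    · rintro (h | ⟨m, h⟩)
      · exact h.1
      · exact h.1
  -- For `m ≥ 1` the units `1 + l p ^ m` multiply the character value by a nontrivial
  -- character of `l` modulo `p`.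
  have hzero : ∀ m, 1 ≤ m → ∫ x in Q m, F x * charPadic p a x = 0 := by
    intro m hm
    have hpm : ‖(p : ℚ_[p]) ^ m‖ < 1 := by
      rw [norm_prime_pow]
      exact inv_lt_one_of_one_lt₀ (one_lt_pow₀ hp1 (by omega))
    have h := card_mul_setIntegral_charPadic p hF a (hQm m) (hQ m) (hQint m) (Finset.range p)
      (fun l ↦ 1 + l * (p : ℚ_[p]) ^ m) (fun l _ ↦ ?_) 0 ?_
    · rw [zero_mul, Finset.card_range, mul_eq_zero] at h
      exact h.resolve_left (by exact_mod_cast hp.out.ne_zero)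
    · have hl : ‖(l : ℚ_[p]) * (p : ℚ_[p]) ^ m‖ < 1 := by
        rw [norm_mul]
        exact (mul_le_of_le_one_left (norm_nonneg _)
          (by simpa using Padic.norm_int_le_one (p := p) l)).trans_lt hpm
      rw [Padic.add_eq_max_of_ne (by rw [norm_one]; exact hl.ne'), norm_one, max_eq_left hl.le]
    · intro x hx
      have h1 : ∀ l : ℕ, psiPadic p ((1 + l * (p : ℚ_[p]) ^ m) * t x) =
          psiPadic p (t x) * psiPadic p (l * ((p : ℚ_[p]) ^ m * t x)) := fun l ↦ by
        rw [← psiPadic_add]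
        ring_nf
      rw [Finset.sum_congr rfl fun l _ ↦ h1 l, ← Finset.mul_sum, sum_psiPadic p, mul_zero]
      rw [norm_mul, norm_prime_pow, hx.2, pow_succ, inv_mul_cancel_left₀ (by positivity)]
  -- On `Q 0` only the nonzero residues `l` are units; averaging over them leaves `-1 / (p - 1)`.
  have hfirst : ‖∫ x in Q 0, F x * charPadic p a x‖ ≤ ((p : ℝ) - 1)⁻¹ * ∫ x in O, ‖F x‖ := by
    have h := card_mul_setIntegral_charPadic p hF a (hQm 0) (hQ 0) (hQint 0) (Finset.Ico 1 p)
      (fun l ↦ (l : ℚ_[p])) (fun l hl ↦ ?_) (-1) ?_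
    · rw [Nat.card_Ico, Nat.cast_sub hp.out.one_le, Nat.cast_one] at h
      have h2 := congrArg norm h
      have hpn : ‖(p : ℂ) - 1‖ = (p : ℝ) - 1 := by
        rw [show (p : ℂ) - 1 = (((p : ℝ) - 1 : ℝ) : ℂ) by push_cast; rfl, Complex.norm_real,
          Real.norm_of_nonneg (by linarith)]
      rw [norm_mul, norm_mul, hpn, norm_neg, norm_one, one_mul] at h2
      rw [le_inv_mul_iff₀ (by linarith), h2]
      refine (norm_integral_le_integral_norm _).trans ?_
      refine setIntegral_mono_set ?_ (Filter.Eventually.of_forall fun x ↦ norm_nonneg _)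
        (Filter.Eventually.of_forall Set.inter_subset_left)
      have h3 : IntegrableOn (fun x ↦ ‖F x * charPadic p a x‖) O := hint.norm
      simpa only [norm_mul, norm_charPadic, mul_one] using h3
    · rw [Finset.mem_Ico] at hl
      rw [Padic.norm_natCast_eq_one_iff]
      exact (Nat.coprime_of_lt_prime (by omega) hl.2 hp.out)
    · intro x hx
      exact sum_psiPadic_units p (by simpa using hx.2)
  have hrest : ∫ x in ⋃ m, Q m, F x * charPadic p a x = ∫ x in Q 0, F x * charPadic p a x := by
    rw [integral_iUnion hQm hdisj (hint.mono_set (Set.iUnion_subset fun m ↦ Set.inter_subset_left)),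
      tsum_eq_single 0 fun m hm ↦ hzero m (Nat.one_le_iff_ne_zero.2 hm)]
  have hd : Disjoint (O ∩ {x | ‖t x‖ ≤ 1}) (⋃ m, Q m) := by
    refine Set.disjoint_iUnion_right.2 fun m ↦ Set.disjoint_left.2 fun x hx hx' ↦ ?_
    have h1 : ‖t x‖ ≤ 1 := hx.2
    rw [hx'.2] at h1
    exact absurd h1 (not_le.2 (one_lt_pow₀ hp1 (Nat.succ_ne_zero m)))
  conv_lhs => rw [hcover]
  rw [setIntegral_union hd (MeasurableSet.iUnion hQm) (hint.mono_set Set.inter_subset_left)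
    (hint.mono_set (Set.iUnion_subset fun m ↦ Set.inter_subset_left)), hrest]
  refine (norm_add_le _ _).trans (add_le_add ?_ hfirst)
  refine (norm_integral_le_integral_norm _).trans_eq ?_
  simp only [norm_mul, norm_charPadic, mul_one]
  rfl

end PadicFourier

/-! ### The local factors at `p` -/

section PadicBounds

variable (p : ℕ) [hp : Fact p.Prime] {n d : ℕ} {f : MvPolynomial (Fin n) ℤ}

theorem heightPadic_smul (hf : f.IsHomogeneous d) (s : ℂ × ℂ) {u : ℚ_[p]} (hu : ‖u‖ = 1)
    (x : Fin n → ℚ_[p]) : heightPadic p d f s (u • x) = heightPadic p d f s x := by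
  have hx : ‖u • x‖ = ‖x‖ := by rw [norm_smul, hu, one_mul]
  have h1 : heightD1Padic p d f (u • x) = heightD1Padic p d f x := by
    rw [heightD1Padic, heightD1Padic, hx, aeval_smul_of_isHomogeneous hf, norm_mul, norm_pow, hu,
      one_pow, one_mul]
  rw [heightPadic, heightPadic, heightD0Padic, heightD0Padic, h1, hx]

theorem majorantPadic_eq_one {ε : ℝ} {x : Fin n → ℚ_[p]} (hx : ‖x‖ ≤ 1) :
    majorantPadic p d f ε x = 1 := by
  rw [majorantPadic, heightD1Padic_eq_one p hx, max_eq_left hx, Real.one_rpow, mul_one]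

theorem integrandPadic_eq_one (a : Fin n → ℤ) (s : ℂ × ℂ) {x : Fin n → ℚ_[p]} (hx : ‖x‖ ≤ 1) :
    integrandPadic p d f a s x = 1 := by
  rw [integrandPadic, heightPadic, heightD1Padic_eq_one p hx, heightD0Padic_eq_one p hx,
    charPadic_eq, psiPadic_eq_one p (norm_aeval_le_one p _ hx)]
  simp

/-- The integral of the majorant outside `ℤ_pⁿ`. -/
noncomputable def outerIntegral (d : ℕ) (f : MvPolynomial (Fin n) ℤ) (ε : ℝ) : ENNReal :=
  ∫⁻ x in (Metric.closedBall (0 : Fin n → ℚ_[p]) 1)ᶜ, ENNReal.ofReal (majorantPadic p d f ε x)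

theorem lintegral_majorantPadic (ε : ℝ) :
    ∫⁻ x, ENNReal.ofReal (majorantPadic p d f ε x) = 1 + outerIntegral p d f ε := by
  rw [← lintegral_add_compl _ (Metric.isClosed_closedBall (x := (0 : Fin n → ℚ_[p]))
    (ε := 1)).measurableSet, outerIntegral]
  congr 1
  rw [setLIntegral_congr_fun (g := fun _ ↦ 1) Metric.isClosed_closedBall.measurableSet,
    setLIntegral_one, volume_pi_padic_closedBall_one]
  intro x hx
  simp only [majorantPadic_eq_one p (show ‖x‖ ≤ 1 by simpa using hx), ENNReal.ofReal_one]

theorem integrable_majorantPadic {ε : ℝ} (h : outerIntegral p d f ε ≠ ⊤) :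
    Integrable (majorantPadic p d f ε : (Fin n → ℚ_[p]) → ℝ) := by
  refine ⟨(continuous_majorantPadic p ε).aestronglyMeasurable, ?_⟩
  rw [hasFiniteIntegral_iff_ofReal
    (Filter.Eventually.of_forall fun x ↦ majorantPadic_nonneg p ε x), lintegral_majorantPadic]
  exact ENNReal.add_lt_top.2 ⟨ENNReal.one_lt_top, h.lt_top⟩

theorem integral_outer_majorantPadic (ε : ℝ) :
    ∫ x in (Metric.closedBall (0 : Fin n → ℚ_[p]) 1)ᶜ, majorantPadic p d f ε x =
      (outerIntegral p d f ε).toReal :=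
  integral_eq_lintegral_of_nonneg_ae
    (Filter.Eventually.of_forall fun x ↦ majorantPadic_nonneg p ε x)
    (continuous_majorantPadic p ε).aestronglyMeasurable

theorem integrable_integrandPadic (hf : f.IsHomogeneous d) {ε : ℝ}
    (h : outerIntegral p d f ε ≠ ⊤) {s : ℂ × ℂ} (hs : s ∈ domainOmega n ε) (a : Fin n → ℤ) :
    Integrable (integrandPadic p d f a s) :=
  (integrable_majorantPadic p h).mono' (continuous_integrandPadic p a s).aestronglyMeasurable
    (Filter.Eventually.of_forall (norm_integrandPadic_le p hf hs a))

theorem integral_integrandPadic_sub_one (hf : f.IsHomogeneous d) {ε : ℝ}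
    (h : outerIntegral p d f ε ≠ ⊤) {s : ℂ × ℂ} (hs : s ∈ domainOmega n ε) (a : Fin n → ℤ) :
    fourierPadic p d f a s - 1 =
      ∫ x in (Metric.closedBall (0 : Fin n → ℚ_[p]) 1)ᶜ, integrandPadic p d f a s x := by
  have hm := (Metric.isClosed_closedBall (x := (0 : Fin n → ℚ_[p])) (ε := 1)).measurableSet
  rw [fourierPadic, ← integral_add_compl hm (integrable_integrandPadic p hf h hs a),
    setIntegral_congr_fun (g := fun _ ↦ 1) hm, setIntegral_const]
  · simp [Measure.real, volume_pi_padic_closedBall_one]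
  · intro x hx
    exact integrandPadic_eq_one p a s (by simpa using hx)

/-- The integral of the absolute value of the integrand exceeds the contribution `1` of `ℤ_pⁿ` by at
most the integral of the majorant outside `ℤ_pⁿ`. -/
theorem integral_norm_integrandPadic_sub_one (hf : f.IsHomogeneous d) {ε : ℝ}
    (h : outerIntegral p d f ε ≠ ⊤) {s : ℂ × ℂ} (hs : s ∈ domainOmega n ε) (a : Fin n → ℤ) :
    0 ≤ (∫ x, ‖integrandPadic p d f a s x‖) - 1 ∧
      (∫ x, ‖integrandPadic p d f a s x‖) - 1 ≤ (outerIntegral p d f ε).toReal := by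
  have hm := (Metric.isClosed_closedBall (x := (0 : Fin n → ℚ_[p])) (ε := 1)).measurableSet
  have hi := (integrable_integrandPadic p hf h hs a).norm
  have h1 : (∫ x, ‖integrandPadic p d f a s x‖) - 1 =
      ∫ x in (Metric.closedBall (0 : Fin n → ℚ_[p]) 1)ᶜ, ‖integrandPadic p d f a s x‖ := by
    rw [← integral_add_compl hm hi,
      setIntegral_congr_fun (g := fun _ ↦ 1) hm, setIntegral_const]
    · simp [Measure.real, volume_pi_padic_closedBall_one]
    · intro x hx
      simp only [integrandPadic_eq_one p a s (show ‖x‖ ≤ 1 by simpa using hx), norm_one]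
  rw [h1, ← integral_outer_majorantPadic]
  exact ⟨integral_nonneg fun x ↦ norm_nonneg _,
    integral_mono hi.integrableOn (integrable_majorantPadic p h).integrableOn
      (norm_integrandPadic_le p hf hs a)⟩

theorem norm_fourierPadic_sub_one_le (hf : f.IsHomogeneous d) {ε : ℝ}
    (h : outerIntegral p d f ε ≠ ⊤) {s : ℂ × ℂ} (hs : s ∈ domainOmega n ε) (a : Fin n → ℤ) :
    ‖fourierPadic p d f a s - 1‖ ≤ (outerIntegral p d f ε).toReal := by
  rw [integral_integrandPadic_sub_one p hf h hs, ← integral_outer_majorantPadic]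
  exact norm_integral_le_of_norm_le (integrable_majorantPadic p h).integrableOn
    (Filter.Eventually.of_forall (norm_integrandPadic_le p hf hs a))

open MvPolynomial in
/-- The height is integrable at every prime, including the primes of bad reduction. -/
theorem outerIntegral_ne_top (hn : 3 ≤ n) (hf : f.IsHomogeneous d) {D : ℤ} {N : ℕ}
    (hD : ∀ i, ∃ (g : MvPolynomial (Fin n) ℤ) (h : Fin n → MvPolynomial (Fin n) ℤ),
      C D * X i ^ N = g * f + ∑ j, h j * pderiv j f)
    (hD0 : D ≠ 0) {ε : ℝ} (hε : 0 < ε) : outerIntegral p d f ε ≠ ⊤ := by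
  have hDp : (D : ℚ_[p]) ≠ 0 := by exact_mod_cast hD0
  have hv := Padic.norm_eq_zpow_neg_valuation hDp
  obtain ⟨c, hc⟩ := Int.eq_ofNat_of_zero_le
    ((Padic.norm_le_one_iff_val_nonneg _).1 (Padic.norm_int_le_one (p := p) D))
  rw [hc] at hv
  rw [outerIntegral, compl_closedBall_eq_iUnion_padicShell]
  refine ne_top_of_le_ne_top ?_ (lintegral_outer_le p hf hε MeasurableSet.univ
    (B := (n * p ^ (2 * c + 1) : ℕ)) ?_ ?_)
  · exact ENNReal.mul_ne_top (ENNReal.mul_ne_top (ENNReal.natCast_ne_top _) ENNReal.ofReal_ne_top)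
      (shellSeries_ne_top hε)
  · rw [Set.inter_univ]
    refine (measure_mono Metric.sphere_subset_closedBall).trans
      ((volume_pi_padic_closedBall_one p n).trans_le ?_)
    exact_mod_cast Nat.mul_pos (by omega) (Nat.pow_pos hp.out.pos)
  · intro j _
    rw [Set.inter_univ]
    exact volume_padicTube_le_of_norm p hn hD hv j

open MvPolynomial in
/-- At a prime of good reduction the integral outside `ℤ_pⁿ` is `O(p ^ (-ε))`, uniformly in `p`. -/
theorem outerIntegral_le_of_good (hn : 3 ≤ n) (hd : 2 ≤ d) (hf : f.IsHomogeneous d) {D : ℤ} {N : ℕ}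
    (hD : ∀ i, ∃ (g : MvPolynomial (Fin n) ℤ) (h : Fin n → MvPolynomial (Fin n) ℤ),
      C D * X i ^ N = g * f + ∑ j, h j * pderiv j f)
    (hDp : (D : ZMod p) ≠ 0) {ε : ℝ} (hε : 0 < ε) :
    outerIntegral p d f ε ≤ (n * d : ℕ) * ENNReal.ofReal ((p : ℝ) ^ (-ε)) * shellSeries ε := by
  rw [outerIntegral, compl_closedBall_eq_iUnion_padicShell]
  refine lintegral_outer_le p hf hε MeasurableSet.univ ?_ ?_
  · rw [Set.inter_univ]
    refine (measure_mono Metric.sphere_subset_closedBall).trans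
      ((volume_pi_padic_closedBall_one p n).trans_le ?_)
    exact_mod_cast Nat.mul_pos (by omega : 0 < n) (by omega : 0 < d)
  · intro j hj
    rw [Set.inter_univ]
    exact volume_padicTube_le p hn hf hD hDp hj

theorem toReal_outerIntegral_le_of_good {ε : ℝ} (hε : 0 < ε) (h : outerIntegral p d f ε ≤
      (n * d : ℕ) * ENNReal.ofReal ((p : ℝ) ^ (-ε)) * shellSeries ε) :
    (outerIntegral p d f ε).toReal ≤ (n * d : ℕ) * (shellSeries ε).toReal * (p : ℝ) ^ (-ε) := by
  have h1 := ENNReal.toReal_mono (ENNReal.mul_ne_top (ENNReal.mul_ne_top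
    (ENNReal.natCast_ne_top _) ENNReal.ofReal_ne_top) (shellSeries_ne_top hε)) h
  rw [ENNReal.toReal_mul, ENNReal.toReal_mul, ENNReal.toReal_natCast,
    ENNReal.toReal_ofReal (by positivity)] at h1
  linarith

open MvPolynomial in
/-- The local factor at a prime of good reduction not dividing `a` is `1 + O(p ^ (-1 - ε))`. -/
theorem norm_fourierPadic_sub_one_le_of_good (hn : 3 ≤ n) (hd : 2 ≤ d) (hf : f.IsHomogeneous d)
    {D : ℤ} {N : ℕ}
    (hD : ∀ i, ∃ (g : MvPolynomial (Fin n) ℤ) (h : Fin n → MvPolynomial (Fin n) ℤ),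
      C D * X i ^ N = g * f + ∑ j, h j * pderiv j f)
    (hDp : (D : ZMod p) ≠ 0) {ε : ℝ} (hε : 0 < ε) {s : ℂ × ℂ} (hs : s ∈ domainOmega n ε)
    {a : Fin n → ℤ} (ha : (fun i ↦ (a i : ZMod p)) ≠ 0) :
    ‖fourierPadic p d f a s - 1‖ ≤
      3 * ((n * d : ℕ) * (shellSeries ε).toReal) * (p : ℝ) ^ (-(1 + ε)) := by
  have hp1 := one_lt_prime_real p
  have hp2 : (2 : ℝ) ≤ p := by exact_mod_cast hp.out.two_le
  have hp0 : (0 : ℝ) < p := by linarith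
  have hpe : (p : ENNReal) ≠ 0 := by exact_mod_cast hp.out.ne_zero
  have hle := outerIntegral_le_of_good p hn hd hf hD hDp hε
  have htop : outerIntegral p d f ε ≠ ⊤ := ne_top_of_le_ne_top (ENNReal.mul_ne_top
    (ENNReal.mul_ne_top (ENNReal.natCast_ne_top _) ENNReal.ofReal_ne_top)
      (shellSeries_ne_top hε)) hle
  have hle' := toReal_outerIntegral_le_of_good p hε hle
  have hm := (Metric.isClosed_closedBall (x := (0 : Fin n → ℚ_[p])) (ε := 1)).measurableSet.compl
  have hint := integrable_integrandPadic p hf htop hs a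
  rw [integral_integrandPadic_sub_one p hf htop hs]
  have hF := norm_setIntegral_charPadic_le p
    (F := fun x ↦ (heightPadic p d f s x)⁻¹) (fun u hu x ↦ by rw [heightPadic_smul p hf s hu]) a hm
    (fun u hu x ↦ by simp [norm_smul, hu]) hint.integrableOn
  have hnorm : ∀ x, ‖(heightPadic p d f s x)⁻¹‖ ≤ majorantPadic p d f ε x := fun x ↦ by
    have := norm_integrandPadic_le p hf hs a x
    rwa [integrandPadic, norm_mul, norm_charPadic, mul_one] at this
  have hmaj := integrable_majorantPadic p htop
  have hFint : Integrable fun x ↦ ‖(heightPadic p d f s x)⁻¹‖ :=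
    hmaj.mono' (continuous_heightPadic_inv p s).norm.aestronglyMeasurable
      (Filter.Eventually.of_forall fun x ↦ by rw [norm_norm]; exact hnorm x)
  set V : Set (Fin n → ℚ_[p]) := {y | ‖aeval y (linForm a)‖ < 1} with hV
  have hVm : MeasurableSet V :=
    (isOpen_lt (continuous_aeval_padic p _).norm continuous_const).measurableSet
  -- If `a · x` is integral and `x` is not, the rescaling `y` of `x` satisfies `‖a · y‖ < 1`.
  have hsub : (Metric.closedBall (0 : Fin n → ℚ_[p]) 1)ᶜ ∩ {x | ‖aeval x (linForm a)‖ ≤ 1} ⊆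
      ⋃ k, padicShell p V (k + 1) := by
    rintro x ⟨hx1, hx2⟩
    rw [compl_closedBall_eq_iUnion_padicShell, Set.mem_iUnion] at hx1
    obtain ⟨k, hk, -⟩ := hx1
    refine Set.mem_iUnion.2 ⟨k, hk, ?_⟩
    rw [hV, Set.mem_ofPred_eq, aeval_linForm_smul, norm_mul, norm_prime_pow]
    exact (mul_le_of_le_one_right (by positivity) hx2).trans_lt
      (inv_lt_one_of_one_lt₀ (one_lt_pow₀ hp1 (Nat.succ_ne_zero k)))
  have hB := lintegral_outer_le p hf hε hVm (B := (n * d : ℕ) * (p : ENNReal)⁻¹) (by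
      rw [← ENNReal.div_eq_inv_mul.trans (mul_comm _ _),
        ENNReal.le_div_iff_mul_le (Or.inl hpe) (Or.inl (ENNReal.natCast_ne_top p)), mul_comm]
      refine (volume_hyperplane_le p ha).trans ?_
      exact_mod_cast Nat.mul_pos (by omega : 0 < n) (by omega : 0 < d)) (by
      intro j hj
      rw [← ENNReal.div_eq_inv_mul.trans (mul_comm _ _),
        ENNReal.le_div_iff_mul_le (Or.inl hpe) (Or.inl (ENNReal.natCast_ne_top p)), mul_comm,
        ← mul_assoc, ← pow_succ']
      exact volume_padicTube_hyperplane_le p hn hd hf hD hDp ha hj)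
  have h1 : (∫ x in (Metric.closedBall (0 : Fin n → ℚ_[p]) 1)ᶜ ∩
      {x | ‖aeval x (linForm a)‖ ≤ 1}, ‖(heightPadic p d f s x)⁻¹‖) ≤
      (n * d : ℕ) * (p : ℝ)⁻¹ * (p : ℝ) ^ (-ε) * (shellSeries ε).toReal := by
    calc _ ≤ ∫ x in ⋃ k, padicShell p V (k + 1), majorantPadic p d f ε x := by
          refine (integral_mono hFint.integrableOn hmaj.integrableOn hnorm).trans ?_
          exact setIntegral_mono_set hmaj.integrableOn
            (Filter.Eventually.of_forall fun x ↦ majorantPadic_nonneg p ε x)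
            (Filter.Eventually.of_forall hsub)
      _ ≤ _ := by
          rw [integral_eq_lintegral_of_nonneg_ae
            (Filter.Eventually.of_forall fun x ↦ majorantPadic_nonneg p ε x)
            (continuous_majorantPadic p ε).aestronglyMeasurable]
          refine (ENNReal.toReal_mono (ENNReal.mul_ne_top (ENNReal.mul_ne_top (ENNReal.mul_ne_top
            (ENNReal.natCast_ne_top _) (ENNReal.inv_ne_top.2 hpe)) ENNReal.ofReal_ne_top)
            (shellSeries_ne_top hε)) hB).trans_eq ?_
          rw [ENNReal.toReal_mul, ENNReal.toReal_mul, ENNReal.toReal_mul, ENNReal.toReal_natCast,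
            ENNReal.toReal_ofReal (by positivity), ENNReal.toReal_inv, ENNReal.toReal_natCast]
  have h2 : (∫ x in (Metric.closedBall (0 : Fin n → ℚ_[p]) 1)ᶜ, ‖(heightPadic p d f s x)⁻¹‖) ≤
      (n * d : ℕ) * (shellSeries ε).toReal * (p : ℝ) ^ (-ε) := by
    refine le_trans ?_ hle'
    rw [← integral_outer_majorantPadic]
    exact integral_mono hFint.integrableOn hmaj.integrableOn hnorm
  have h3 : ((p : ℝ) - 1)⁻¹ ≤ 2 * (p : ℝ)⁻¹ := by
    rw [← div_eq_mul_inv, le_div_iff₀ hp0, inv_mul_le_iff₀ (by linarith)]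
    linarith
  have h4 : (p : ℝ) ^ (-(1 + ε)) = (p : ℝ)⁻¹ * (p : ℝ) ^ (-ε) := by
    rw [neg_add, Real.rpow_add hp0, Real.rpow_neg_one]
  refine hF.trans ((add_le_add h1 (mul_le_mul h3 h2 (integral_nonneg fun x ↦ norm_nonneg _)
    (by positivity))).trans_eq ?_)
  rw [h4]
  ring

end PadicBounds

/-! ### Holomorphy of products and integrals -/

section Holomorphy

open Filter Topology in
/-- An infinite product of holomorphic functions of two variables is holomorphic when it converges
normally: by Schwarz's lemma, the derivatives of the partial products converge uniformly. -/
theorem differentiableOn_tprod_of_summable {ι : Type*} {g : ι → ℂ × ℂ → ℂ} {U : Set (ℂ × ℂ)}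
    (hU : IsOpen U) {u : ι → ℝ} (hu : Summable u) (hg : ∀ i, DifferentiableOn ℂ (g i) U)
    (hb : ∀ i, ∀ s ∈ U, ‖g i s - 1‖ ≤ u i) : DifferentiableOn ℂ (fun s ↦ ∏' i, g i s) U := by
  classical
  intro x hx
  obtain ⟨ρ, hρ, hball⟩ := Metric.isOpen_iff.1 hU x hx
  set r : ℝ := ρ / 4 with hr
  have hr0 : 0 < r := by positivity
  have hKU : Metric.closedBall x (2 * r) ⊆ U :=
    (Metric.closedBall_subset_ball (by rw [hr]; linarith)).trans hball
  have hprod := hu.hasProdUniformlyOn_one_add (f := fun i s ↦ g i s - 1)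
    (isCompact_closedBall x (2 * r)) (Eventually.of_forall fun i s hs ↦ hb i s (hKU hs))
    fun i ↦ ((hg i).continuousOn.mono hKU).sub continuousOn_const
  simp only [add_sub_cancel] at hprod
  have hunif := hprod.tendstoUniformlyOn
  set F : Finset ι → ℂ × ℂ → ℂ := fun S s ↦ ∏ i ∈ S, g i s with hF
  have hFd : ∀ S, DifferentiableOn ℂ (F S) U := by
    intro S
    induction S using Finset.induction_on with
    | empty => simp [hF]
    | insert i S hi ih =>
      simp only [hF, Finset.prod_insert hi]
      exact (hg i).mul ih
  have hsub : ∀ z ∈ Metric.ball x r, Metric.ball z r ⊆ Metric.closedBall x (2 * r) := by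
    intro z hz y hy
    rw [Metric.mem_ball] at hz hy
    rw [Metric.mem_closedBall]
    linarith [dist_triangle y z x]
  have hcauchy : UniformCauchySeqOn (fun S ↦ fderiv ℂ (F S)) atTop (Metric.ball x r) := by
    rw [Metric.uniformCauchySeqOn_iff]
    intro ε hε
    -- Derivatives are estimated by values on a ball of radius `r`.
    obtain ⟨S₀, hS₀⟩ := Metric.uniformCauchySeqOn_iff.1 hunif.uniformCauchySeqOn (ε * r / 4)
      (by positivity)
    refine ⟨S₀, fun S hS T hT z hz ↦ ?_⟩
    have hzU : ∀ W, DifferentiableAt ℂ (F W) z := fun W ↦ (hFd W).differentiableAt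
      (hU.mem_nhds (hKU (hsub z hz (Metric.mem_ball_self hr0))))
    rw [dist_eq_norm, ← fderiv_sub (hzU S) (hzU T)]
    have h : ‖fderiv ℂ (F S - F T) z‖ ≤ (ε * r / 2) / r := by
      refine Complex.norm_fderiv_le_div_of_mapsTo_ball ?_ ?_ hr0
      · exact ((hFd S).sub (hFd T)).mono ((hsub z hz).trans hKU)
      · intro y hy
        have h1 := hS₀ S hS T hT y (hsub z hz hy)
        have h2 := hS₀ S hS T hT z (hsub z hz (Metric.mem_ball_self hr0))
        rw [dist_eq_norm] at h1 h2
        rw [Metric.mem_closedBall, dist_eq_norm]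
        refine (norm_sub_le _ _).trans ?_
        simp only [Pi.sub_apply]
        linarith
    refine h.trans_lt ?_
    rw [div_lt_iff₀ hr0]
    nlinarith
  have hlim : ∀ z, ∃ L, z ∈ Metric.ball x r → Tendsto (fun S ↦ fderiv ℂ (F S) z) atTop (𝓝 L) := by
    intro z
    by_cases hz : z ∈ Metric.ball x r
    · obtain ⟨L, hL⟩ := cauchySeq_tendsto_of_complete (hcauchy.cauchySeq hz)
      exact ⟨L, fun _ ↦ hL⟩
    · exact ⟨0, fun h ↦ absurd h hz⟩
  choose L hL using hlim
  have hD := hasFDerivAt_of_tendstoUniformlyOn (x := x) Metric.isOpen_ball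
    (hcauchy.tendstoUniformlyOn_of_tendsto hL)
    (fun S z hz ↦ ((hFd S).differentiableAt
      (hU.mem_nhds (hKU (hsub z hz (Metric.mem_ball_self hr0))))).hasFDerivAt)
    (fun z hz ↦ hunif.tendsto_at (hsub z hz (Metric.mem_ball_self hr0)))
    (Metric.mem_ball_self hr0)
  exact hD.differentiableAt.differentiableWithinAt

theorem rpow_neg_le_add {A t lo hi : ℝ} (hA : 0 < A) (h1 : lo ≤ t) (h2 : t ≤ hi) :
    A ^ (-t) ≤ A ^ (-lo) + A ^ (-hi) := by
  have hp1 : 0 < A ^ (-lo) := by positivity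
  have hp2 : 0 < A ^ (-hi) := by positivity
  rcases le_total 1 A with h | h
  · have := Real.rpow_le_rpow_of_exponent_le h (neg_le_neg h1)
    linarith
  · have := Real.rpow_le_rpow_of_exponent_ge hA h (neg_le_neg h2)
    linarith

/-- Logarithmic factors are absorbed by moving the exponent by `2 δ` in both directions. -/
theorem rpow_neg_mul_abs_log_le {A t σ δ : ℝ} (hA : 0 < A) (hδ : 0 < δ) (h1 : σ - δ ≤ t)
    (h2 : t ≤ σ + δ) : A ^ (-t) * |Real.log A| ≤
      2 / δ * (A ^ (-(σ - 2 * δ)) + A ^ (-(σ + 2 * δ))) := by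
  have hlog : |Real.log A| ≤ (A ^ δ + A ^ (-δ)) / δ := by
    have ha := Real.log_le_rpow_div hA.le hδ
    have hb := Real.log_le_rpow_div (inv_pos.2 hA).le hδ
    rw [Real.log_inv, Real.inv_rpow hA.le, ← Real.rpow_neg hA.le] at hb
    have hp1 : 0 < A ^ δ / δ := by positivity
    have hp2 : 0 < A ^ (-δ) / δ := by positivity
    rw [add_div, abs_le]
    constructor <;> linarith
  calc A ^ (-t) * |Real.log A| ≤ A ^ (-t) * ((A ^ δ + A ^ (-δ)) / δ) := by gcongr
    _ = (A ^ (-(t - δ)) + A ^ (-(t + δ))) / δ := by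
      rw [mul_div_assoc', mul_add, ← Real.rpow_add hA, ← Real.rpow_add hA]
      ring_nf
    _ ≤ ((A ^ (-(σ - 2 * δ)) + A ^ (-(σ + 2 * δ))) +
        (A ^ (-(σ - 2 * δ)) + A ^ (-(σ + 2 * δ)))) / δ := by
      gcongr
      · exact rpow_neg_le_add hA (by linarith) (by linarith)
      · exact rpow_neg_le_add hA (by linarith) (by linarith)
    _ = _ := by ring

theorem norm_inv_cpow_mul_cpow {A B : ℝ} (hA : 0 < A) (hB : 0 < B) (s : ℂ × ℂ) :
    ‖((A : ℂ) ^ s.1 * (B : ℂ) ^ s.2)⁻¹‖ = A ^ (-s.1.re) * B ^ (-s.2.re) := by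
  rw [norm_inv, norm_mul, Complex.norm_cpow_eq_rpow_re_of_pos hA,
    Complex.norm_cpow_eq_rpow_re_of_pos hB, Real.rpow_neg hA.le, Real.rpow_neg hB.le, mul_inv]

theorem hasFDerivAt_inv_cpow_mul_cpow {A B : ℝ} (hA : 0 < A) (hB : 0 < B) (w : ℂ) (s : ℂ × ℂ) :
    HasFDerivAt (fun s : ℂ × ℂ ↦ ((A : ℂ) ^ s.1 * (B : ℂ) ^ s.2)⁻¹ * w)
      ((((A : ℂ) ^ s.1 * (B : ℂ) ^ s.2)⁻¹ * w * -(Real.log A : ℂ)) • ContinuousLinearMap.fst ℂ ℂ ℂ +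
       (((A : ℂ) ^ s.1 * (B : ℂ) ^ s.2)⁻¹ * w * -(Real.log B : ℂ)) •
        ContinuousLinearMap.snd ℂ ℂ ℂ) s := by
  have hexp : ∀ s : ℂ × ℂ, ((A : ℂ) ^ s.1 * (B : ℂ) ^ s.2)⁻¹ =
      Complex.exp (-((Real.log A : ℂ) * s.1 + (Real.log B : ℂ) * s.2)) := by
    intro s
    rw [Complex.cpow_def_of_ne_zero (by exact_mod_cast hA.ne'),
      Complex.cpow_def_of_ne_zero (by exact_mod_cast hB.ne'), ← Complex.exp_add, ← Complex.exp_neg,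
      Complex.ofReal_log hA.le, Complex.ofReal_log hB.le]
  simp only [hexp]
  have h1 : HasFDerivAt (fun s : ℂ × ℂ ↦ -((Real.log A : ℂ) * s.1 + (Real.log B : ℂ) * s.2))
      (-((Real.log A : ℂ) • ContinuousLinearMap.fst ℂ ℂ ℂ +
        (Real.log B : ℂ) • ContinuousLinearMap.snd ℂ ℂ ℂ)) s :=
    ((hasFDerivAt_fst.const_mul _).add (hasFDerivAt_snd.const_mul _)).neg
  refine (h1.cexp.mul_const w).congr_fderiv ?_
  ext <;> simp <;> ring

/-- Mellin-type integrals in two variables are holomorphic on the domain of absolute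
convergence. -/
theorem differentiableOn_integral_cpow {X : Type*} [MeasurableSpace X] {μ : Measure X}
    {A B : X → ℝ} {w : X → ℂ} {α β : ℝ} (hA : ∀ x, 0 < A x) (hB : ∀ x, 0 < B x)
    (hAm : Measurable A) (hBm : Measurable B) (hwm : Measurable w) (hw : ∀ x, ‖w x‖ ≤ 1)
    (hint : ∀ σ τ : ℝ, α < σ → β < τ → Integrable (fun x ↦ A x ^ (-σ) * B x ^ (-τ)) μ) :
    DifferentiableOn ℂ (fun s : ℂ × ℂ ↦ ∫ x, ((A x : ℂ) ^ s.1 * (B x : ℂ) ^ s.2)⁻¹ * w x ∂μ)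
      {s | α < s.1.re ∧ β < s.2.re} := by
  rintro s ⟨hs1, hs2⟩
  obtain ⟨δ, hδ, hδ1, hδ2⟩ : ∃ δ : ℝ, 0 < δ ∧ α < s.1.re - 2 * δ ∧ β < s.2.re - 2 * δ := by
    refine ⟨min (s.1.re - α) (s.2.re - β) / 4, by
      have : 0 < min (s.1.re - α) (s.2.re - β) := lt_min (by linarith) (by linarith)
      positivity, ?_, ?_⟩
    · linarith [min_le_left (s.1.re - α) (s.2.re - β)]
    · linarith [min_le_right (s.1.re - α) (s.2.re - β)]
  set F : ℂ × ℂ → X → ℂ := fun s x ↦ ((A x : ℂ) ^ s.1 * (B x : ℂ) ^ s.2)⁻¹ * w x with hF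
  have hFm : ∀ s, Measurable (F s) := fun s ↦ by
    refine Measurable.mul (Measurable.inv (Measurable.mul ?_ ?_)) hwm
    · exact (Complex.measurable_ofReal.comp hAm).pow_const _
    · exact (Complex.measurable_ofReal.comp hBm).pow_const _
  have hFn : ∀ s x, ‖F s x‖ ≤ A x ^ (-s.1.re) * B x ^ (-s.2.re) := fun s x ↦ by
    rw [hF, norm_mul, norm_inv_cpow_mul_cpow (hA x) (hB x)]
    have := (hA x).le
    have := (hB x).le
    exact mul_le_of_le_one_right (by positivity) (hw x)
  let a : X → ℝ := fun x ↦ A x ^ (-(s.1.re - 2 * δ)) + A x ^ (-(s.1.re + 2 * δ))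
  let b : X → ℝ := fun x ↦ B x ^ (-(s.2.re - 2 * δ)) + B x ^ (-(s.2.re + 2 * δ))
  have hab : Integrable (fun x ↦ a x * b x) μ := by
    simp only [a, b, add_mul, mul_add]
    refine ((hint _ _ ?_ ?_).add (hint _ _ ?_ ?_)).add ((hint _ _ ?_ ?_).add (hint _ _ ?_ ?_)) <;>
      linarith
  refine DifferentiableAt.differentiableWithinAt (HasFDerivAt.differentiableAt
    (hasFDerivAt_integral_of_dominated_of_fderiv_le (F := F)
      (F' := fun s x ↦ (F s x * -(Real.log (A x) : ℂ)) • ContinuousLinearMap.fst ℂ ℂ ℂ +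
       (F s x * -(Real.log (B x) : ℂ)) • ContinuousLinearMap.snd ℂ ℂ ℂ)
      (bound := fun x ↦ 4 / δ * (a x * b x)) (Metric.ball_mem_nhds s hδ)
      (Filter.Eventually.of_forall fun s ↦ (hFm s).aestronglyMeasurable) ?_ ?_ ?_
      (hab.const_mul _) ?_))
  · exact (hint _ _ hs1 hs2).mono' (hFm s).aestronglyMeasurable
      (Filter.Eventually.of_forall (hFn s))
  · have h1 : Measurable fun x ↦ F s x * -(Real.log (A x) : ℂ) :=
      (hFm s).mul (Complex.measurable_ofReal.comp (Real.measurable_log.comp hAm)).neg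
    have h2 : Measurable fun x ↦ F s x * -(Real.log (B x) : ℂ) :=
      (hFm s).mul (Complex.measurable_ofReal.comp (Real.measurable_log.comp hBm)).neg
    exact (h1.aestronglyMeasurable.smul_const _).add (h2.aestronglyMeasurable.smul_const _)
  · refine Filter.Eventually.of_forall fun x t ht ↦ ?_
    have hts : ‖t - s‖ < δ := by rwa [Metric.mem_ball, dist_eq_norm] at ht
    have ht1 : |t.1.re - s.1.re| < δ :=
      ((Complex.abs_re_le_norm (t - s).1).trans (norm_fst_le (t - s))).trans_lt hts
    have ht2 : |t.2.re - s.2.re| < δ :=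
      ((Complex.abs_re_le_norm (t - s).2).trans (norm_snd_le (t - s))).trans_lt hts
    rw [abs_lt] at ht1 ht2
    have hAx := hA x
    have hBx := hB x
    have hfst : ‖ContinuousLinearMap.fst ℂ ℂ ℂ‖ ≤ 1 := ContinuousLinearMap.norm_fst_le ℂ ℂ ℂ
    have hsnd : ‖ContinuousLinearMap.snd ℂ ℂ ℂ‖ ≤ 1 := ContinuousLinearMap.norm_snd_le ℂ ℂ ℂ
    have ha : A x ^ (-t.1.re) ≤ a x := rpow_neg_le_add hAx (by linarith) (by linarith)
    have hb : B x ^ (-t.2.re) ≤ b x := rpow_neg_le_add hBx (by linarith) (by linarith)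
    have hla : A x ^ (-t.1.re) * |Real.log (A x)| ≤ 2 / δ * a x :=
      rpow_neg_mul_abs_log_le hAx hδ (by linarith) (by linarith)
    have hlb : B x ^ (-t.2.re) * |Real.log (B x)| ≤ 2 / δ * b x :=
      rpow_neg_mul_abs_log_le hBx hδ (by linarith) (by linarith)
    have hapos : 0 < a x := by positivity
    have hbpos : 0 < b x := by positivity
    calc _ ≤ ‖F t x * -(Real.log (A x) : ℂ)‖ * 1 + ‖F t x * -(Real.log (B x) : ℂ)‖ * 1 := by
          refine (norm_add_le _ _).trans (add_le_add ?_ ?_) <;> rw [norm_smul] <;> gcongr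
      _ ≤ (A x ^ (-t.1.re) * B x ^ (-t.2.re)) * |Real.log (A x)| +
          (A x ^ (-t.1.re) * B x ^ (-t.2.re)) * |Real.log (B x)| := by
          simp only [norm_mul, norm_neg, Complex.norm_real, Real.norm_eq_abs, mul_one]
          have := hFn t x
          gcongr
      _ = (A x ^ (-t.1.re) * |Real.log (A x)|) * B x ^ (-t.2.re) +
          A x ^ (-t.1.re) * (B x ^ (-t.2.re) * |Real.log (B x)|) := by ring
      _ ≤ (2 / δ * a x) * b x + a x * (2 / δ * b x) := by gcongr
      _ = 4 / δ * (a x * b x) := by ring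
  · exact Filter.Eventually.of_forall fun x t _ ↦
      hasFDerivAt_inv_cpow_mul_cpow (hA x) (hB x) (w x) t

theorem isOpen_domainOmega (n : ℕ) (ε : ℝ) : IsOpen (domainOmega n ε) :=
  (isOpen_lt continuous_const (Complex.continuous_re.comp continuous_fst)).inter
    (isOpen_lt continuous_const (Complex.continuous_re.comp continuous_snd))

theorem differentiableOn_fourierPadic (p : ℕ) [Fact p.Prime] {n d : ℕ}
    {f : MvPolynomial (Fin n) ℤ} (hf : f.IsHomogeneous d)
    (h : ∀ ε : ℝ, 0 < ε → outerIntegral p d f ε ≠ ⊤) {ε : ℝ} (hε : 0 < ε) (a : Fin n → ℤ) :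
    DifferentiableOn ℂ (fourierPadic p d f a) (domainOmega n ε) := by
  have hmain := differentiableOn_integral_cpow (μ := (volume : Measure (Fin n → ℚ_[p])))
    (A := heightD0Padic p d f) (B := heightD1Padic p d f) (w := charPadic p a)
    (α := n) (β := n - 1)
    (fun x ↦ one_pos.trans_le (one_le_heightD0Padic p x)) (fun x ↦ heightD1Padic_pos p x)
    (continuous_heightD0Padic p).measurable (continuous_heightD1Padic p).measurable
    (continuous_charPadic p a).measurable (fun x ↦ (norm_charPadic p a x).le) (by
      intro σ τ hσ hτ
      obtain ⟨δ, hδ, h1, h2⟩ : ∃ δ : ℝ, 0 < δ ∧ n + δ < σ ∧ n - 1 + δ < τ := by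
        refine ⟨min (σ - n) (τ - (n - 1)) / 2, ?_, ?_, ?_⟩
        · have : 0 < min (σ - n) (τ - (n - 1)) := lt_min (by linarith) (by linarith)
          positivity
        · have : 0 < min (σ - n) (τ - (n - 1)) := lt_min (by linarith) (by linarith)
          linarith [min_le_left (σ - n) (τ - (n - 1))]
        · have : 0 < min (σ - n) (τ - (n - 1)) := lt_min (by linarith) (by linarith)
          linarith [min_le_right (σ - n) (τ - (n - 1))]
      have := (integrable_integrandPadic p hf (h δ hδ) (s := ((σ : ℂ), (τ : ℂ)))
        ⟨by simpa using h1, by simpa using h2⟩ a).norm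
      refine this.congr (Filter.Eventually.of_forall fun x ↦ ?_)
      simp only [integrandPadic, norm_mul, norm_charPadic, norm_heightPadic_inv, mul_one,
        Complex.ofReal_re])
  refine hmain.mono fun s hs ↦ ?_
  exact ⟨by linarith [hs.1], by linarith [hs.2]⟩

end Holomorphy

/-! ### Volumes of real tubes -/

section RealVolume

variable {n : ℕ}

theorem continuous_aeval_real (f : MvPolynomial (Fin n) ℤ) :
    Continuous fun y : Fin n → ℝ ↦ MvPolynomial.aeval y f := by
  simp only [MvPolynomial.aeval_def, MvPolynomial.eval₂_eq]
  fun_prop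

/-- The points of the annulus `1 ≤ ‖y‖ ≤ 2` of `ℝⁿ` at which the form is at most `τ`. -/
def realTube (f : MvPolynomial (Fin n) ℤ) (τ : ℝ) : Set (Fin n → ℝ) :=
  {y | 1 ≤ ‖y‖ ∧ ‖y‖ ≤ 2 ∧ |MvPolynomial.aeval y f| ≤ τ}

theorem isCompact_realAnnulus : IsCompact {y : Fin n → ℝ | 1 ≤ ‖y‖ ∧ ‖y‖ ≤ 2} := by
  refine (isCompact_closedBall (0 : Fin n → ℝ) 2).of_isClosed_subset
    ((isClosed_le continuous_const continuous_norm).inter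
      (isClosed_le continuous_norm continuous_const)) fun y hy ↦ ?_
  simpa using hy.2

open MvPolynomial in
/-- Smoothness on the compact annulus: `f` and its partial derivatives have no common zero there. -/
theorem exists_le_abs_aeval_or_pderiv {f : MvPolynomial (Fin n) ℤ}
    (hsm : IsSmoothHypersurface f) :
    ∃ c : ℝ, 0 < c ∧ ∀ y : Fin n → ℝ, 1 ≤ ‖y‖ → ‖y‖ ≤ 2 →
      c ≤ |aeval y f| ∨ ∃ i, c ≤ |aeval y (pderiv i f)| := by
  obtain ⟨c, hc0, hc⟩ := isCompact_realAnnulus.exists_forall_le'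
    (f := fun y : Fin n → ℝ ↦ |aeval y f| + ∑ i, |aeval y (pderiv i f)|) (a := 0)
    (((continuous_aeval_real f).abs.add (continuous_finsetSum _ fun i _ ↦
      (continuous_aeval_real (pderiv i f)).abs)).continuousOn) (by
    rintro y ⟨hy1, -⟩
    rcases (abs_nonneg (aeval y f)).eq_or_lt' with h0 | h0
    · let z : Fin n → ℂ := fun i ↦ algebraMap ℝ ℂ (y i)
      have hz : z ≠ 0 := by
        intro h
        have : y = 0 := funext fun i ↦ by simpa [z] using congrFun h i
        rw [this, norm_zero] at hy1
        linarith
      have hco : ∀ q : MvPolynomial (Fin n) ℤ, aeval z q = algebraMap ℝ ℂ (aeval y q) := fun q ↦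
        aeval_algebraMap_apply ℂ y q
      obtain ⟨i, hi⟩ := hsm z hz (by rw [hco, abs_eq_zero.1 h0, map_zero])
      rw [hco] at hi
      have : aeval y (pderiv i f) ≠ 0 := fun h ↦ hi (by rw [h, map_zero])
      refine add_pos_of_nonneg_of_pos (abs_nonneg _) (Finset.sum_pos' (fun _ _ ↦ abs_nonneg _)
        ⟨i, Finset.mem_univ _, abs_pos.2 this⟩)
    · exact add_pos_of_pos_of_nonneg h0 (Finset.sum_nonneg fun _ _ ↦ abs_nonneg _))
  refine ⟨c / (n + 1), by positivity, fun y h1 h2 ↦ ?_⟩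
  by_contra! hcon
  have hn : (0 : ℝ) < n + 1 := by positivity
  have h3 : ∑ i, |aeval y (pderiv i f)| ≤ ∑ _i : Fin n, c / (n + 1) :=
    Finset.sum_le_sum fun i _ ↦ (hcon.2 i).le
  rw [Finset.sum_const, Finset.card_univ, Fintype.card_fin, nsmul_eq_mul] at h3
  have h4 : c / (n + 1) + n * (c / (n + 1)) = c := by field_simp; ring
  linarith [hc y ⟨h1, h2⟩, hcon.1]

open MvPolynomial in
/-- A uniform form of the implicit function theorem: where a partial derivative is bounded below,
the form grows linearly along short segments in the corresponding direction. -/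
theorem exists_linear_growth (f : MvPolynomial (Fin n) ℤ) (i : Fin n) {c : ℝ} (hc : 0 < c) :
    ∃ t₀ : ℝ, 0 < t₀ ∧ t₀ ≤ 1 ∧ ∀ y : Fin n → ℝ, ‖y‖ ≤ 2 → c ≤ |aeval y (pderiv i f)| →
      ∀ t : ℝ, 0 ≤ t → t ≤ t₀ → t * (c / 2) ≤ |aeval (y + Pi.single i t) f - aeval y f| := by
  obtain ⟨r, hr⟩ := exists_taylor_remainder f i
  obtain ⟨M, hM⟩ := ((isCompact_Icc (a := (0 : ℝ)) (b := 1)).prod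
    (isCompact_closedBall (0 : Fin n → ℝ) 2)).exists_bound_of_continuousOn
    (f := fun q : ℝ × (Fin n → ℝ) ↦ aeval (fun o : Option (Fin n) ↦ o.elim q.1 q.2) r) (by
      refine Continuous.continuousOn ?_
      simp only [aeval_def, eval₂_eq]
      refine continuous_finsetSum _ fun m _ ↦ continuous_const.mul
        (continuous_finsetProd _ fun o _ ↦ Continuous.pow ?_ _)
      rcases o with _ | o
      · exact continuous_fst
      · exact (continuous_apply o).comp continuous_snd)
  have hM1 : 0 < |M| + 1 := by positivity
  refine ⟨min 1 (c / (2 * (|M| + 1))), lt_min one_pos (by positivity), min_le_left _ _,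
    fun y hy hd t ht0 ht ↦ ?_⟩
  have ht1 : t ≤ 1 := ht.trans (min_le_left _ _)
  have hb : |aeval (fun o : Option (Fin n) ↦ o.elim t y) r| ≤ |M| + 1 := by
    have := hM (t, y) ⟨⟨ht0, ht1⟩, by simpa using hy⟩
    rw [Real.norm_eq_abs] at this
    linarith [le_abs_self M]
  have ht2 : t * (|M| + 1) ≤ c / 2 := by
    have := ht.trans (min_le_right _ _)
    rw [le_div_iff₀ (by positivity)] at this
    linarith
  rw [hr ℝ y t]
  calc t * (c / 2) ≤ t * c - t * (t * (|M| + 1)) := by nlinarith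
    _ ≤ |t * aeval y (pderiv i f)| - |t ^ 2 * aeval (fun o : Option (Fin n) ↦ o.elim t y) r| := by
      rw [abs_mul, abs_mul, abs_of_nonneg ht0, abs_of_nonneg (sq_nonneg t), sq, mul_assoc]
      gcongr
    _ ≤ _ := by
      have := abs_sub_abs_le_abs_sub (t * aeval y (pderiv i f))
        (-(t ^ 2 * aeval (fun o : Option (Fin n) ↦ o.elim t y) r))
      rw [abs_neg, sub_neg_eq_add] at this
      refine this.trans (le_of_eq ?_)
      congr 1
      ring

open MvPolynomial in
/-- A real tube of radius `τ` has volume `O(τ)`: about `1 / τ` disjoint translates of it, in the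
direction of a large partial derivative, lie in a fixed ball. -/
theorem exists_volume_realTube_le {f : MvPolynomial (Fin n) ℤ} (hsm : IsSmoothHypersurface f) :
    ∃ C : ℝ, 0 ≤ C ∧ ∀ τ : ℝ, 0 < τ → volume (realTube f τ) ≤ ENNReal.ofReal (C * τ) := by
  obtain ⟨c, hc, hcov⟩ := exists_le_abs_aeval_or_pderiv hsm
  choose t₀ ht₀ ht₁ hgrow using fun i ↦ exists_linear_growth f i hc
  set V : ℝ := (volume (Metric.closedBall (0 : Fin n → ℝ) 3)).toReal with hV
  have hV0 : 0 ≤ V := ENNReal.toReal_nonneg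
  have hVtop : volume (Metric.closedBall (0 : Fin n → ℝ) 3) = ENNReal.ofReal V :=
    (ENNReal.ofReal_toReal measure_closedBall_lt_top.ne).symm
  let B : ℝ → Fin n → Set (Fin n → ℝ) := fun τ i ↦
    {y | ‖y‖ ≤ 2} ∩ ({y | |aeval y f| ≤ τ} ∩ {y | c ≤ |aeval y (pderiv i f)|})
  have hBm : ∀ τ i, MeasurableSet (B τ i) := fun τ i ↦
    ((isClosed_le continuous_norm continuous_const).inter
      ((isClosed_le (continuous_aeval_real f).abs continuous_const).inter
      (isClosed_le continuous_const (continuous_aeval_real _).abs))).measurableSet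
  have hB : ∀ τ, 0 < τ → ∀ i, volume (B τ i) ≤ ENNReal.ofReal (V * (5 / (c * t₀ i)) * τ) := by
    intro τ hτ i
    -- translates by multiples of `h` are disjoint, and `m` of them fit in the segment
    set h : ℝ := 5 * τ / c with hh
    have hh0 : 0 < h := by positivity
    set m : ℕ := ⌊t₀ i / h⌋₊ + 1 with hm
    have hm1 : t₀ i / h ≤ m := by
      rw [hm]
      push_cast
      exact (Nat.lt_floor_add_one _).le
    have hm2 : ∀ l : ℕ, l < m → (l : ℝ) * h ≤ t₀ i := by
      intro l hl
      rw [← le_div_iff₀ hh0]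
      exact (Nat.le_floor_iff (div_nonneg (ht₀ i).le hh0.le)).1 (Nat.lt_succ_iff.1 hl)
    let v : ℕ → Fin n → ℝ := fun l ↦ Pi.single i ((l : ℝ) * h)
    have hdisj : ∀ l l' : ℕ, l < l' → l' < m → ∀ x : Fin n → ℝ, -v l + x ∈ B τ i →
        -v l' + x ∈ B τ i → False := by
      intro l l' hll hl' x hx hx'
      have hy : -v l + x = (-v l' + x) + Pi.single i (((l' : ℝ) - l) * h) := by
        funext k
        by_cases hk : k = i
        · subst hk; simp [v]; ring
        · simp [v, hk]
      have hl1 : (1 : ℝ) ≤ (l' : ℝ) - l := by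
        have : ((l + 1 : ℕ) : ℝ) ≤ l' := by exact_mod_cast hll
        push_cast at this
        linarith
      have ht : h ≤ ((l' : ℝ) - l) * h := by nlinarith
      have hg := hgrow i (-v l' + x) hx'.1 hx'.2.2 (((l' : ℝ) - l) * h) (hh0.le.trans ht) (by
        have := hm2 l' hl'
        have : (0 : ℝ) ≤ l * h := by positivity
        linarith)
      rw [← hy] at hg
      have h1 : |aeval (-v l + x) f| ≤ τ := hx.2.1
      have h2 : |aeval (-v l' + x) f| ≤ τ := hx'.2.1
      have h3 := abs_sub (aeval (-v l + x) f) (aeval (-v l' + x) f)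
      have h4 : h * (c / 2) ≤ ((l' : ℝ) - l) * h * (c / 2) := by gcongr
      have h5 : h * (c / 2) = 5 / 2 * τ := by rw [hh]; field_simp
      linarith
    have hsum : ∑ l ∈ Finset.range m, volume ((fun x ↦ -v l + x) ⁻¹' B τ i) ≤
        volume (Metric.closedBall (0 : Fin n → ℝ) 3) := by
      rw [← measure_biUnion_finset]
      · refine measure_mono (Set.iUnion₂_subset fun l hl x hx ↦ ?_)
        have h1 : ‖-v l + x‖ ≤ 2 := hx.1
        have h2 : ‖v l‖ ≤ 1 := by
          have := hm2 l (Finset.mem_range.1 hl)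
          simp only [v, Pi.norm_single, Real.norm_eq_abs]
          rw [abs_of_nonneg (by positivity)]
          exact this.trans (ht₁ i)
        have h3 := norm_add_le (v l) (-v l + x)
        rw [add_neg_cancel_left] at h3
        rw [Metric.mem_closedBall, dist_zero_right]
        linarith
      · intro l hl l' hl' hll
        refine Set.disjoint_left.2 fun x hx hx' ↦ ?_
        rcases lt_or_gt_of_ne hll with h | h
        · exact hdisj l l' h (Finset.mem_range.1 hl') x hx hx'
        · exact hdisj l' l h (Finset.mem_range.1 hl) x hx' hx
      · intro l _
        exact (hBm τ i).preimage (measurable_const_add _)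
    simp only [measure_preimage_add, Finset.sum_const, Finset.card_range, nsmul_eq_mul] at hsum
    have hm0 : (0 : ℝ) < m := by rw [hm]; positivity
    rw [hVtop, mul_comm, ← ENNReal.le_div_iff_mul_le (by left; simp [hm]) (by simp),
      ← ENNReal.ofReal_natCast m, ← ENNReal.ofReal_div_of_pos hm0] at hsum
    refine hsum.trans (ENNReal.ofReal_le_ofReal ?_)
    have ht := ht₀ i
    rw [div_le_iff₀ hm0]
    calc V = V * (5 / (c * t₀ i)) * τ * (t₀ i / h) := by rw [hh]; field_simp
      _ ≤ _ := by gcongr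
  refine ⟨V / c + ∑ i, V * (5 / (c * t₀ i)), ?_, fun τ hτ ↦ ?_⟩
  · have : 0 ≤ ∑ i, V * (5 / (c * t₀ i)) := Finset.sum_nonneg fun i _ ↦ by
      have := ht₀ i
      positivity
    positivity
  have hsum0 : ∀ i, 0 ≤ V * (5 / (c * t₀ i)) := fun i ↦ by
    have := ht₀ i
    positivity
  rcases lt_or_ge τ c with h | h
  · have hsub : realTube f τ ⊆ ⋃ i, B τ i := by
      rintro y ⟨h1, h2, h3⟩
      rcases hcov y h1 h2 with h4 | ⟨i, hi⟩
      · linarith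
      · exact Set.mem_iUnion.2 ⟨i, h2, h3, hi⟩
    calc volume (realTube f τ) ≤ ∑ i, volume (B τ i) :=
          (measure_mono hsub).trans (measure_iUnion_fintype_le _ _)
      _ ≤ ∑ i, ENNReal.ofReal (V * (5 / (c * t₀ i)) * τ) := Finset.sum_le_sum fun i _ ↦ hB τ hτ i
      _ = ENNReal.ofReal ((∑ i, V * (5 / (c * t₀ i))) * τ) := by
        rw [Finset.sum_mul, ENNReal.ofReal_sum_of_nonneg fun i _ ↦ mul_nonneg (hsum0 i) hτ.le]
      _ ≤ _ := by
        gcongr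
        have : 0 ≤ V / c := by positivity
        linarith
  · calc volume (realTube f τ) ≤ volume (Metric.closedBall (0 : Fin n → ℝ) 3) := by
          refine measure_mono fun y hy ↦ ?_
          rw [Metric.mem_closedBall, dist_zero_right]
          linarith [hy.2.1]
      _ = ENNReal.ofReal V := hVtop
      _ ≤ _ := by
        refine ENNReal.ofReal_le_ofReal ?_
        have h1 : V ≤ V / c * τ := by
          rw [div_mul_eq_mul_div, le_div_iff₀ hc]
          gcongr
        have h2 : 0 ≤ (∑ i, V * (5 / (c * t₀ i))) * τ :=
          mul_nonneg (Finset.sum_nonneg fun i _ ↦ hsum0 i) hτ.le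
        rw [add_mul]
        linarith

end RealVolume

/-! ### The archimedean height -/

section RealHeight

variable {n d : ℕ} {f : MvPolynomial (Fin n) ℤ}

theorem realSize_sq (x : Fin n → ℝ) : realSize x ^ 2 = 1 + ∑ i, x i ^ 2 :=
  Real.sq_sqrt (by positivity)

theorem one_le_realSize (x : Fin n → ℝ) : 1 ≤ realSize x := by
  rw [realSize, Real.one_le_sqrt]
  have : 0 ≤ ∑ i, x i ^ 2 := by positivity
  linarith

theorem norm_le_realSize (x : Fin n → ℝ) : ‖x‖ ≤ realSize x := by
  refine (pi_norm_le_iff_of_nonneg (by linarith [one_le_realSize x])).2 fun i ↦ ?_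
  rw [Real.norm_eq_abs]
  refine Real.abs_le_sqrt ?_
  have : x i ^ 2 ≤ ∑ i, x i ^ 2 := Finset.single_le_sum (f := fun i ↦ x i ^ 2)
    (fun i _ ↦ sq_nonneg (x i)) (Finset.mem_univ i)
  linarith

theorem realSize_le (x : Fin n → ℝ) (r : ℝ) (hr : 1 ≤ r) (hx : ‖x‖ ≤ r) :
    realSize x ≤ (n + 1) * r := by
  refine Real.sqrt_le_iff.2 ⟨by positivity, ?_⟩
  have h : ∑ i, x i ^ 2 ≤ ∑ _i : Fin n, r ^ 2 := Finset.sum_le_sum fun i _ ↦ by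
    have := (norm_le_pi_norm x i).trans hx
    rw [Real.norm_eq_abs] at this
    exact sq_le_sq' (by linarith [abs_le.1 this]) (abs_le.1 this).2
  rw [Finset.sum_const, Finset.card_univ, Fintype.card_fin, nsmul_eq_mul] at h
  have hn : (0 : ℝ) ≤ n := Nat.cast_nonneg n
  nlinarith [mul_nonneg hn (sq_nonneg r), mul_nonneg (mul_nonneg hn hn) (sq_nonneg r)]

theorem continuous_realSize : Continuous (realSize : (Fin n → ℝ) → ℝ) := by
  unfold realSize
  fun_prop

theorem exists_abs_aeval_le (hf : f.IsHomogeneous d) :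
    ∃ C : ℝ, 1 ≤ C ∧ ∀ x : Fin n → ℝ, |MvPolynomial.aeval x f| ≤ C * realSize x ^ d := by
  obtain ⟨C, hC⟩ := (isCompact_closedBall (0 : Fin n → ℝ) 1).exists_bound_of_continuousOn
    (continuous_aeval_real f).continuousOn
  refine ⟨max 1 C, le_max_left _ _, fun x ↦ ?_⟩
  have h1 : 0 < realSize x := by linarith [one_le_realSize x]
  have h2 : x = realSize x • ((realSize x)⁻¹ • x) := by
    rw [smul_smul, mul_inv_cancel₀ h1.ne', one_smul]
  have h3 := hC ((realSize x)⁻¹ • x) (by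
    rw [Metric.mem_closedBall, dist_zero_right, norm_smul, norm_inv, Real.norm_of_nonneg h1.le,
      inv_mul_le_iff₀ h1, mul_one]
    exact norm_le_realSize x)
  rw [Real.norm_eq_abs] at h3
  rw [h2, aeval_smul_of_isHomogeneous hf, abs_mul, abs_of_nonneg (pow_nonneg h1.le d), ← h2,
    mul_comm]
  gcongr
  exact h3.trans (le_max_right _ _)

theorem sqrt_heightD1Real_pos (x : Fin n → ℝ) :
    0 < √((1 / realSize x) ^ 2 + (|MvPolynomial.aeval x f| / realSize x ^ d) ^ 2) := by
  have h1 : 0 < realSize x := by linarith [one_le_realSize x]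
  positivity

theorem heightD1Real_pos (x : Fin n → ℝ) : 0 < heightD1Real d f x :=
  inv_pos.2 (sqrt_heightD1Real_pos x)

theorem heightD1Real_le (x : Fin n → ℝ) : heightD1Real d f x ≤ realSize x := by
  have h1 : 0 < realSize x := by linarith [one_le_realSize x]
  rw [heightD1Real, inv_le_comm₀ (sqrt_heightD1Real_pos x) h1]
  refine Real.le_sqrt_of_sq_le ?_
  rw [one_div]
  exact le_add_of_nonneg_right (sq_nonneg _)

theorem heightD1Real_mul_abs_le (x : Fin n → ℝ) :
    heightD1Real d f x * |MvPolynomial.aeval x f| ≤ realSize x ^ d := by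
  have h1 : 0 < realSize x := by linarith [one_le_realSize x]
  rw [heightD1Real, inv_mul_le_iff₀ (sqrt_heightD1Real_pos x), ← div_le_iff₀ (by positivity)]
  exact Real.le_sqrt_of_sq_le (le_add_of_nonneg_left (sq_nonneg _))

theorem heightD0Real_eq (x : Fin n → ℝ) :
    heightD0Real d f x = realSize x / heightD1Real d f x := by
  rw [heightD0Real, inv_div]

theorem one_le_heightD0Real (x : Fin n → ℝ) : 1 ≤ heightD0Real d f x := by
  rw [heightD0Real_eq, one_le_div (heightD1Real_pos x)]
  exact heightD1Real_le x

/-- At the real place `H_{D₁}` may be smaller than `1`, but it is bounded below. -/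
theorem exists_le_heightD1Real (hf : f.IsHomogeneous d) :
    ∃ C : ℝ, 1 ≤ C ∧ ∀ x : Fin n → ℝ, 1 ≤ C * heightD1Real d f x := by
  obtain ⟨C, hC1, hC⟩ := exists_abs_aeval_le hf
  refine ⟨1 + C, by linarith, fun x ↦ ?_⟩
  have h1 : 0 < realSize x := by linarith [one_le_realSize x]
  rw [heightD1Real, ← div_eq_mul_inv, one_le_div (sqrt_heightD1Real_pos x)]
  refine Real.sqrt_le_iff.2 ⟨by linarith, ?_⟩
  have h2 : 1 / realSize x ≤ 1 := (div_le_one h1).2 (one_le_realSize x)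
  have h3 : |MvPolynomial.aeval x f| / realSize x ^ d ≤ C :=
    (div_le_iff₀ (by positivity)).2 (hC x)
  have h4 : 0 ≤ 1 / realSize x := by positivity
  have h5 : 0 ≤ |MvPolynomial.aeval x f| / realSize x ^ d := by positivity
  nlinarith

theorem continuous_heightD1Real : Continuous (heightD1Real d f : (Fin n → ℝ) → ℝ) := by
  have h1 : ∀ x : Fin n → ℝ, realSize x ≠ 0 := fun x ↦ by linarith [one_le_realSize x]
  have h2 := continuous_realSize (n := n)
  have h3 := continuous_aeval_real f
  refine Continuous.inv₀ (Real.continuous_sqrt.comp (((continuous_const.div h2 h1).pow 2).add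
    ((h3.abs.div (h2.pow d) fun x ↦ pow_ne_zero _ (h1 x)).pow 2)))
    fun x ↦ (sqrt_heightD1Real_pos x).ne'

theorem continuous_heightD0Real : Continuous (heightD0Real d f : (Fin n → ℝ) → ℝ) := by
  have : heightD0Real d f = fun x : Fin n → ℝ ↦ realSize x / heightD1Real d f x :=
    funext heightD0Real_eq
  rw [this]
  exact continuous_realSize.div continuous_heightD1Real fun x ↦ (heightD1Real_pos x).ne'

theorem norm_charReal (a : Fin n → ℤ) (x : Fin n → ℝ) : ‖charReal a x‖ = 1 := by
  rw [charReal, Complex.norm_exp]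
  simp

theorem continuous_charReal (a : Fin n → ℤ) : Continuous (charReal a) := by
  unfold charReal
  fun_prop

/-- The dominating function `ρ(x) ^ (-(n + ε)) H_{D₁,∞}(x)`, the value of `|H(s;x)⁻¹|` at the
corner of the domain. -/
noncomputable def majorantReal (d : ℕ) (f : MvPolynomial (Fin n) ℤ) (ε : ℝ) (x : Fin n → ℝ) : ℝ :=
  realSize x ^ (-(n + ε)) * heightD1Real d f x

theorem majorantReal_nonneg (ε : ℝ) (x : Fin n → ℝ) : 0 ≤ majorantReal d f ε x :=
  mul_nonneg (Real.rpow_nonneg (by linarith [one_le_realSize x]) _) (heightD1Real_pos x).le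

theorem continuous_majorantReal (ε : ℝ) :
    Continuous (majorantReal d f ε : (Fin n → ℝ) → ℝ) :=
  (continuous_realSize.rpow_const fun x ↦ Or.inl (by linarith [one_le_realSize x])).mul
    continuous_heightD1Real

/-- A number at most `2 ^ k` with `h u ≤ 1` is dominated by a sum over the dyadic scales of `u`. -/
theorem le_dyadic_sum {h u : ℝ} (hh : 0 ≤ h) (hhu : h * u ≤ 1) (k : ℕ) (hk : h ≤ 2 ^ k) :
    h ≤ 1 + ∑ j ∈ Finset.range (k + 1), 2 ^ (j + 1) * (if u * 2 ^ j ≤ 1 then 1 else 0) := by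
  induction k with
  | zero =>
    refine hk.trans ?_
    have : (0 : ℝ) ≤ ∑ j ∈ Finset.range (0 + 1), 2 ^ (j + 1) * (if u * 2 ^ j ≤ 1 then 1 else 0) :=
      Finset.sum_nonneg fun j _ ↦ by split_ifs <;> positivity
    linarith
  | succ k ih =>
    -- Either `u ≤ 2 ^ (-k)` and the term of index `k` suffices alone, or `h ≤ 2 ^ k` and the
    -- induction hypothesis applies.
    rw [Finset.sum_range_succ]
    have h0 : (0 : ℝ) ≤ 2 ^ (k + 1 + 1) * (if u * 2 ^ (k + 1) ≤ 1 then 1 else 0) := by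
      split_ifs <;> positivity
    by_cases hu : u * 2 ^ k ≤ 1
    · have h1 : (0 : ℝ) ≤ ∑ j ∈ Finset.range k, 2 ^ (j + 1) * (if u * 2 ^ j ≤ 1 then 1 else 0) :=
        Finset.sum_nonneg fun j _ ↦ by split_ifs <;> positivity
      rw [Finset.sum_range_succ, if_pos hu]
      linarith
    · have h1 : h ≤ 2 ^ k := by
        have h2 : (0 : ℝ) < 2 ^ k := by positivity
        nlinarith
      linarith [ih h1]

/-- The part of the shell `2 ^ k ≤ ‖x‖ ≤ 2 ^ (k + 1)` on which the form is at most `2 ^ (k d) τ` is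
contained in a dilation by `2 ^ k` of a tube in the annulus `1 ≤ ‖y‖ ≤ 2`. -/
theorem volume_shell_inter_le (hf : f.IsHomogeneous d) (k : ℕ) (τ : ℝ) :
    volume {x : Fin n → ℝ | 2 ^ k ≤ ‖x‖ ∧ ‖x‖ ≤ 2 ^ (k + 1) ∧
      |MvPolynomial.aeval x f| ≤ 2 ^ (k * d) * τ} ≤
      ENNReal.ofReal (2 ^ (k * n)) * volume (realTube f τ) := by
  have h2 : (0 : ℝ) < 2 ^ k := by positivity
  have := Measure.addHaar_smul (volume : Measure (Fin n → ℝ)) ((2 : ℝ) ^ k) (realTube f τ)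
  rw [Module.finrank_fin_fun, ← pow_mul, abs_of_pos (by positivity)] at this
  rw [← this]
  refine measure_mono fun x hx ↦ ?_
  rw [Set.mem_smul_set_iff_inv_smul_mem₀ h2.ne']
  obtain ⟨hx1, hx2, hx3⟩ := hx
  refine ⟨?_, ?_, ?_⟩
  · rw [norm_smul, norm_inv, Real.norm_of_nonneg h2.le, ← div_eq_inv_mul]
    exact (one_le_div h2).2 hx1
  · rw [norm_smul, norm_inv, Real.norm_of_nonneg h2.le, ← div_eq_inv_mul, div_le_iff₀ h2]
    rwa [pow_succ, mul_comm] at hx2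
  · rw [aeval_smul_of_isHomogeneous hf, abs_mul, abs_of_nonneg (by positivity), inv_pow,
      ← pow_mul, inv_mul_le_iff₀ (by positivity)]
    exact hx3

/-- On the shell of size `2 ^ k` the majorant is bounded by a sum over the tubes of radius
`2 ^ (-j)` with `j ≤ k`, weighted by `2 ^ j`. -/
theorem majorantReal_le_of_mem_shell {ε : ℝ} (hε : 0 ≤ ε) {k : ℕ} {x : Fin n → ℝ}
    (h1 : 2 ^ k ≤ ‖x‖) (h2 : ‖x‖ ≤ 2 ^ (k + 1)) :
    majorantReal d f ε x ≤ (2 * (n + 1) + (2 * (n + 1)) ^ d) * ((2 : ℝ) ^ k) ^ (-(n + ε)) *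
      (1 + ∑ j ∈ Finset.range (k + 1), 2 ^ (j + 1) *
        (if |MvPolynomial.aeval x f| ≤ 2 ^ (k * d) * (2 ^ j)⁻¹ then 1 else 0)) := by
  have hρ : 0 < realSize x := by linarith [one_le_realSize x]
  have h2k : (0 : ℝ) < 2 ^ k := by positivity
  set L : ℝ := 2 * (n + 1) with hL
  have hL0 : 0 < L := by positivity
  have hρL : realSize x ≤ L * 2 ^ k := by
    refine (realSize_le x _ (one_le_pow₀ one_le_two) h2).trans (le_of_eq ?_)
    rw [hL]
    ring
  have hM : 0 < L + L ^ d := by positivity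
  have hpos := heightD1Real_pos (d := d) (f := f) x
  have key := le_dyadic_sum (h := heightD1Real d f x / (L + L ^ d))
    (u := |MvPolynomial.aeval x f| / 2 ^ (k * d)) (by positivity) (by
      rw [div_mul_div_comm, div_le_one (by positivity)]
      refine (heightD1Real_mul_abs_le x).trans ?_
      calc realSize x ^ d ≤ (L * 2 ^ k) ^ d := by gcongr
        _ = L ^ d * 2 ^ (k * d) := by rw [mul_pow, pow_mul]
        _ ≤ _ := by gcongr; linarith) k (by
      rw [div_le_iff₀ hM]
      refine (heightD1Real_le x).trans (hρL.trans ?_)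
      rw [mul_comm]
      gcongr
      have : 0 < L ^ d := by positivity
      linarith)
  have hcond : ∀ j : ℕ, |MvPolynomial.aeval x f| / 2 ^ (k * d) * 2 ^ j ≤ 1 ↔
      |MvPolynomial.aeval x f| ≤ 2 ^ (k * d) * (2 ^ j)⁻¹ := fun j ↦ by
    rw [← le_div_iff₀ (by positivity), div_le_iff₀ (by positivity), one_div, mul_comm]
  simp only [hcond] at key
  rw [div_le_iff₀ hM] at key
  have hpow : realSize x ^ (-(n + ε)) ≤ ((2 : ℝ) ^ k) ^ (-(n + ε)) :=
    Real.rpow_le_rpow_of_nonpos h2k (h1.trans (norm_le_realSize x)) (by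
      have : (0 : ℝ) ≤ n := Nat.cast_nonneg n
      linarith)
  calc majorantReal d f ε x ≤ ((2 : ℝ) ^ k) ^ (-(n + ε)) * heightD1Real d f x := by
        rw [majorantReal]
        gcongr
    _ ≤ _ := mul_le_mul_of_nonneg_left key (by positivity)
    _ = _ := by ring

/-- The shell of size `2 ^ k` contributes `O(k 2 ^ (-ε k))`, because the tubes at all the scales
`2 ^ (-j)` with `j ≤ k` contribute equally. -/
theorem integrable_majorantReal (hf : f.IsHomogeneous d) (hsm : IsSmoothHypersurface f) {ε : ℝ}
    (hε : 0 < ε) : Integrable (majorantReal d f ε : (Fin n → ℝ) → ℝ) := by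
  classical
  refine ⟨(continuous_majorantReal ε).aestronglyMeasurable, ?_⟩
  rw [hasFiniteIntegral_iff_ofReal (Filter.Eventually.of_forall (majorantReal_nonneg ε))]
  obtain ⟨C, hC0, hC⟩ := exists_volume_realTube_le hsm
  set S : ℕ → Set (Fin n → ℝ) := fun k ↦ {x | 2 ^ k ≤ ‖x‖ ∧ ‖x‖ ≤ 2 ^ (k + 1)} with hS
  have hcover : Set.univ ⊆ Metric.closedBall (0 : Fin n → ℝ) 1 ∪ ⋃ k, S k := by
    intro x _
    rcases le_or_gt ‖x‖ 1 with h | h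
    · exact Or.inl (by simpa using h)
    · obtain ⟨k, hk1, hk2⟩ := exists_nat_pow_near h.le one_lt_two
      exact Or.inr (Set.mem_iUnion.2 ⟨k, hk1, hk2.le⟩)
  set M : ℝ := 2 * (n + 1) + (2 * (n + 1)) ^ d with hM
  have hM0 : 0 ≤ M := by positivity
  set V := volume {y : Fin n → ℝ | 1 ≤ ‖y‖ ∧ ‖y‖ ≤ 2} with hV
  have hVtop : V ≠ ⊤ := (isCompact_realAnnulus (n := n)).measure_lt_top.ne
  -- the tubes at scale `2 ^ (-j)` contribute equally for all `j ≤ k`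
  have hshell : ∀ k, ∫⁻ x in S k, ENNReal.ofReal (majorantReal d f ε x) ≤
      (ENNReal.ofReal M * (V + ENNReal.ofReal (2 * C))) *
        (((k : ENNReal) + 2) * ENNReal.ofReal ((2 : ℝ) ^ (-ε)) ^ k) := by
    intro k
    set T : ℕ → Set (Fin n → ℝ) := fun j ↦
      {x | |MvPolynomial.aeval x f| ≤ 2 ^ (k * d) * (2 ^ j)⁻¹} with hT
    have hTm : ∀ j, MeasurableSet (T j) := fun j ↦
      (isClosed_le (continuous_aeval_real f).abs continuous_const).measurableSet
    have hSm : MeasurableSet (S k) := ((isClosed_le continuous_const continuous_norm).inter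
      (isClosed_le continuous_norm continuous_const)).measurableSet
    set E : ℝ := ((2 : ℝ) ^ k) ^ (-(n + ε)) with hE
    have hE0 : 0 ≤ E := by positivity
    have hle : ∀ x ∈ S k, ENNReal.ofReal (majorantReal d f ε x) ≤ ENNReal.ofReal (M * E) *
        (1 + ∑ j ∈ Finset.range (k + 1), ENNReal.ofReal (2 ^ (j + 1)) *
          (T j).indicator 1 x) := by
      intro x hx
      refine (ENNReal.ofReal_le_ofReal (majorantReal_le_of_mem_shell hε.le hx.1 hx.2)).trans ?_
      rw [ENNReal.ofReal_mul (by positivity), ENNReal.ofReal_add zero_le_one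
        (Finset.sum_nonneg fun j _ ↦ by split_ifs <;> positivity), ENNReal.ofReal_one,
        ENNReal.ofReal_sum_of_nonneg fun j _ ↦ by split_ifs <;> positivity]
      gcongr with j hj
      rw [ENNReal.ofReal_mul (by positivity)]
      gcongr
      by_cases h : |MvPolynomial.aeval x f| ≤ 2 ^ (k * d) * (2 ^ j)⁻¹
      · rw [Set.indicator_of_mem (show x ∈ T j from h), if_pos h]; simp
      · rw [Set.indicator_of_notMem (show x ∉ T j from h), if_neg h]; simp
    have hSV : volume (S k) ≤ ENNReal.ofReal (2 ^ (k * n)) * V := by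
      have h2 : (0 : ℝ) < 2 ^ k := by positivity
      have := Measure.addHaar_smul (volume : Measure (Fin n → ℝ)) ((2 : ℝ) ^ k)
        {y : Fin n → ℝ | 1 ≤ ‖y‖ ∧ ‖y‖ ≤ 2}
      rw [Module.finrank_fin_fun, ← pow_mul, abs_of_pos (by positivity)] at this
      rw [← this]
      refine measure_mono fun x hx ↦ ?_
      rw [Set.mem_smul_set_iff_inv_smul_mem₀ h2.ne', Set.mem_ofPred_eq, norm_smul, norm_inv,
        Real.norm_of_nonneg h2.le, ← div_eq_inv_mul, le_div_iff₀ h2, div_le_iff₀ h2, one_mul]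
      exact ⟨hx.1, hx.2.trans_eq (by ring)⟩
    have hTV : ∀ j, ENNReal.ofReal (2 ^ (j + 1)) * volume (T j ∩ S k) ≤
        ENNReal.ofReal (2 ^ (k * n)) * ENNReal.ofReal (2 * C) := by
      intro j
      have h1 : volume (T j ∩ S k) ≤ ENNReal.ofReal (2 ^ (k * n)) *
          ENNReal.ofReal (C * (2 ^ j)⁻¹) := by
        refine (measure_mono ?_).trans ((volume_shell_inter_le hf k (2 ^ j)⁻¹).trans ?_)
        · exact fun x hx ↦ ⟨hx.2.1, hx.2.2, hx.1⟩
        · gcongr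
          exact hC _ (by positivity)
      calc _ ≤ ENNReal.ofReal (2 ^ (j + 1)) * (ENNReal.ofReal (2 ^ (k * n)) *
            ENNReal.ofReal (C * (2 ^ j)⁻¹)) := by gcongr
        _ = ENNReal.ofReal (2 ^ (k * n)) * (ENNReal.ofReal (2 ^ (j + 1)) *
            ENNReal.ofReal (C * (2 ^ j)⁻¹)) := by ring
        _ = _ := by
          rw [← ENNReal.ofReal_mul (by positivity)]
          congr 2
          field_simp
          ring
    have hscale : ENNReal.ofReal E * ENNReal.ofReal (2 ^ (k * n)) =
        ENNReal.ofReal ((2 : ℝ) ^ (-ε)) ^ k := by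
      rw [← ENNReal.ofReal_pow (by positivity), ← ENNReal.ofReal_mul hE0]
      congr 1
      rw [hE, ← Real.rpow_natCast, ← Real.rpow_natCast, ← Real.rpow_natCast, ← Real.rpow_mul
        zero_le_two, ← Real.rpow_mul zero_le_two, ← Real.rpow_add two_pos]
      congr 1
      push_cast
      ring
    calc ∫⁻ x in S k, ENNReal.ofReal (majorantReal d f ε x)
        ≤ ∫⁻ x in S k, ENNReal.ofReal (M * E) *
          (1 + ∑ j ∈ Finset.range (k + 1), ENNReal.ofReal (2 ^ (j + 1)) * (T j).indicator 1 x) :=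
          setLIntegral_mono' hSm hle
      _ = ENNReal.ofReal (M * E) * (volume (S k) + ∑ j ∈ Finset.range (k + 1),
          ENNReal.ofReal (2 ^ (j + 1)) * volume (T j ∩ S k)) := by
        have hind : ∀ j, Measurable ((T j).indicator (1 : (Fin n → ℝ) → ENNReal)) := fun j ↦
          measurable_one.indicator (hTm j)
        rw [lintegral_const_mul _ (by fun_prop), lintegral_add_left measurable_const,
          lintegral_finsetSum _ (fun j _ ↦ (hind j).const_mul _)]
        congr 2
        · simp
        · refine Finset.sum_congr rfl fun j _ ↦ ?_
          rw [lintegral_const_mul _ (hind j), lintegral_indicator_one (hTm j),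
            Measure.restrict_apply (hTm j)]
      _ ≤ ENNReal.ofReal (M * E) * (ENNReal.ofReal (2 ^ (k * n)) * V +
          ∑ j ∈ Finset.range (k + 1), ENNReal.ofReal (2 ^ (k * n)) * ENNReal.ofReal (2 * C)) := by
        exact mul_le_mul_right (add_le_add hSV (Finset.sum_le_sum fun j _ ↦ hTV j)) _
      _ = ENNReal.ofReal M * (ENNReal.ofReal E * ENNReal.ofReal (2 ^ (k * n))) *
          (V + ((k : ENNReal) + 1) * ENNReal.ofReal (2 * C)) := by
        rw [Finset.sum_const, Finset.card_range, nsmul_eq_mul, ENNReal.ofReal_mul hM0]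
        push_cast
        ring
      _ ≤ ENNReal.ofReal M * (ENNReal.ofReal E * ENNReal.ofReal (2 ^ (k * n))) *
          (((k : ENNReal) + 2) * V + ((k : ENNReal) + 2) * ENNReal.ofReal (2 * C)) := by
        gcongr
        · refine le_mul_of_one_le_left' ?_
          exact le_add_left one_le_two
        · exact one_le_two
      _ = _ := by rw [hscale]; ring
  have hball : ∫⁻ x in Metric.closedBall (0 : Fin n → ℝ) 1,
      ENNReal.ofReal (majorantReal d f ε x) < ⊤ :=
    ((continuous_majorantReal ε).continuousOn.integrableOn_compact
      (isCompact_closedBall (0 : Fin n → ℝ) 1)).lintegral_lt_top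
  calc ∫⁻ x, ENNReal.ofReal (majorantReal d f ε x)
      ≤ ∫⁻ x in Metric.closedBall (0 : Fin n → ℝ) 1 ∪ ⋃ k, S k,
        ENNReal.ofReal (majorantReal d f ε x) := by
        rw [← setLIntegral_univ]
        exact lintegral_mono_set hcover
    _ ≤ (∫⁻ x in Metric.closedBall (0 : Fin n → ℝ) 1, ENNReal.ofReal (majorantReal d f ε x)) +
        ∑' k, ∫⁻ x in S k, ENNReal.ofReal (majorantReal d f ε x) :=
        (lintegral_union_le _ _ _).trans (by gcongr; exact lintegral_iUnion_le _ _)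
    _ ≤ (∫⁻ x in Metric.closedBall (0 : Fin n → ℝ) 1, ENNReal.ofReal (majorantReal d f ε x)) +
        (ENNReal.ofReal M * (V + ENNReal.ofReal (2 * C))) * shellSeries ε := by
        rw [shellSeries, ← ENNReal.tsum_mul_left]
        gcongr with k
        exact hshell k
    _ < ⊤ := ENNReal.add_lt_top.2 ⟨hball, ENNReal.mul_lt_top (ENNReal.mul_lt_top
        ENNReal.ofReal_lt_top (ENNReal.add_lt_top.2 ⟨hVtop.lt_top, ENNReal.ofReal_lt_top⟩))
        (shellSeries_ne_top hε).lt_top⟩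

/-- On the domain of the parameter, the integrand is dominated by its value at the corner, up to a
factor that is bounded in vertical strips. -/
theorem exists_norm_heightReal_inv_le (hf : f.IsHomogeneous d) :
    ∃ C : ℝ, 1 ≤ C ∧ ∀ ε : ℝ, 0 < ε → ∀ σ τ : ℝ, n + ε ≤ σ → n - 1 + ε ≤ τ → 1 ≤ n →
      ∀ x : Fin n → ℝ, heightD0Real d f x ^ (-σ) * heightD1Real d f x ^ (-τ) ≤
        C ^ τ * majorantReal d f ε x := by
  obtain ⟨C, hC1, hC⟩ := exists_le_heightD1Real hf
  refine ⟨C, hC1, fun ε hε σ τ hσ hτ hn x ↦ ?_⟩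
  have hC0 : 0 < C := by linarith
  have h0 := one_le_heightD0Real (d := d) (f := f) x
  have h1 := heightD1Real_pos (d := d) (f := f) x
  have hρ : 0 < realSize x := by linarith [one_le_realSize x]
  have hn1 : (1 : ℝ) ≤ n := by exact_mod_cast hn
  have hA : heightD0Real d f x ^ (-σ) ≤ heightD0Real d f x ^ (-(n + ε)) :=
    Real.rpow_le_rpow_of_exponent_le h0 (by linarith)
  have hB : heightD1Real d f x ^ (-τ) ≤ C ^ τ * heightD1Real d f x ^ (-(n - 1 + ε)) := by
    have := Real.rpow_le_rpow_of_exponent_le (hC x) (show -τ ≤ -(n - 1 + ε) by linarith)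
    rw [Real.mul_rpow hC0.le h1.le, Real.mul_rpow hC0.le h1.le, Real.rpow_neg hC0.le,
      inv_mul_le_iff₀ (by positivity)] at this
    refine this.trans ?_
    gcongr
    exact mul_le_of_le_one_left (by positivity)
      (Real.rpow_le_one_of_one_le_of_nonpos hC1 (by linarith))
  have h0' : 0 < heightD0Real d f x := by linarith
  calc _ ≤ heightD0Real d f x ^ (-(n + ε)) * (C ^ τ * heightD1Real d f x ^ (-(n - 1 + ε))) := by
        gcongr
    _ = C ^ τ * majorantReal d f ε x := by
      rw [majorantReal, heightD0Real_eq, Real.div_rpow hρ.le h1.le,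
        show (-(n - 1 + ε) : ℝ) = -(n + ε) + 1 by ring, Real.rpow_add h1, Real.rpow_one]
      have : heightD1Real d f x ^ (-(n + ε)) ≠ 0 := by positivity
      field_simp

theorem integrable_heightReal_rpow (hf : f.IsHomogeneous d) (hsm : IsSmoothHypersurface f)
    (hn : 1 ≤ n) {σ τ : ℝ} (hσ : n < σ) (hτ : n - 1 < τ) :
    Integrable fun x : Fin n → ℝ ↦ heightD0Real d f x ^ (-σ) * heightD1Real d f x ^ (-τ) := by
  obtain ⟨C, hC1, hC⟩ := exists_norm_heightReal_inv_le hf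
  set ε := min (σ - n) (τ - (n - 1)) with hεdef
  have hε : 0 < ε := lt_min (by linarith) (by linarith)
  have h0 : ∀ x : Fin n → ℝ, 0 < heightD0Real d f x := fun x ↦
    one_pos.trans_le (one_le_heightD0Real x)
  refine ((integrable_majorantReal hf hsm hε).const_mul (C ^ τ)).mono' ?_
    (Filter.Eventually.of_forall fun x ↦ ?_)
  · exact ((continuous_heightD0Real.rpow_const fun x ↦ Or.inl (h0 x).ne').mul
      (continuous_heightD1Real.rpow_const fun x ↦
        Or.inl (heightD1Real_pos x).ne')).aestronglyMeasurable
  · have h1 := heightD1Real_pos (d := d) (f := f) x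
    have := h0 x
    rw [Real.norm_of_nonneg (by positivity)]
    refine hC ε hε σ τ ?_ ?_ hn x
    · linarith [min_le_left (σ - n) (τ - (n - 1))]
    · linarith [min_le_right (σ - n) (τ - (n - 1))]

theorem norm_integrandReal (a : Fin n → ℤ) (s : ℂ × ℂ) (x : Fin n → ℝ) :
    ‖integrandReal d f a s x‖ =
      heightD0Real d f x ^ (-s.1.re) * heightD1Real d f x ^ (-s.2.re) := by
  rw [integrandReal, norm_mul, norm_charReal, mul_one, heightReal, norm_inv_cpow_mul_cpow
    (one_pos.trans_le (one_le_heightD0Real x)) (heightD1Real_pos x)]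

theorem measurable_integrandReal (a : Fin n → ℤ) (s : ℂ × ℂ) :
    Measurable (integrandReal d f a s) := by
  refine Measurable.mul (Measurable.inv (Measurable.mul ?_ ?_)) (continuous_charReal a).measurable
  · exact (Complex.measurable_ofReal.comp continuous_heightD0Real.measurable).pow_const _
  · exact (Complex.measurable_ofReal.comp continuous_heightD1Real.measurable).pow_const _

theorem integrable_integrandReal (hf : f.IsHomogeneous d) (hsm : IsSmoothHypersurface f)
    (hn : 1 ≤ n) (a : Fin n → ℤ) {s : ℂ × ℂ} (hs0 : n < s.1.re) (hs1 : n - 1 < s.2.re) :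
    Integrable (integrandReal d f a s) :=
  (integrable_heightReal_rpow hf hsm hn hs0 hs1).mono'
    (measurable_integrandReal a s).aestronglyMeasurable
    (Filter.Eventually.of_forall fun x ↦ (norm_integrandReal a s x).le)

theorem differentiableOn_fourierReal (hf : f.IsHomogeneous d) (hsm : IsSmoothHypersurface f)
    (hn : 1 ≤ n) (a : Fin n → ℤ) {ε : ℝ} (hε : 0 < ε) :
    DifferentiableOn ℂ (fourierReal d f a) (domainOmega n ε) := by
  have hmain := differentiableOn_integral_cpow (μ := (volume : Measure (Fin n → ℝ)))
    (A := heightD0Real d f) (B := heightD1Real d f) (w := charReal a) (α := n) (β := n - 1)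
    (fun x ↦ one_pos.trans_le (one_le_heightD0Real x)) (fun x ↦ heightD1Real_pos x)
    continuous_heightD0Real.measurable continuous_heightD1Real.measurable
    (continuous_charReal a).measurable (fun x ↦ (norm_charReal a x).le)
    (fun σ τ hσ hτ ↦ integrable_heightReal_rpow hf hsm hn hσ hτ)
  exact hmain.mono fun s hs ↦ ⟨by linarith [hs.1], by linarith [hs.2]⟩

end RealHeight

/-! ### Symbols and integration by parts -/

section Symbols

open MvPolynomial

variable {n : ℕ} {ι : Type}

theorem hasLineDerivAt_aeval (P : MvPolynomial (Fin n) ℤ) (i : Fin n) (x : Fin n → ℝ) :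
    HasLineDerivAt ℝ (fun x : Fin n → ℝ ↦ aeval x P) (aeval x (pderiv i P)) x (Pi.single i 1) := by
  have h := (aeval (fun j ↦ Polynomial.C (x j) + Polynomial.X *
    Polynomial.C ((Pi.single i 1 : Fin n → ℝ) j)) P).hasDerivAt 0
  rw [derivative_aeval_line, Finset.sum_eq_single i (fun j _ hj ↦ by simp [hj]) (by simp),
    Pi.single_eq_same, one_mul] at h
  simp only [eval_aeval_line] at h
  exact h

theorem totalDegree_pderiv_le {σ R : Type*} [CommRing R] (P : MvPolynomial σ R) (i : σ) {m : ℕ}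
    (hP : P.totalDegree ≤ m) : (pderiv i P).totalDegree ≤ m - 1 := by
  classical
  rw [P.as_sum, map_sum]
  refine totalDegree_finsetSum_le fun s hs ↦ ?_
  rw [pderiv_monomial]
  by_cases h : s i = 0
  · simp [h]
  · refine (totalDegree_monomial_le _ _).trans
      (show (s - Finsupp.single i 1).sum (fun _ e ↦ e) ≤ m - 1 from ?_)
    have h1 : s.sum (fun _ e ↦ e) ≤ m := (le_totalDegree hs).trans hP
    have h2 : s = (s - Finsupp.single i 1) + Finsupp.single i 1 := by
      refine (tsub_add_cancel_of_le ?_).symm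
      rw [Finsupp.single_le_iff]
      omega
    have h3 : s.sum (fun _ e ↦ e) = (s - Finsupp.single i 1).sum (fun _ e ↦ e) + 1 := by
      conv_lhs => rw [h2]
      rw [Finsupp.sum_add_index' (fun _ ↦ rfl) fun _ _ _ ↦ rfl, Finsupp.sum_single_index rfl]
    omega

theorem exists_abs_aeval_le_of_totalDegree_le (P : MvPolynomial (Fin n) ℤ) {m : ℕ}
    (hP : P.totalDegree ≤ m) :
    ∃ C : ℝ, 0 ≤ C ∧ ∀ x : Fin n → ℝ, |aeval x P| ≤ C * realSize x ^ m := by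
  refine ⟨∑ s ∈ P.support, |algebraMap ℤ ℝ (P.coeff s)|, Finset.sum_nonneg fun _ _ ↦ abs_nonneg _,
    fun x ↦ ?_⟩
  rw [aeval_def, eval₂_eq, Finset.sum_mul]
  refine (Finset.abs_sum_le_sum_abs _ _).trans (Finset.sum_le_sum fun s hs ↦ ?_)
  rw [abs_mul]
  refine mul_le_mul_of_nonneg_left ?_ (abs_nonneg _)
  have h1 := one_le_realSize x
  rw [Finset.abs_prod]
  calc ∏ j ∈ s.support, |x j ^ s j| ≤ ∏ j ∈ s.support, realSize x ^ s j := by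
        refine Finset.prod_le_prod (fun _ _ ↦ abs_nonneg _) fun j _ ↦ ?_
        rw [abs_pow]
        gcongr
        exact (norm_le_pi_norm x j).trans (norm_le_realSize x)
    _ = realSize x ^ (s.sum fun _ e ↦ e) := Finset.prod_pow_eq_pow_sum _ _ _
    _ ≤ _ := pow_le_pow_right₀ h1 ((le_totalDegree hs).trans hP)

/-- A family of polynomials is tame in the direction `i` if each of them is positive on `ℝⁿ` and
dominates all its iterated partial derivatives with respect to the `i`-th variable. -/
structure IsTame (Q : ι → MvPolynomial (Fin n) ℤ) (i : Fin n) : Prop where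
  pos : ∀ j (x : Fin n → ℝ), 0 < aeval x (Q j)
  dom : ∀ j k, ∃ C : ℝ, 0 ≤ C ∧
    ∀ x : Fin n → ℝ, |aeval x ((pderiv i)^[k] (Q j))| ≤ C * aeval x (Q j)

/-- The product of complex powers `∏ⱼ Qⱼ(x) ^ θⱼ` of positive polynomials, written with real
logarithms. -/
noncomputable def powerProduct [Fintype ι] (Q : ι → MvPolynomial (Fin n) ℤ) (θ : ι → ℂ)
    (x : Fin n → ℝ) : ℂ :=
  Complex.exp (∑ j, θ j * (Real.log (aeval x (Q j)) : ℂ))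

/-- The symbols of order at most `N`: the functions of the exponents `θ` and of the point `x`
generated by constants, by the quotients `∂ᵢᵏQⱼ / Qⱼ` of order `0`, and by the exponents `θⱼ`,
which have order `1`. -/
inductive IsSymbol (Q : ι → MvPolynomial (Fin n) ℤ) (i : Fin n) :
    ℕ → ((ι → ℂ) → (Fin n → ℝ) → ℂ) → Prop
  | const (c : ℂ) : IsSymbol Q i 0 fun _ _ ↦ c
  | quot (j : ι) (k : ℕ) :
      IsSymbol Q i 0 fun _ x ↦ ((aeval x ((pderiv i)^[k] (Q j)) / aeval x (Q j) : ℝ) : ℂ)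
  | exponent (j : ι) : IsSymbol Q i 1 fun θ _ ↦ θ j
  | add {N : ℕ} {g h : (ι → ℂ) → (Fin n → ℝ) → ℂ} :
      IsSymbol Q i N g → IsSymbol Q i N h → IsSymbol Q i N fun θ x ↦ g θ x + h θ x
  | mul {M N : ℕ} {g h : (ι → ℂ) → (Fin n → ℝ) → ℂ} :
      IsSymbol Q i M g → IsSymbol Q i N h → IsSymbol Q i (M + N) fun θ x ↦ g θ x * h θ x
  | mono {M N : ℕ} {g : (ι → ℂ) → (Fin n → ℝ) → ℂ} :
      M ≤ N → IsSymbol Q i M g → IsSymbol Q i N g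

variable {Q : ι → MvPolynomial (Fin n) ℤ} {i : Fin n} {N : ℕ} {g : (ι → ℂ) → (Fin n → ℝ) → ℂ}

/-- A symbol of order at most `N` grows at most like `‖θ‖ ^ N`, uniformly in `x`. -/
theorem IsSymbol.exists_norm_le [Fintype ι] (hQ : IsTame Q i) (hg : IsSymbol Q i N g) :
    ∃ C : ℝ, 0 ≤ C ∧ ∀ θ x, ‖g θ x‖ ≤ C * (1 + ‖θ‖) ^ N := by
  induction hg with
  | const c => exact ⟨‖c‖, norm_nonneg _, fun θ x ↦ by simp⟩
  | quot j k =>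
    obtain ⟨C, hC0, hC⟩ := hQ.dom j k
    refine ⟨C, hC0, fun θ x ↦ ?_⟩
    rw [Complex.norm_real, Real.norm_eq_abs, abs_div, abs_of_pos (hQ.pos j x), pow_zero, mul_one,
      div_le_iff₀ (hQ.pos j x)]
    exact hC x
  | exponent j =>
    refine ⟨1, zero_le_one, fun θ x ↦ ?_⟩
    rw [one_mul, pow_one]
    linarith [norm_le_pi_norm θ j]
  | add _ _ ih₁ ih₂ =>
    obtain ⟨C₁, h₁, hC₁⟩ := ih₁
    obtain ⟨C₂, h₂, hC₂⟩ := ih₂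
    refine ⟨C₁ + C₂, add_nonneg h₁ h₂, fun θ x ↦ (norm_add_le _ _).trans ?_⟩
    rw [add_mul]
    exact add_le_add (hC₁ θ x) (hC₂ θ x)
  | mul _ _ ih₁ ih₂ =>
    obtain ⟨C₁, h₁, hC₁⟩ := ih₁
    obtain ⟨C₂, h₂, hC₂⟩ := ih₂
    refine ⟨C₁ * C₂, mul_nonneg h₁ h₂, fun θ x ↦ ?_⟩
    rw [norm_mul, pow_add, mul_mul_mul_comm]
    exact mul_le_mul (hC₁ θ x) (hC₂ θ x) (norm_nonneg _) ((norm_nonneg _).trans (hC₁ θ x))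
  | mono h _ ih =>
    obtain ⟨C, hC0, hC⟩ := ih
    refine ⟨C, hC0, fun θ x ↦ (hC θ x).trans ?_⟩
    gcongr
    linarith [norm_nonneg θ]

theorem IsSymbol.continuous (hQ : IsTame Q i) (hg : IsSymbol Q i N g) (θ : ι → ℂ) :
    Continuous (g θ) := by
  induction hg with
  | const c => exact continuous_const
  | quot j k =>
    exact Complex.continuous_ofReal.comp ((continuous_aeval_real _).div (continuous_aeval_real _)
      fun x ↦ (hQ.pos j x).ne')
  | exponent j => exact continuous_const
  | add _ _ ih₁ ih₂ => exact ih₁.add ih₂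
  | mul _ _ ih₁ ih₂ => exact ih₁.mul ih₂
  | mono _ _ ih => exact ih

/-- Differentiation in `x` preserves the symbols of a given order, because
`∂(∂ᵏQ / Q) = ∂ᵏ⁺¹Q / Q - (∂ᵏQ / Q) (∂Q / Q)`. -/
theorem IsSymbol.exists_hasLineDerivAt (hQ : IsTame Q i) (hg : IsSymbol Q i N g) :
    ∃ g', IsSymbol Q i N g' ∧ ∀ θ x, HasLineDerivAt ℝ (g θ) (g' θ x) x (Pi.single i 1) := by
  induction hg with
  | const c => exact ⟨_, .const 0, fun θ x ↦ hasDerivAt_const _ _⟩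
  | quot j k =>
    refine ⟨_, (IsSymbol.quot j (k + 1)).add
      ((IsSymbol.const (-1)).mul ((IsSymbol.quot j k).mul (IsSymbol.quot j 1))), fun θ x ↦ ?_⟩
    have h1 := hasLineDerivAt_aeval ((pderiv i)^[k] (Q j)) i x
    have h2 := hasLineDerivAt_aeval (Q j) i x
    have h0 : aeval (x + (0 : ℝ) • (Pi.single i 1 : Fin n → ℝ)) (Q j) ≠ 0 := by
      rw [zero_smul, add_zero]
      exact (hQ.pos j x).ne'
    have h3 : HasDerivAt _ _ (0 : ℝ) := (HasDerivAt.div h1 h2 h0).ofReal_comp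
    refine h3.congr_deriv ?_
    have h4 : ((aeval x (Q j) : ℝ) : ℂ) ≠ 0 := by exact_mod_cast (hQ.pos j x).ne'
    rw [Function.iterate_succ_apply']
    simp only [zero_smul, add_zero, Function.iterate_one]
    push_cast
    field_simp
    ring
  | exponent j =>
    exact ⟨_, .mono (Nat.zero_le 1) (.const 0), fun θ x ↦ hasDerivAt_const _ _⟩
  | add _ _ ih₁ ih₂ =>
    obtain ⟨g₁, hs₁, h₁⟩ := ih₁
    obtain ⟨g₂, hs₂, h₂⟩ := ih₂
    exact ⟨_, hs₁.add hs₂, fun θ x ↦ HasDerivAt.add (h₁ θ x) (h₂ θ x)⟩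
  | mul hg₁ hg₂ ih₁ ih₂ =>
    obtain ⟨g₁, hs₁, h₁⟩ := ih₁
    obtain ⟨g₂, hs₂, h₂⟩ := ih₂
    refine ⟨_, (hs₁.mul hg₂).add (hg₁.mul hs₂), fun θ x ↦ ?_⟩
    have h3 : HasDerivAt _ _ (0 : ℝ) := HasDerivAt.mul (h₁ θ x) (h₂ θ x)
    refine h3.congr_deriv ?_
    simp only [zero_smul, add_zero]
  | mono h _ ih =>
    obtain ⟨g', hs, h'⟩ := ih
    exact ⟨g', hs.mono h, h'⟩

theorem IsSymbol.sum {κ : Type} (t : Finset κ) {g : κ → (ι → ℂ) → (Fin n → ℝ) → ℂ}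
    (hg : ∀ k ∈ t, IsSymbol Q i N (g k)) : IsSymbol Q i N fun θ x ↦ ∑ k ∈ t, g k θ x := by
  classical
  induction t using Finset.induction_on with
  | empty => simpa using (IsSymbol.const 0).mono (Nat.zero_le N)
  | insert k t hk ih =>
    simp only [Finset.sum_insert hk]
    exact (hg k (Finset.mem_insert_self _ _)).add
      (ih fun l hl ↦ hg l (Finset.mem_insert_of_mem hl))

/-- The logarithmic derivative of `powerProduct Q θ` is the symbol `∑ⱼ θⱼ ∂ᵢQⱼ / Qⱼ` of order
`1`. -/
theorem hasLineDerivAt_powerProduct [Fintype ι] (hQ : IsTame Q i) (θ : ι → ℂ) (x : Fin n → ℝ) :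
    HasLineDerivAt ℝ (powerProduct Q θ) (powerProduct Q θ x *
      ∑ j, θ j * ((aeval x ((pderiv i)^[1] (Q j)) / aeval x (Q j) : ℝ) : ℂ)) x
      (Pi.single i 1) := by
  have h1 : ∀ j, HasDerivAt (fun t : ℝ ↦ θ j *
      (Real.log (aeval (x + t • (Pi.single i 1 : Fin n → ℝ)) (Q j)) : ℂ))
      (θ j * ((aeval x ((pderiv i)^[1] (Q j)) / aeval x (Q j) : ℝ) : ℂ)) 0 := by
    intro j
    have h2 := hasLineDerivAt_aeval (Q j) i x
    have h0 : aeval (x + (0 : ℝ) • (Pi.single i 1 : Fin n → ℝ)) (Q j) ≠ 0 := by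
      rw [zero_smul, add_zero]
      exact (hQ.pos j x).ne'
    have h3 := ((HasDerivAt.log h2 h0).ofReal_comp).const_mul (θ j)
    simp only [zero_smul, add_zero] at h3
    exact h3
  have h2 := (HasDerivAt.fun_sum (u := Finset.univ) fun j _ ↦ h1 j).cexp
  simp only [zero_smul, add_zero] at h2
  exact h2

theorem continuous_powerProduct [Fintype ι] (hQ : IsTame Q i) (θ : ι → ℂ) :
    Continuous (powerProduct Q θ) :=
  Complex.continuous_exp.comp (continuous_finsetSum _ fun j _ ↦ continuous_const.mul
    (Complex.continuous_ofReal.comp ((continuous_aeval_real (Q j)).log fun x ↦ (hQ.pos j x).ne')))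

/-- The derivatives of a product of complex powers are the product itself times symbols, whose
order increases by one with each derivative. -/
theorem IsSymbol.exists_hasLineDerivAt_powerProduct_mul [Fintype ι] (hQ : IsTame Q i)
    (hg : IsSymbol Q i N g) :
    ∃ g', IsSymbol Q i (N + 1) g' ∧ ∀ θ x, HasLineDerivAt ℝ (fun x ↦ powerProduct Q θ x * g θ x)
      (powerProduct Q θ x * g' θ x) x (Pi.single i 1) := by
  obtain ⟨g', hs, h⟩ := hg.exists_hasLineDerivAt hQ
  refine ⟨_, (hs.mono N.le_succ).add (hg.mul (IsSymbol.sum Finset.univ fun j _ ↦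
    (IsSymbol.exponent j).mul (IsSymbol.quot j 1))), fun θ x ↦ ?_⟩
  have h3 : HasDerivAt _ _ (0 : ℝ) :=
    HasDerivAt.mul (hasLineDerivAt_powerProduct hQ θ x) (h θ x)
  refine h3.congr_deriv ?_
  simp only [zero_smul, add_zero]
  ring

theorem hasLineDerivAt_charReal (a : Fin n → ℤ) (i : Fin n) (x : Fin n → ℝ) :
    HasLineDerivAt ℝ (charReal a) (-(2 * Real.pi * Complex.I * a i) * charReal a x) x
      (Pi.single i 1) := by
  have h1 : ∀ t : ℝ, charReal a (x + t • (Pi.single i 1 : Fin n → ℝ)) =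
      Complex.exp (-(2 * Real.pi * Complex.I * a i) * t) * charReal a x := by
    intro t
    have h2 : ∑ j, (a j : ℝ) * (x + t • (Pi.single i 1 : Fin n → ℝ)) j =
        a i * t + ∑ j, (a j : ℝ) * x j := by
      simp only [Pi.add_apply, Pi.smul_apply, smul_eq_mul, mul_add, Finset.sum_add_distrib]
      rw [add_comm, Finset.sum_eq_single
        (f := fun j ↦ (a j : ℝ) * (t * (Pi.single i 1 : Fin n → ℝ) j)) i
        (fun j _ hj ↦ by simp [hj]) (by simp), Pi.single_eq_same, mul_one]
    rw [charReal, charReal, h2, ← Complex.exp_add]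
    congr 1
    push_cast
    ring
  have h3 : HasDerivAt (fun t : ℝ ↦ -(2 * Real.pi * Complex.I * a i) * (t : ℂ))
      (-(2 * Real.pi * Complex.I * a i)) 0 := by
    simpa using ((hasDerivAt_id (0 : ℝ)).ofReal_comp).const_mul (-(2 * Real.pi * Complex.I * a i))
  have h4 := (h3.cexp).mul_const (charReal a x)
  unfold HasLineDerivAt
  simp only [h1]
  refine h4.congr_deriv ?_
  simp

/-- Symbols are bounded in `x`, so multiplying by them preserves integrability. -/
theorem IsSymbol.integrable_powerProduct_mul [Fintype ι] (hQ : IsTame Q i)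
    (hg : IsSymbol Q i N g) {θ : ι → ℂ} (hint : Integrable (powerProduct Q θ)) :
    Integrable fun x ↦ powerProduct Q θ x * g θ x := by
  obtain ⟨C, hC0, hC⟩ := hg.exists_norm_le hQ
  exact hint.mul_bdd (hg.continuous hQ θ).aestronglyMeasurable
    (Filter.Eventually.of_forall fun x ↦ hC θ x)

theorem integrable_mul_charReal {h : (Fin n → ℝ) → ℂ} (hh : Integrable h) (a : Fin n → ℤ) :
    Integrable fun x ↦ h x * charReal a x :=
  hh.mul_bdd (c := 1) (continuous_charReal a).aestronglyMeasurable
    (Filter.Eventually.of_forall fun x ↦ (norm_charReal a x).le)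

/-- Repeated integration by parts against an oscillating character. The constant depends neither on
the exponents `θ` nor on the frequency `a`. -/
theorem exists_norm_integral_powerProduct_mul_charReal_le [Fintype ι] (hQ : IsTame Q i) (N : ℕ) :
    ∃ C : ℝ, 0 ≤ C ∧ ∀ θ : ι → ℂ, Integrable (powerProduct Q θ) → ∀ a : Fin n → ℤ,
      (2 * Real.pi * |(a i : ℝ)|) ^ N * ‖∫ x, powerProduct Q θ x * charReal a x‖ ≤
        C * (1 + ‖θ‖) ^ N * ∫ x, ‖powerProduct Q θ x‖ := by
  have key : ∃ g, IsSymbol Q i N g ∧ ∀ θ : ι → ℂ, Integrable (powerProduct Q θ) →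
      ∀ a : Fin n → ℤ, (2 * Real.pi * Complex.I * a i) ^ N *
        ∫ x, powerProduct Q θ x * charReal a x =
          ∫ x, powerProduct Q θ x * g θ x * charReal a x := by
    induction N with
    | zero => exact ⟨_, .const 1, fun θ _ a ↦ by simp⟩
    | succ N ih =>
      obtain ⟨g, hg, h⟩ := ih
      obtain ⟨g', hg', hd⟩ := hg.exists_hasLineDerivAt_powerProduct_mul hQ
      refine ⟨g', hg', fun θ hint a ↦ ?_⟩
      have h1 := integrable_mul_charReal (hg.integrable_powerProduct_mul hQ hint) a
      have h2 := integrable_mul_charReal (hg'.integrable_powerProduct_mul hQ hint) a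
      have h3 := integral_bilinear_hasLineDerivAt_right_eq_neg_left_of_integrable
        (μ := (volume : Measure (Fin n → ℝ))) (B := ContinuousLinearMap.mul ℝ ℂ)
        (f := fun x ↦ powerProduct Q θ x * g θ x) (f' := fun x ↦ powerProduct Q θ x * g' θ x)
        (g := charReal a) (g' := fun x ↦ -(2 * Real.pi * Complex.I * a i) * charReal a x)
        (v := Pi.single i 1) (by simpa using h2) (by
          simpa [mul_left_comm] using h1.const_mul (-(2 * Real.pi * Complex.I * a i)))
        (by simpa using h1) (fun x _ ↦ hd θ x) (fun x _ ↦ hasLineDerivAt_charReal a i x)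
      simp only [ContinuousLinearMap.mul_apply'] at h3
      have h4 : ∀ x, powerProduct Q θ x * g θ x * (-(2 * Real.pi * Complex.I * a i) *
          charReal a x) = -(2 * Real.pi * Complex.I * a i) *
          (powerProduct Q θ x * g θ x * charReal a x) := fun x ↦ by ring
      simp only [h4] at h3
      rw [integral_const_mul, neg_mul, neg_inj] at h3
      rw [pow_succ', mul_assoc, h θ hint a, h3]
  obtain ⟨g, hg, h⟩ := key
  obtain ⟨C, hC0, hC⟩ := hg.exists_norm_le hQ
  refine ⟨C, hC0, fun θ hint a ↦ ?_⟩
  have h1 := congrArg norm (h θ hint a)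
  rw [norm_mul, norm_pow] at h1
  have h2 : ‖2 * Real.pi * Complex.I * (a i : ℂ)‖ = 2 * Real.pi * |(a i : ℝ)| := by
    simp [abs_of_pos Real.pi_pos]
  rw [h2] at h1
  rw [h1, ← integral_const_mul]
  refine norm_integral_le_of_norm_le (hint.norm.const_mul _)
    (Filter.Eventually.of_forall fun x ↦ ?_)
  rw [norm_mul, norm_mul, norm_charReal, mul_one, mul_comm]
  gcongr
  exact hC θ x

end Symbols

/-! ### Decay of the archimedean factor -/

section RealDecay

open MvPolynomial

variable {n d : ℕ} {f : MvPolynomial (Fin n) ℤ}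

/-- The polynomials `q = 1 + ∑ xᵢ²` and `q ^ (d - 1) + f²`, of which the archimedean heights are
products of powers. -/
noncomputable def heightPolys (d : ℕ) (f : MvPolynomial (Fin n) ℤ) :
    Fin 2 → MvPolynomial (Fin n) ℤ :=
  ![1 + ∑ i, X i ^ 2, (1 + ∑ i, X i ^ 2) ^ (d - 1) + f ^ 2]

/-- The exponents of the polynomials `heightPolys` in `H_∞(s;x)⁻¹`, obtained from
`H_{D₁} = q ^ (d / 2) (q ^ (d - 1) + f²) ^ (-1 / 2)` and `H_{D₀} = q ^ (1 / 2) / H_{D₁}`. -/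
noncomputable def heightExponents (d : ℕ) (s : ℂ × ℂ) : Fin 2 → ℂ :=
  ![(-s.1 + d * (s.1 - s.2)) / 2, (s.2 - s.1) / 2]

theorem aeval_heightPolys_zero (x : Fin n → ℝ) :
    aeval x (heightPolys d f 0) = realSize x ^ 2 := by
  rw [realSize_sq]
  simp [heightPolys]

theorem aeval_heightPolys_one (x : Fin n → ℝ) :
    aeval x (heightPolys d f 1) = (realSize x ^ 2) ^ (d - 1) + aeval x f ^ 2 := by
  rw [realSize_sq]
  simp [heightPolys]

theorem totalDegree_iterate_pderiv_le {σ R : Type*} [CommRing R] (P : MvPolynomial σ R) (i : σ)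
    {m : ℕ} (hP : P.totalDegree ≤ m) (k : ℕ) :
    ((pderiv i)^[k] P).totalDegree ≤ m - k := by
  induction k with
  | zero => simpa using hP
  | succ k ih =>
    rw [Function.iterate_succ_apply', ← Nat.sub_sub]
    exact totalDegree_pderiv_le _ i ih

/-- Dominating the derivatives of `f²` by `q ^ (d - 1) + f²` uses `2 |f ∂ᵢf| ≤ f² + (∂ᵢf)²`. -/
theorem isTame_heightPolys (hf : f.IsHomogeneous d) (hd : 1 ≤ d) (i : Fin n) :
    IsTame (heightPolys d f) i := by
  have hdeg : (1 + ∑ i, X i ^ 2 : MvPolynomial (Fin n) ℤ).totalDegree ≤ 2 := by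
    refine (totalDegree_add _ _).trans (max_le (by simp) (totalDegree_finsetSum_le fun i _ ↦ ?_))
    exact (totalDegree_pow _ _).trans (by simp [totalDegree_X])
  have hdegq : ((1 + ∑ i, X i ^ 2 : MvPolynomial (Fin n) ℤ) ^ (d - 1)).totalDegree ≤
      2 * (d - 1) := by
    refine (totalDegree_pow _ _).trans ?_
    rw [mul_comm]
    gcongr
  have hdegf : (f ^ 2).totalDegree ≤ 2 * d :=
    (totalDegree_pow _ _).trans (by have := hf.totalDegree_le; omega)
  have hW : ∀ x : Fin n → ℝ, realSize x ^ (2 * (d - 1)) ≤ aeval x (heightPolys d f 1) := by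
    intro x
    rw [aeval_heightPolys_one, pow_mul]
    linarith [sq_nonneg (aeval x f : ℝ)]
  constructor
  · intro j x
    have hρ : 0 < realSize x := by linarith [one_le_realSize x]
    fin_cases j
    · change 0 < aeval x (heightPolys d f 0)
      rw [aeval_heightPolys_zero]
      positivity
    · exact lt_of_lt_of_le (by positivity) (hW x)
  · intro j k
    fin_cases j
    · obtain ⟨C, hC0, hC⟩ := exists_abs_aeval_le_of_totalDegree_le
        ((pderiv i)^[k] (1 + ∑ i, X i ^ 2))
        ((totalDegree_iterate_pderiv_le _ i hdeg k).trans (Nat.sub_le _ _))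
      refine ⟨C, hC0, fun x ↦ ?_⟩
      change _ ≤ C * aeval x (heightPolys d f 0)
      rw [aeval_heightPolys_zero]
      exact hC x
    · change ∃ C : ℝ, 0 ≤ C ∧ ∀ x : Fin n → ℝ, |aeval x ((pderiv i)^[k] (heightPolys d f 1))| ≤
        C * aeval x (heightPolys d f 1)
      match k with
      | 0 =>
        refine ⟨1, zero_le_one, fun x ↦ ?_⟩
        rw [Function.iterate_zero_apply, one_mul, abs_of_nonneg]
        have hρ : 0 < realSize x := by linarith [one_le_realSize x]
        exact le_trans (by positivity) (hW x)
      -- The first derivative of `f²` may have degree `2 d - 1`, which exceeds the degree of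
      -- `q ^ (d - 1)`; this case uses the summand `f²`.
      | 1 =>
        obtain ⟨C₁, h₁, hC₁⟩ := exists_abs_aeval_le_of_totalDegree_le
          (pderiv i ((1 + ∑ i, X i ^ 2) ^ (d - 1))) ((totalDegree_pderiv_le _ i hdegq).trans
            (Nat.sub_le _ _))
        obtain ⟨C₂, h₂, hC₂⟩ := exists_abs_aeval_le_of_totalDegree_le (pderiv i f)
          (totalDegree_pderiv_le _ i hf.totalDegree_le)
        refine ⟨C₁ + (1 + C₂ ^ 2), by positivity, fun x ↦ ?_⟩
        have hρ : 0 < realSize x := by linarith [one_le_realSize x]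
        have h3 : |2 * (aeval x f * aeval x (pderiv i f))| ≤
            (1 + C₂ ^ 2) * aeval x (heightPolys d f 1) := by
          have h4 := hC₂ x
          have h5 : (aeval x (pderiv i f) : ℝ) ^ 2 ≤ C₂ ^ 2 * (realSize x ^ 2) ^ (d - 1) := by
            rw [← sq_abs, ← pow_mul, mul_comm 2, pow_mul, ← mul_pow]
            gcongr
          have h6 : |2 * (aeval x f * aeval x (pderiv i f))| ≤
              (aeval x f : ℝ) ^ 2 + (aeval x (pderiv i f) : ℝ) ^ 2 := by
            rw [abs_le]
            constructor
            · nlinarith [sq_nonneg ((aeval x f : ℝ) + aeval x (pderiv i f))]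
            · nlinarith [sq_nonneg ((aeval x f : ℝ) - aeval x (pderiv i f))]
          rw [aeval_heightPolys_one]
          have h7 : 0 ≤ (realSize x ^ 2) ^ (d - 1) := by positivity
          nlinarith [mul_nonneg (sq_nonneg C₂) (sq_nonneg (aeval x f : ℝ))]
        have h8 : aeval x ((pderiv i)^[1] (heightPolys d f 1)) =
            aeval x (pderiv i ((1 + ∑ i, X i ^ 2 : MvPolynomial (Fin n) ℤ) ^ (d - 1))) +
              2 * (aeval x f * aeval x (pderiv i f)) := by
          rw [Function.iterate_one]
          change aeval x (pderiv i ((1 + ∑ i, X i ^ 2) ^ (d - 1) + f ^ 2)) = _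
          rw [map_add, map_add, sq f, pderiv_mul, map_add, map_mul, map_mul]
          ring
        rw [h8, add_mul]
        refine (abs_add_le _ _).trans (add_le_add ((hC₁ x).trans ?_) h3)
        gcongr
        exact hW x
      -- From the second derivative on, degrees are at most `2 (d - 1)`.
      | k + 2 =>
        obtain ⟨C, hC0, hC⟩ := exists_abs_aeval_le_of_totalDegree_le
          ((pderiv i)^[k + 2] (heightPolys d f 1)) (m := 2 * (d - 1))
          ((totalDegree_iterate_pderiv_le _ i (m := 2 * d) ((totalDegree_add _ _).trans
            (max_le (hdegq.trans (by omega)) hdegf)) _).trans (by omega))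
        exact ⟨C, hC0, fun x ↦ (hC x).trans (by gcongr; exact hW x)⟩

/-- The definition gives `H_{D₁}² = q ^ d / (q ^ (d - 1) + f²)`, in terms of the polynomials
`heightPolys`. -/
theorem log_heightD1Real (hd : 1 ≤ d) (x : Fin n → ℝ) :
    Real.log (heightD1Real d f x) = d / 2 * Real.log (aeval x (heightPolys d f 0)) -
      1 / 2 * Real.log (aeval x (heightPolys d f 1)) := by
  have hρ : 0 < realSize x := by linarith [one_le_realSize x]
  have hW : 0 < aeval x (heightPolys d f 1) := by
    rw [aeval_heightPolys_one]
    have : 0 < (realSize x ^ 2) ^ (d - 1) := by positivity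
    linarith [sq_nonneg (aeval x f : ℝ)]
  have h1 : (1 / realSize x) ^ 2 + (|aeval x f| / realSize x ^ d) ^ 2 =
      aeval x (heightPolys d f 1) / (realSize x ^ 2) ^ d := by
    obtain ⟨e, rfl⟩ := Nat.exists_eq_add_of_le' hd
    rw [aeval_heightPolys_one, div_pow, div_pow, sq_abs, Nat.add_sub_cancel, one_pow]
    field_simp
    ring
  rw [heightD1Real, h1, aeval_heightPolys_zero, Real.log_inv, Real.log_sqrt (by positivity),
    Real.log_div hW.ne' (by positivity), Real.log_pow]
  ring

theorem heightReal_inv_eq_powerProduct (hd : 1 ≤ d) (s : ℂ × ℂ) (x : Fin n → ℝ) :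
    (heightReal d f s x)⁻¹ = powerProduct (heightPolys d f) (heightExponents d s) x := by
  have hρ : 0 < realSize x := by linarith [one_le_realSize x]
  have h1 := heightD1Real_pos (d := d) (f := f) x
  have h0 : 0 < heightD0Real d f x := one_pos.trans_le (one_le_heightD0Real x)
  have hlog0 : Real.log (heightD0Real d f x) =
      1 / 2 * Real.log (aeval x (heightPolys d f 0)) - Real.log (heightD1Real d f x) := by
    rw [heightD0Real_eq, Real.log_div hρ.ne' h1.ne', aeval_heightPolys_zero, Real.log_pow]
    push_cast
    ring
  rw [heightReal, powerProduct, Fin.sum_univ_two,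
    Complex.cpow_def_of_ne_zero (by exact_mod_cast h0.ne'),
    Complex.cpow_def_of_ne_zero (by exact_mod_cast h1.ne'), ← Complex.exp_add, ← Complex.exp_neg,
    ← Complex.ofReal_log h0.le, ← Complex.ofReal_log h1.le, hlog0, log_heightD1Real hd]
  congr 1
  simp only [heightExponents, Matrix.cons_val_zero, Matrix.cons_val_one]
  push_cast
  ring

/-- The exponents grow linearly in the imaginary part of `s`, uniformly in vertical strips. -/
theorem norm_heightExponents_le {s : ℂ × ℂ} {R : ℝ} (h0 : 0 ≤ s.1.re) (h1 : 0 ≤ s.2.re)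
    (hR0 : s.1.re ≤ R) (hR1 : s.2.re ≤ R) :
    1 + ‖heightExponents d s‖ ≤ (2 + d) * (1 + |R|) * (1 + ‖(s.1.im, s.2.im)‖) := by
  set m := ‖(s.1.im, s.2.im)‖ with hm
  have hm0 : 0 ≤ m := norm_nonneg _
  have hd : (0 : ℝ) ≤ d := Nat.cast_nonneg d
  have hR : R ≤ |R| := le_abs_self R
  have hR' : 0 ≤ |R| := abs_nonneg R
  have hs0 : ‖s.1‖ ≤ |R| + m := by
    refine (Complex.norm_le_abs_re_add_abs_im _).trans
      (add_le_add ?_ (norm_fst_le (s.1.im, s.2.im)))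
    rw [abs_of_nonneg h0]
    linarith
  have hs1 : ‖s.2‖ ≤ |R| + m := by
    refine (Complex.norm_le_abs_re_add_abs_im _).trans
      (add_le_add ?_ (norm_snd_le (s.1.im, s.2.im)))
    rw [abs_of_nonneg h1]
    linarith
  have hsub : ‖s.1 - s.2‖ ≤ 2 * (|R| + m) := (norm_sub_le _ _).trans (by linarith)
  have h : ‖heightExponents d s‖ ≤ (1 + d) * (|R| + m) := by
    refine (pi_norm_le_iff_of_nonneg (by positivity)).2 fun j ↦ ?_
    fin_cases j
    · change ‖(-s.1 + d * (s.1 - s.2)) / 2‖ ≤ _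
      rw [norm_div, Complex.norm_ofNat, div_le_iff₀ two_pos]
      have h3 : ‖(d : ℂ) * (s.1 - s.2)‖ ≤ d * (2 * (|R| + m)) := by
        rw [norm_mul, Complex.norm_natCast]
        gcongr
      have h4 := norm_add_le (-s.1) (d * (s.1 - s.2))
      rw [norm_neg] at h4
      linarith
    · change ‖(s.2 - s.1) / 2‖ ≤ _
      rw [norm_div, Complex.norm_ofNat, div_le_iff₀ two_pos, norm_sub_rev]
      nlinarith [mul_nonneg hd (add_nonneg hR' hm0)]
  nlinarith [mul_nonneg hd hR', mul_nonneg hd hm0, mul_nonneg hR' hm0,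
    mul_nonneg hd (mul_nonneg hR' hm0)]

/-- In vertical strips the archimedean Fourier transform decays faster than any power of `‖a‖`,
with polynomial growth in the imaginary part. -/
theorem exists_norm_fourierReal_le (hf : f.IsHomogeneous d) (hsm : IsSmoothHypersurface f)
    (hn : 1 ≤ n) (hd : 1 ≤ d) {ε : ℝ} (hε : 0 < ε) (N : ℕ) (R : ℝ) :
    ∃ C : ℝ, 0 ≤ C ∧ ∀ a : Fin n → ℤ, a ≠ 0 → ∀ s ∈ domainOmega n ε, s.1.re ≤ R → s.2.re ≤ R →
      (1 + ‖a‖) ^ N * ‖fourierReal d f a s‖ ≤ C * (1 + ‖(s.1.im, s.2.im)‖) ^ N := by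
  choose C hC0 hC using fun i : Fin n ↦ exists_norm_integral_powerProduct_mul_charReal_le
    (isTame_heightPolys hf hd i) N
  obtain ⟨K, hK1, hK⟩ := exists_norm_heightReal_inv_le hf
  set I := ∫ x, majorantReal d f ε x with hI
  have hI0 : 0 ≤ I := integral_nonneg (majorantReal_nonneg ε)
  have hK0 : 0 < K := by linarith
  have hn1 : (1 : ℝ) ≤ n := by exact_mod_cast hn
  refine ⟨(∑ i, C i) * ((2 + d) * (1 + |R|)) ^ N * (K ^ R * I), ?_, fun a ha s hs hR0 hR1 ↦ ?_⟩
  · have := Finset.sum_nonneg fun i (_ : i ∈ Finset.univ) ↦ hC0 i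
    positivity
  have hint := integrable_integrandReal hf hsm hn a (s := s) (by linarith [hs.1])
    (by linarith [hs.2])
  have hfun : ∀ x, integrandReal d f a s x =
      powerProduct (heightPolys d f) (heightExponents d s) x * charReal a x := fun x ↦ by
    rw [integrandReal, heightReal_inv_eq_powerProduct hd]
  have hnorm : ∀ x, ‖powerProduct (heightPolys d f) (heightExponents d s) x‖ =
      ‖integrandReal d f a s x‖ := fun x ↦ by
    rw [hfun, norm_mul, norm_charReal, mul_one]
  -- Integration by parts is done in the direction of the largest coordinate of `a`.
  obtain ⟨i, hi⟩ := exists_norm_apply_eq ha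
  have hpp : Integrable (powerProduct (heightPolys d f) (heightExponents d s)) :=
    hint.congr' (continuous_powerProduct (isTame_heightPolys hf hd i) _).aestronglyMeasurable
      (Filter.Eventually.of_forall fun x ↦ (hnorm x).symm)
  have h1 := hC i (heightExponents d s) hpp a
  have hL1 : ∫ x, ‖powerProduct (heightPolys d f) (heightExponents d s) x‖ ≤ K ^ R * I := by
    rw [hI, ← integral_const_mul]
    refine integral_mono hpp.norm ((integrable_majorantReal hf hsm hε).const_mul _) fun x ↦ ?_
    simp only [hnorm, norm_integrandReal]
    refine (hK ε hε _ _ hs.1.le hs.2.le hn x).trans ?_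
    have := majorantReal_nonneg (d := d) (f := f) ε x
    gcongr
  have ha1 : 1 ≤ ‖a‖ := by
    rw [← hi]
    have : a i ≠ 0 := by
      intro h
      rw [h, norm_zero] at hi
      exact ha (norm_eq_zero.1 hi.symm)
    rw [Int.norm_eq_abs]
    exact_mod_cast Int.one_le_abs this
  have ha2 : 1 + ‖a‖ ≤ 2 * Real.pi * |(a i : ℝ)| := by
    rw [← Int.norm_eq_abs, hi]
    nlinarith [Real.pi_gt_three]
  have hfou : fourierReal d f a s =
      ∫ x, powerProduct (heightPolys d f) (heightExponents d s) x * charReal a x :=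
    integral_congr_ae (Filter.Eventually.of_forall hfun)
  have hCi : C i ≤ ∑ i, C i := Finset.single_le_sum (fun i _ ↦ hC0 i) (Finset.mem_univ i)
  have hexp := norm_heightExponents_le (d := d) (s := s) (R := R) (by linarith [hs.1])
    (by linarith [hs.2]) hR0 hR1
  calc (1 + ‖a‖) ^ N * ‖fourierReal d f a s‖
      ≤ (2 * Real.pi * |(a i : ℝ)|) ^ N * ‖fourierReal d f a s‖ := by gcongr
    _ ≤ C i * (1 + ‖heightExponents d s‖) ^ N *
        ∫ x, ‖powerProduct (heightPolys d f) (heightExponents d s) x‖ := by rw [hfou]; exact h1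
    _ ≤ (∑ i, C i) * ((2 + d) * (1 + |R|) * (1 + ‖(s.1.im, s.2.im)‖)) ^ N * (K ^ R * I) := by
      have hC1 : 0 ≤ ∑ i, C i := (hC0 i).trans hCi
      have h2 : 0 ≤ ∫ x, ‖powerProduct (heightPolys d f) (heightExponents d s) x‖ :=
        integral_nonneg fun x ↦ norm_nonneg _
      gcongr
    _ = _ := by
      rw [mul_pow ((2 + (d : ℝ)) * (1 + |R|))]
      ring

end RealDecay

/-! ### Integration over the finite adeles -/

section AdelicIntegral

variable {n : ℕ}

theorem mem_integralPoints_iff {p : Nat.Primes} {x : Fin n → ℚ_[p]} :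
    x ∈ integralPoints n p ↔ ‖x‖ ≤ 1 := by
  rw [← SetLike.mem_coe, coe_integralPoints, pi_norm_le_iff_of_nonneg zero_le_one]
  simp

/-- The adelic points that are integral outside a finite set of primes. -/
def integralOutside (n : ℕ) (S : Finset Nat.Primes) : Set (FiniteAdelicPoints n) :=
  {x | ∀ p ∉ S, ‖x p‖ ≤ 1}

/-- The projection to the components at a finite set of primes. -/
def projFinset (S : Finset Nat.Primes) (x : FiniteAdelicPoints n) (p : S) : Fin n → ℚ_[p.1] := x p.1

theorem continuous_projFinset (S : Finset Nat.Primes) :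
    Continuous (projFinset S : FiniteAdelicPoints n → _) :=
  continuous_pi fun p ↦ RestrictedProduct.continuous_eval p.1

theorem measurableSet_integralOutside (S : Finset Nat.Primes) :
    MeasurableSet (integralOutside n S) := by
  have : integralOutside n S = ⋂ p : Nat.Primes, ⋂ _ : p ∉ S, {x | ‖x p‖ ≤ 1} := by
    ext x
    simp [integralOutside]
  rw [this]
  exact (isClosed_iInter fun p ↦ isClosed_iInter fun _ ↦
    isClosed_le (RestrictedProduct.continuous_eval p).norm continuous_const).measurableSet

/-- The extension by zero of finitely many components to an adelic point. -/
noncomputable def extendZero (S : Finset Nat.Primes) (y : ∀ p : S, Fin n → ℚ_[p.1]) :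
    FiniteAdelicPoints n := by
  classical
  exact ⟨fun p ↦ if h : p ∈ S then y ⟨p, h⟩ else 0, by
    refine S.finite_toSet.subset fun p hp ↦ ?_
    by_contra h
    refine hp ?_
    rw [Finset.mem_coe] at h
    change (if h : p ∈ S then y ⟨p, h⟩ else 0) ∈ integralPoints n p
    rw [dif_neg h]
    exact zero_mem _⟩

theorem extendZero_apply_of_mem {S : Finset Nat.Primes} (y : ∀ p : S, Fin n → ℚ_[p.1])
    {p : Nat.Primes} (h : p ∈ S) : extendZero S y p = y ⟨p, h⟩ := by
  classical exact dif_pos h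

theorem extendZero_apply_of_notMem {S : Finset Nat.Primes} (y : ∀ p : S, Fin n → ℚ_[p.1])
    {p : Nat.Primes} (h : p ∉ S) : extendZero S y p = 0 := by
  classical exact dif_neg h

theorem coe_integralAdelicPoints :
    (integralAdelicPoints n : Set (FiniteAdelicPoints n)) = {x | ∀ p, ‖x p‖ ≤ 1} := by
  ext x
  simp only [Set.mem_ofPred_eq, ← mem_integralPoints_iff]
  constructor
  · rintro ⟨y, rfl⟩ p
    exact (y p).2
  · intro h
    exact ⟨fun p ↦ ⟨x p, h p⟩, rfl⟩

theorem volume_integralAdelicPoints :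
    volume (integralAdelicPoints n : Set (FiniteAdelicPoints n)) = 1 :=
  Measure.addHaarMeasure_self

instance : (volume : Measure (FiniteAdelicPoints n)).IsAddHaarMeasure :=
  inferInstanceAs (Measure.addHaarMeasure (integralAdelicPoints n)).IsAddHaarMeasure

/-- Translations of the components at `S` lift, through the extension by zero, to translations of
the adeles that preserve integrality outside `S`. -/
theorem isAddLeftInvariant_map_projFinset (S : Finset Nat.Primes) :
    (((volume : Measure (FiniteAdelicPoints n)).restrict (integralOutside n S)).map
      (projFinset S)).IsAddLeftInvariant := by
  refine ⟨fun y ↦ ?_⟩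
  have hm := (continuous_projFinset (n := n) S).measurable
  have hmy : Measurable fun x : FiniteAdelicPoints n ↦ extendZero S y + x :=
    (continuous_const.add continuous_id).measurable
  rw [Measure.map_map (measurable_const_add y) hm]
  have h1 : (fun x ↦ y + x) ∘ projFinset (n := n) S =
      projFinset S ∘ fun x ↦ extendZero S y + x := by
    funext x p
    change y p + x p.1 = extendZero S y p.1 + x p.1
    rw [extendZero_apply_of_mem y p.2]
  have h2 : integralOutside n S = (fun x ↦ extendZero S y + x) ⁻¹' integralOutside n S := by
    ext x
    refine forall₂_congr fun p hp ↦ ?_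
    change _ ↔ ‖extendZero S y p + x p‖ ≤ 1
    rw [extendZero_apply_of_notMem y hp, zero_add]
  rw [h1, ← Measure.map_map hm hmy]
  conv_lhs => rw [h2]
  rw [← Measure.restrict_map hmy (measurableSet_integralOutside S), map_add_left_eq_self]

theorem volume_pi_closedBall_one (S : Finset Nat.Primes) :
    volume (Metric.closedBall (0 : ∀ p : S, Fin n → ℚ_[p.1]) 1) = 1 := by
  rw [closedBall_pi _ zero_le_one, volume_pi_pi]
  exact Finset.prod_eq_one fun p _ ↦ volume_pi_padic_closedBall_one _ n

theorem map_projFinset_closedBall (S : Finset Nat.Primes) :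
    ((volume : Measure (FiniteAdelicPoints n)).restrict (integralOutside n S)).map (projFinset S)
      (Metric.closedBall 0 1) = 1 := by
  have hm := (continuous_projFinset (n := n) S).measurable
  rw [Measure.map_apply hm Metric.isClosed_closedBall.measurableSet,
    Measure.restrict_apply (hm Metric.isClosed_closedBall.measurableSet),
    ← volume_integralAdelicPoints (n := n)]
  congr 1
  rw [coe_integralAdelicPoints]
  ext x
  simp only [Set.mem_inter_iff, Set.mem_preimage, Metric.mem_closedBall, dist_zero_right,
    pi_norm_le_iff_of_nonneg zero_le_one (x := projFinset S x), Set.mem_ofPred_eq]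
  constructor
  · rintro ⟨h1, h2⟩ p
    by_cases hp : p ∈ S
    · exact h1 ⟨p, hp⟩
    · exact h2 p hp
  · exact fun h ↦ ⟨fun p ↦ h p.1, fun p _ ↦ h p⟩

/-- On the adelic points that are integral outside `S`, the Haar measure projects to the product
measure on the components at `S`, by uniqueness of Haar measure. -/
theorem map_projFinset (S : Finset Nat.Primes) :
    ((volume : Measure (FiniteAdelicPoints n)).restrict (integralOutside n S)).map (projFinset S) =
      volume := by
  set ν := ((volume : Measure (FiniteAdelicPoints n)).restrict (integralOutside n S)).map
    (projFinset S) with hν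
  have hinv : ν.IsAddLeftInvariant := isAddLeftInvariant_map_projFinset S
  let K : TopologicalSpace.PositiveCompacts (∀ p : S, Fin n → ℚ_[p.1]) :=
    ⟨⟨Metric.closedBall 0 1, isCompact_closedBall 0 1⟩,
      ⟨0, mem_interior_iff_mem_nhds.2 (Metric.closedBall_mem_nhds 0 one_pos)⟩⟩
  have hK : ν K = 1 := map_projFinset_closedBall S
  have hK' : volume (K : Set (∀ p : S, Fin n → ℚ_[p.1])) = 1 := volume_pi_closedBall_one S
  have hhaar : ν.IsAddHaarMeasure := Measure.isAddHaarMeasure_of_isCompact_nonempty_interior ν K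
    K.isCompact K.interior_nonempty (by rw [hK]; exact one_ne_zero)
    (by rw [hK]; exact ENNReal.one_ne_top)
  rw [Measure.addHaarMeasure_unique ν K,
    Measure.addHaarMeasure_unique (volume : Measure (∀ p : S, Fin n → ℚ_[p.1])) K, hK, hK']

theorem measurePreserving_projFinset (S : Finset Nat.Primes) :
    MeasurePreserving (projFinset S) ((volume : Measure (FiniteAdelicPoints n)).restrict
      (integralOutside n S)) volume :=
  ⟨(continuous_projFinset S).measurable, map_projFinset S⟩

theorem eventually_mem_integralOutside (x : FiniteAdelicPoints n) :
    ∀ᶠ S in Filter.atTop, x ∈ integralOutside n S := by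
  have hfin : {p | x p ∉ integralPoints n p}.Finite := x.2
  filter_upwards [Filter.eventually_ge_atTop hfin.toFinset] with S hS p hp
  rw [← mem_integralPoints_iff]
  by_contra h
  exact hp (hS (by simpa using h))

instance : SigmaFinite (volume : Measure (FiniteAdelicPoints n)) := by
  refine Measure.sigmaFinite_of_countable (S := Set.range fun q : Finset Nat.Primes × ℕ ↦
    integralOutside n q.1 ∩ projFinset q.1 ⁻¹' Metric.closedBall 0 q.2)
    (Set.countable_range _) ?_ ?_
  · rintro _ ⟨⟨S, m⟩, rfl⟩
    have h := (measurePreserving_projFinset (n := n) S).measure_preimage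
      (s := Metric.closedBall 0 m) Metric.isClosed_closedBall.measurableSet.nullMeasurableSet
    rw [Measure.restrict_apply ((continuous_projFinset S).measurable
      Metric.isClosed_closedBall.measurableSet), Set.inter_comm] at h
    change volume (integralOutside n S ∩ projFinset S ⁻¹' Metric.closedBall 0 m) < ⊤
    rw [h]
    exact measure_closedBall_lt_top
  · refine Set.eq_univ_of_forall fun x ↦ ?_
    obtain ⟨S, hS⟩ := (eventually_mem_integralOutside x).exists
    obtain ⟨m, hm⟩ := exists_nat_ge ‖projFinset S x‖
    exact ⟨_, ⟨(S, m), rfl⟩, hS, by simpa using hm⟩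

/-- The sets of points integral outside `S` exhaust the finite adeles; there are countably many of
them, which makes limits along them compatible with dominated convergence. -/
theorem aecover_integralOutside :
    AECover (volume : Measure (FiniteAdelicPoints n)) Filter.atTop (integralOutside n) :=
  ⟨Filter.Eventually.of_forall eventually_mem_integralOutside, measurableSet_integralOutside⟩

variable {F : ∀ p : Nat.Primes, (Fin n → ℚ_[p]) → ℂ}

/-- A product of local functions equal to `1` at integral points is a finite product on the adelic
points that are integral outside `S`. -/
theorem finprod_eq_prod_projFinset (hF1 : ∀ p x, ‖x‖ ≤ 1 → F p x = 1) {S : Finset Nat.Primes}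
    {x : FiniteAdelicPoints n} (hx : x ∈ integralOutside n S) :
    ∏ᶠ p, F p (x p) = ∏ p : S, F p.1 (projFinset S x p) := by
  rw [finprod_eq_prod_of_mulSupport_subset (s := S)]
  · exact (Finset.prod_coe_sort S fun p ↦ F p (x p)).symm
  · intro p hp
    by_contra h
    exact hp (hF1 p _ (hx p h))

/-- Fubini's theorem for the adeles: an absolutely convergent Euler product of local integrals is
an integral over the finite adelic points. -/
theorem integrable_finprod_and_integral_eq_tprod (hFi : ∀ p, Integrable (F p))
    (hF1 : ∀ p x, ‖x‖ ≤ 1 → F p x = 1) {u : Nat.Primes → ℝ} (hu : Summable u)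
    (hFu : ∀ p, |(∫ x, ‖F p x‖) - 1| ≤ u p) (hmul : Multipliable fun p ↦ ∫ x, F p x) :
    Integrable (fun x : FiniteAdelicPoints n ↦ ∏ᶠ p, F p (x p)) ∧
      ∫ x : FiniteAdelicPoints n, ∏ᶠ p, F p (x p) = ∏' p, ∫ x, F p x := by
  have hset : ∀ S, ∀ x ∈ integralOutside n S,
      ∏ᶠ p, F p (x p) = ∏ p : S, F p.1 (projFinset S x p) := fun S x hx ↦
    finprod_eq_prod_projFinset hF1 hx
  have hint : ∀ S, IntegrableOn (fun x : FiniteAdelicPoints n ↦ ∏ᶠ p, F p (x p))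
      (integralOutside n S) := fun S ↦ by
    refine IntegrableOn.congr_fun ?_ (fun x hx ↦ (hset S x hx).symm)
      (measurableSet_integralOutside S)
    exact (measurePreserving_projFinset S).integrable_comp_of_integrable
      (Integrable.fintype_prod_dep fun p : S ↦ hFi p.1)
  have hval : ∀ S, ∫ x in integralOutside n S, ∏ᶠ p, F p (x p) = ∏ p ∈ S, ∫ x, F p x := fun S ↦ by
    rw [setIntegral_congr_fun (measurableSet_integralOutside S) (hset S),
      ← Finset.prod_coe_sort, ← integral_fintype_prod_volume_eq_prod (fun p : S ↦ F p.1),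
      ← map_projFinset S, integral_map (continuous_projFinset S).measurable.aemeasurable]
    rw [map_projFinset]
    exact (Integrable.fintype_prod_dep fun p : S ↦ hFi p.1).aestronglyMeasurable
  have hnorm : ∀ S, ∫ x in integralOutside n S, ‖∏ᶠ p, F p (x p)‖ = ∏ p ∈ S, ∫ x, ‖F p x‖ :=
    fun S ↦ by
    have hset' : Set.EqOn (fun x : FiniteAdelicPoints n ↦ ‖∏ᶠ p, F p (x p)‖)
        (fun x ↦ ∏ p : S, ‖F p.1 (projFinset S x p)‖) (integralOutside n S) := fun x hx ↦ by
      simp only [hset S x hx, norm_prod]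
    rw [setIntegral_congr_fun (measurableSet_integralOutside S) hset',
      ← Finset.prod_coe_sort,
      ← integral_fintype_prod_volume_eq_prod (fun (p : S) (x : Fin n → ℚ_[p.1]) ↦ ‖F p.1 x‖),
      ← map_projFinset S, integral_map (continuous_projFinset S).measurable.aemeasurable]
    rw [map_projFinset]
    exact (Integrable.fintype_prod_dep fun p : S ↦ (hFi p.1).norm).aestronglyMeasurable
  have hu0 : ∀ p, 0 ≤ u p := fun p ↦ (abs_nonneg _).trans (hFu p)
  have hbound : ∀ S, ∫ x in integralOutside n S, ‖∏ᶠ p, F p (x p)‖ ≤ Real.exp (∑' p, u p) := by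
    intro S
    rw [hnorm]
    calc ∏ p ∈ S, ∫ x, ‖F p x‖ ≤ ∏ p ∈ S, Real.exp (u p) := by
          refine Finset.prod_le_prod (fun p _ ↦ integral_nonneg fun x ↦ norm_nonneg _) fun p _ ↦ ?_
          have := (abs_le.1 (hFu p)).2
          linarith [Real.add_one_le_exp (u p)]
      _ = Real.exp (∑ p ∈ S, u p) := (Real.exp_sum _ _).symm
      _ ≤ _ := Real.exp_le_exp.2 (hu.sum_le_tsum S fun p _ ↦ hu0 p)
  have hI := aecover_integralOutside.integrable_of_integral_norm_bounded _ hint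
    (Filter.Eventually.of_forall hbound)
  refine ⟨hI, ?_⟩
  have hlim := aecover_integralOutside.integral_tendsto_of_countably_generated hI
  simp only [hval] at hlim
  exact tendsto_nhds_unique hlim hmul.hasProd

end AdelicIntegral

/-! ### The Euler product -/

section EulerProduct

variable {n d : ℕ} {f : MvPolynomial (Fin n) ℤ}

theorem finite_primes_dvd {m : ℤ} (hm : m ≠ 0) : {p : Nat.Primes | ((p : ℕ) : ℤ) ∣ m}.Finite := by
  refine Set.Finite.of_finite_image (f := fun p : Nat.Primes ↦ (p : ℕ))
    ((m.natAbs.primeFactors.finite_toSet).subset ?_) (fun p _ q _ h ↦ Subtype.ext h)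
  rintro _ ⟨p, hp, rfl⟩
  exact Nat.mem_primeFactors.2 ⟨p.2, Int.natCast_dvd.1 hp, Int.natAbs_ne_zero.2 hm⟩

/-- The number of prime divisors grows slowly: `2 ^ ω(m) ≤ |m|`. -/
theorem two_pow_card_le_of_dvd {m : ℤ} (hm : m ≠ 0) (S : Finset Nat.Primes)
    (hS : ∀ p ∈ S, ((p : ℕ) : ℤ) ∣ m) : (2 : ℝ) ^ S.card ≤ |(m : ℝ)| := by
  have h1 : 2 ^ S.card ≤ ∏ p ∈ S, (p : ℕ) := by
    rw [← Finset.prod_const]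
    exact Finset.prod_le_prod' fun p _ ↦ p.2.two_le
  have h2 : ∏ p ∈ S, (p : ℕ) ∣ m.natAbs := by
    have := Finset.prod_primes_dvd (s := S.image fun p : Nat.Primes ↦ (p : ℕ)) m.natAbs
      (fun p hp ↦ by
        obtain ⟨q, -, rfl⟩ := Finset.mem_image.1 hp
        exact q.2.prime) (fun p hp ↦ by
        obtain ⟨q, hq, rfl⟩ := Finset.mem_image.1 hp
        exact Int.natCast_dvd.1 (hS q hq))
    rwa [Finset.prod_image (f := fun q : ℕ ↦ q) (g := fun p : Nat.Primes ↦ (p : ℕ))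
      fun p _ q _ h ↦ Subtype.ext h] at this
  have h3 : 2 ^ S.card ≤ m.natAbs := h1.trans (Nat.le_of_dvd (Int.natAbs_pos.2 hm) h2)
  rw [← Int.cast_abs, Int.abs_eq_natAbs]
  exact_mod_cast h3

/-- The local estimates at all primes, with uniform constants: `D` is an integer whose prime
divisors include the primes of bad reduction. -/
theorem exists_padic_bounds (hn : 3 ≤ n) (hd : 2 ≤ d) (hf : f.IsHomogeneous d)
    (hsm : IsSmoothHypersurface f) {ε : ℝ} (hε : 0 < ε) :
    ∃ D : ℤ, D ≠ 0 ∧ ∃ A K : ℝ, 0 ≤ A ∧ 0 ≤ K ∧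
      (∀ p : Nat.Primes, outerIntegral p d f ε ≠ ⊤) ∧
      (∀ p : Nat.Primes, (outerIntegral p d f ε).toReal ≤ K) ∧
      (∀ p : Nat.Primes, ¬ ((p : ℕ) : ℤ) ∣ D →
        (outerIntegral p d f ε).toReal ≤ A * (p : ℝ) ^ (-ε)) ∧
      ∀ p : Nat.Primes, ¬ ((p : ℕ) : ℤ) ∣ D → ∀ a : Fin n → ℤ, (∃ i, ¬ ((p : ℕ) : ℤ) ∣ a i) →
        ∀ s ∈ domainOmega n ε, ‖fourierPadic p d f a s - 1‖ ≤ A * (p : ℝ) ^ (-(1 + ε)) := by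
  obtain ⟨D, hD0, N, hD⟩ := exists_smoothness_identity hsm
  set B : ℝ := (n * d : ℕ) * (shellSeries ε).toReal with hB
  have hB0 : 0 ≤ B := by positivity
  have hgood : ∀ p : Nat.Primes, ¬ ((p : ℕ) : ℤ) ∣ D → (D : ZMod p) ≠ 0 := fun p hp h ↦
    hp ((ZMod.intCast_zmod_eq_zero_iff_dvd D p).1 h)
  have houter : ∀ p : Nat.Primes, ¬ ((p : ℕ) : ℤ) ∣ D →
      (outerIntegral p d f ε).toReal ≤ B * (p : ℝ) ^ (-ε) := fun p hp ↦
    toReal_outerIntegral_le_of_good p hε (outerIntegral_le_of_good p hn hd hf hD (hgood p hp) hε)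
  set T := (finite_primes_dvd hD0).toFinset with hT
  have hsum0 : 0 ≤ ∑ p ∈ T, (outerIntegral p d f ε).toReal :=
    Finset.sum_nonneg fun _ _ ↦ ENNReal.toReal_nonneg
  refine ⟨D, hD0, 3 * B, B + ∑ p ∈ T, (outerIntegral p d f ε).toReal, by positivity,
    by positivity, fun p ↦ outerIntegral_ne_top p hn hf hD hD0 hε, fun p ↦ ?_, fun p hp ↦ ?_,
    fun p hp a ha s hs ↦ ?_⟩
  · by_cases hp : ((p : ℕ) : ℤ) ∣ D
    · have := Finset.single_le_sum (f := fun p : Nat.Primes ↦ (outerIntegral p d f ε).toReal)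
        (fun _ _ ↦ ENNReal.toReal_nonneg) (show p ∈ T by simpa [hT] using hp)
      linarith
    · have h1 : ((p : ℕ) : ℝ) ^ (-ε) ≤ 1 :=
        Real.rpow_le_one_of_one_le_of_nonpos (one_lt_prime_real p).le (by linarith)
      nlinarith [houter p hp]
  · refine (houter p hp).trans ?_
    have : 0 ≤ ((p : ℕ) : ℝ) ^ (-ε) := by positivity
    nlinarith
  · obtain ⟨i, hi⟩ := ha
    exact norm_fourierPadic_sub_one_le_of_good p hn hd hf hD (hgood p hp) hε hs fun h ↦
      hi ((ZMod.intCast_zmod_eq_zero_iff_dvd _ p).1 (congrFun h i))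

open scoped Classical in
/-- The bound for the local factor at `p`: a constant at the primes dividing `m` and a convergent
tail. -/
noncomputable def localBound (A K r : ℝ) (m : ℤ) (p : Nat.Primes) : ℝ :=
  (if ((p : ℕ) : ℤ) ∣ m then K else 0) + A * (p : ℝ) ^ (-r)

theorem summable_localBound (A K : ℝ) {r : ℝ} (hr : 1 < r) {m : ℤ} (hm : m ≠ 0) :
    Summable (localBound A K r m) := by
  refine Summable.add ?_ ((Nat.Primes.summable_rpow.2 (by linarith)).mul_left A)
  refine summable_of_hasFiniteSupport ((finite_primes_dvd hm).subset fun p hp ↦ ?_)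
  by_contra h
  exact hp (if_neg h)

theorem localBound_nonneg {A K r : ℝ} (hA : 0 ≤ A) (hK : 0 ≤ K) (m : ℤ) (p : Nat.Primes) :
    0 ≤ localBound A K r m p := by
  unfold localBound
  split_ifs <;> positivity

theorem le_localBound {A K r x : ℝ} (hA : 0 ≤ A) {m : ℤ} {p : Nat.Primes}
    (h1 : x ≤ K) (h2 : ¬ ((p : ℕ) : ℤ) ∣ m → x ≤ A * (p : ℝ) ^ (-r)) :
    x ≤ localBound A K r m p := by
  have h3 : 0 ≤ A * ((p : ℕ) : ℝ) ^ (-r) := by positivity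
  unfold localBound
  split_ifs with h
  · linarith
  · linarith [h2 h]

/-- The factors at the divisors of `m` contribute at most
`(1 + K) ^ ω(m) ≤ (2 ^ ω(m)) ^ c ≤ |m| ^ c`, and the remaining factors a convergent product. -/
theorem prod_one_add_localBound_le {A K r : ℝ} (hA : 0 ≤ A) (hK : 0 ≤ K) (hr : 1 < r) {c : ℕ}
    (hc : 1 + K ≤ 2 ^ c) {m : ℤ} (hm : m ≠ 0) (S : Finset Nat.Primes) :
    ∏ p ∈ S, (1 + localBound A K r m p) ≤
      Real.exp (∑' p : Nat.Primes, A * (p : ℝ) ^ (-r)) * |(m : ℝ)| ^ c := by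
  classical
  have hs : Summable fun p : Nat.Primes ↦ A * (p : ℝ) ^ (-r) :=
    (Nat.Primes.summable_rpow.2 (by linarith)).mul_left A
  have h0 : ∀ p : Nat.Primes, 0 ≤ A * ((p : ℕ) : ℝ) ^ (-r) := fun p ↦ by positivity
  calc ∏ p ∈ S, (1 + localBound A K r m p)
      ≤ ∏ p ∈ S, Real.exp (A * (p : ℝ) ^ (-r)) * (if ((p : ℕ) : ℤ) ∣ m then 2 ^ c else 1) := by
        refine Finset.prod_le_prod (fun p _ ↦ by linarith [localBound_nonneg (r := r) hA hK m p])
          fun p _ ↦ ?_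
        have h1 := Real.add_one_le_exp (A * ((p : ℕ) : ℝ) ^ (-r))
        have h2 := h0 p
        unfold localBound
        split_ifs
        · calc 1 + (K + A * ((p : ℕ) : ℝ) ^ (-r))
              ≤ (A * ((p : ℕ) : ℝ) ^ (-r) + 1) * (1 + K) := by nlinarith
            _ ≤ _ := by gcongr
        · linarith
    _ = Real.exp (∑ p ∈ S, A * (p : ℝ) ^ (-r)) *
        ((2 : ℝ) ^ (S.filter fun p : Nat.Primes ↦ ((p : ℕ) : ℤ) ∣ m).card) ^ c := by
        rw [Finset.prod_mul_distrib, ← Real.exp_sum, Finset.prod_ite, Finset.prod_const,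
          Finset.prod_const_one, mul_one, ← pow_mul, ← pow_mul, mul_comm c]
    _ ≤ _ := by
        gcongr
        · exact hs.sum_le_tsum S fun p _ ↦ h0 p
        · exact two_pow_card_le_of_dvd hm _ fun p hp ↦ (Finset.mem_filter.1 hp).2

theorem norm_tprod_le_of_norm_sub_one_le {g : Nat.Primes → ℂ} {u : Nat.Primes → ℝ} {C : ℝ}
    (hg : Multipliable g) (hu : ∀ p, ‖g p - 1‖ ≤ u p)
    (hC : ∀ S : Finset Nat.Primes, ∏ p ∈ S, (1 + u p) ≤ C) : ‖∏' p, g p‖ ≤ C := by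
  refine le_of_tendsto' hg.hasProd.norm fun S ↦ ?_
  refine (Finset.prod_le_prod (fun _ _ ↦ norm_nonneg _) fun p _ ↦ ?_).trans (hC S)
  have := norm_add_le (g p - 1) 1
  rw [sub_add_cancel, norm_one] at this
  linarith [hu p]

theorem multipliable_of_norm_sub_one_le {g : Nat.Primes → ℂ} {u : Nat.Primes → ℝ}
    (hs : Summable u) (hu : ∀ p, ‖g p - 1‖ ≤ u p) : Multipliable g := by
  have := multipliable_one_add_of_summable (f := fun p ↦ g p - 1)
    (hs.of_nonneg_of_le (fun _ ↦ norm_nonneg _) hu)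
  simpa using this

/-- The bound for the local factors of `Ĥ(s;ψ_a)`: the exceptional primes are the divisors of
`D aᵢ` for any nonzero coordinate `aᵢ`. -/
theorem exists_norm_fourierPadic_sub_one_le (hn : 3 ≤ n) (hd : 2 ≤ d) (hf : f.IsHomogeneous d)
    (hsm : IsSmoothHypersurface f) {ε : ℝ} (hε : 0 < ε) :
    ∃ D : ℤ, D ≠ 0 ∧ ∃ A K : ℝ, 0 ≤ A ∧ 0 ≤ K ∧ ∀ (a : Fin n → ℤ) (i : Fin n), a i ≠ 0 →
      ∀ (p : Nat.Primes), ∀ s ∈ domainOmega n ε,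
        ‖fourierPadic p d f a s - 1‖ ≤ localBound A K (1 + ε) (D * a i) p := by
  obtain ⟨D, hD0, A, K, hA, hK, htop, hbad, -, hgood⟩ := exists_padic_bounds hn hd hf hsm hε
  refine ⟨D, hD0, A, K, hA, hK, fun a i hi p s hs ↦ le_localBound hA ?_ fun hp ↦ ?_⟩
  · exact (norm_fourierPadic_sub_one_le p hf (htop p) hs a).trans (hbad p)
  · exact hgood p (fun h ↦ hp (h.mul_right _)) a ⟨i, fun h ↦ hp (h.mul_left _)⟩ s hs

theorem exists_apply_ne_zero {a : Fin n → ℤ} (ha : a ≠ 0) : ∃ i, a i ≠ 0 :=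
  Function.ne_iff.1 ha

theorem multipliable_fourierPadic (hn : 3 ≤ n) (hd : 2 ≤ d) (hf : f.IsHomogeneous d)
    (hsm : IsSmoothHypersurface f) {ε : ℝ} (hε : 0 < ε) {a : Fin n → ℤ} (ha : a ≠ 0) {s : ℂ × ℂ}
    (hs : s ∈ domainOmega n ε) : Multipliable fun p : Nat.Primes ↦ fourierPadic p d f a s := by
  obtain ⟨D, hD0, A, K, -, -, h⟩ := exists_norm_fourierPadic_sub_one_le hn hd hf hsm hε
  obtain ⟨i, hi⟩ := exists_apply_ne_zero ha
  exact multipliable_of_norm_sub_one_le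
    (summable_localBound A K (by linarith) (mul_ne_zero hD0 hi)) fun p ↦ h a i hi p s hs

theorem differentiableOn_fourierEuler (hn : 3 ≤ n) (hd : 2 ≤ d) (hf : f.IsHomogeneous d)
    (hsm : IsSmoothHypersurface f) {ε : ℝ} (hε : 0 < ε) {a : Fin n → ℤ} (ha : a ≠ 0) :
    DifferentiableOn ℂ (fourierEuler d f a) (domainOmega n ε) := by
  obtain ⟨D, hD0, A, K, -, -, h⟩ := exists_norm_fourierPadic_sub_one_le hn hd hf hsm hε
  obtain ⟨i, hi⟩ := exists_apply_ne_zero ha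
  refine (differentiableOn_fourierReal hf hsm (by omega) a hε).mul ?_
  refine differentiableOn_tprod_of_summable (isOpen_domainOmega n ε)
    (summable_localBound A K (by linarith : 1 < 1 + ε) (mul_ne_zero hD0 hi)) (fun p ↦ ?_)
    fun p s hs ↦ h a i hi p s hs
  refine differentiableOn_fourierPadic p hf (fun δ hδ ↦ ?_) hε a
  obtain ⟨_, _, _, _, _, _, htop, -⟩ := exists_padic_bounds hn hd hf hsm hδ
  exact htop p

/-- The finite part of the Euler product grows at most polynomially in `a`, since the number of
exceptional primes is at most logarithmic; this is absorbed by the decay of the archimedean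
factor. -/
theorem exists_norm_tprod_fourierPadic_le (hn : 3 ≤ n) (hd : 2 ≤ d) (hf : f.IsHomogeneous d)
    (hsm : IsSmoothHypersurface f) {ε : ℝ} (hε : 0 < ε) :
    ∃ (c : ℕ) (C : ℝ), 0 < C ∧ ∀ a : Fin n → ℤ, a ≠ 0 → ∀ s ∈ domainOmega n ε,
      ‖∏' p : Nat.Primes, fourierPadic p d f a s‖ ≤ C * (1 + ‖a‖) ^ c := by
  obtain ⟨D, hD0, A, K, hA, hK, h⟩ := exists_norm_fourierPadic_sub_one_le hn hd hf hsm hε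
  -- Each exceptional prime contributes at most `2 ^ c`, up to a factor of a convergent product.
  obtain ⟨c, hc⟩ := pow_unbounded_of_one_lt (1 + K) one_lt_two
  have hD : 0 < |(D : ℝ)| := abs_pos.2 (by exact_mod_cast hD0)
  refine ⟨c, Real.exp (∑' p : Nat.Primes, A * (p : ℝ) ^ (-(1 + ε))) * |(D : ℝ)| ^ c,
    by positivity, fun a ha s hs ↦ ?_⟩
  obtain ⟨i, hi⟩ := exists_apply_ne_zero ha
  refine (norm_tprod_le_of_norm_sub_one_le (multipliable_fourierPadic hn hd hf hsm hε ha hs)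
    (fun p ↦ h a i hi p s hs) (prod_one_add_localBound_le hA hK (by linarith) hc.le
      (mul_ne_zero hD0 hi))).trans ?_
  rw [Int.cast_mul, abs_mul, mul_pow, ← mul_assoc]
  gcongr
  have := norm_le_pi_norm a i
  rw [Int.norm_eq_abs] at this
  linarith

/-- The polynomial growth of the finite part in `‖a‖` is compensated by additional integrations by
parts at the real place. -/
theorem exists_norm_fourierEuler_le (hn : 3 ≤ n) (hd : 2 ≤ d) (hf : f.IsHomogeneous d)
    (hsm : IsSmoothHypersurface f) {ε : ℝ} (hε : 0 < ε) :
    ∃ ν : ℝ, ∀ R : ℝ, ∃ C : ℝ, 0 < C ∧ ∀ a : Fin n → ℤ, a ≠ 0 → ∀ s ∈ domainOmega n ε,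
      s.1.re ≤ R → s.2.re ≤ R → ‖fourierEuler d f a s‖ ≤
        C * (1 + ‖(s.1.im, s.2.im)‖) ^ ν * (1 + ‖a‖) ^ (-(n : ℝ) - 1) := by
  obtain ⟨c, C₁, hC₁, h₁⟩ := exists_norm_tprod_fourierPadic_le hn hd hf hsm hε
  -- Of the `n + 1 + c` integrations by parts, `c` compensate the growth of the finite part.
  refine ⟨(n + 1 + c : ℕ), fun R ↦ ?_⟩
  obtain ⟨C₂, hC₂, h₂⟩ := exists_norm_fourierReal_le hf hsm (by omega) (by omega) hε (n + 1 + c) R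
  refine ⟨(C₂ + 1) * C₁, by positivity, fun a ha s hs h0 h1 ↦ ?_⟩
  have hx : 0 < 1 + ‖a‖ := by positivity
  set y := 1 + ‖(s.1.im, s.2.im)‖ with hy
  have hy0 : 0 < y := by positivity
  have h3 := h₁ a ha s hs
  have h4 := h₂ a ha s hs h0 h1
  rw [Real.rpow_natCast, show (-(n : ℝ) - 1) = -((n + 1 : ℕ) : ℝ) by push_cast; ring,
    Real.rpow_neg hx.le, Real.rpow_natCast, ← div_eq_mul_inv, le_div_iff₀ (by positivity),
    fourierEuler, norm_mul]
  calc ‖fourierReal d f a s‖ * ‖∏' p : Nat.Primes, fourierPadic p d f a s‖ * (1 + ‖a‖) ^ (n + 1)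
      ≤ ‖fourierReal d f a s‖ * (C₁ * (1 + ‖a‖) ^ c) * (1 + ‖a‖) ^ (n + 1) := by gcongr
    _ = (1 + ‖a‖) ^ (n + 1 + c) * ‖fourierReal d f a s‖ * C₁ := by ring
    _ ≤ C₂ * y ^ (n + 1 + c) * C₁ := by gcongr
    _ ≤ (C₂ + 1) * y ^ (n + 1 + c) * C₁ := by gcongr; linarith
    _ = _ := by ring

end EulerProduct

/-! ### The adelic integral -/

section GlobalFourier

variable {n d : ℕ} {f : MvPolynomial (Fin n) ℤ}

theorem finite_mulSupport_of_eq_one {F : ∀ p : Nat.Primes, (Fin n → ℚ_[p]) → ℂ}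
    (hF1 : ∀ p x, ‖x‖ ≤ 1 → F p x = 1) (x : FiniteAdelicPoints n) :
    (Function.mulSupport fun p ↦ F p (x p)).Finite := by
  obtain ⟨S, hS⟩ := (eventually_mem_integralOutside x).exists
  refine S.finite_toSet.subset fun p hp ↦ ?_
  by_contra h
  exact hp (hF1 p _ (hS p h))

/-- The global integrand is the product of the local ones. At each adelic point only finitely many
factors differ from `1`, so the separate `finprod`s of heights and characters have no junk value
and can be combined. -/
theorem integrandAdelic_eq (a : Fin n → ℤ) (s : ℂ × ℂ) (x : AdelicPoints n) :
    integrandAdelic d f a s x =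
      integrandReal d f a s x.1 * ∏ᶠ p : Nat.Primes, integrandPadic p d f a s (x.2 p) := by
  have h1 : (Function.mulSupport fun p : Nat.Primes ↦ heightPadic p d f s (x.2 p)).Finite :=
    finite_mulSupport_of_eq_one (F := fun p ↦ heightPadic p d f s) (fun p y hy ↦ by
      rw [heightPadic, heightD1Padic_eq_one p hy, heightD0Padic_eq_one p hy]
      simp) x.2
  have h2 : (Function.mulSupport fun p : Nat.Primes ↦ charPadic p a (x.2 p)).Finite :=
    finite_mulSupport_of_eq_one (F := fun p ↦ charPadic p a) (fun p y hy ↦ by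
      rw [charPadic_eq, psiPadic_eq_one p (norm_aeval_le_one p _ hy)]) x.2
  have h3 : (Function.mulSupport fun p : Nat.Primes ↦ (heightPadic p d f s (x.2 p))⁻¹).Finite := by
    rwa [Function.mulSupport_fun_inv]
  simp only [integrandPadic]
  rw [finprod_mul_distrib h3 h2, finprod_inv_distrib, integrandAdelic, heightAdelic, charAdelic,
    integrandReal, mul_inv]
  ring

/-- In the range of absolute convergence of the adelic integral, the global Fourier transform is
the Euler product of the local ones. -/
theorem integrable_integrandAdelic_and_integral_eq (hn : 3 ≤ n) (hd : 2 ≤ d)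
    (hf : f.IsHomogeneous d) (hsm : IsSmoothHypersurface f) {a : Fin n → ℤ} (ha : a ≠ 0)
    {s : ℂ × ℂ} (hs0 : (n : ℝ) + 1 < s.1.re) (hs1 : (n : ℝ) < s.2.re) :
    Integrable (integrandAdelic d f a s) ∧
      ∫ x : AdelicPoints n, integrandAdelic d f a s x = fourierEuler d f a s := by
  -- The estimate with `δ > 1` in place of `ε` makes the bounds `O(p ^ (-δ))` summable over `p`.
  obtain ⟨δ, hδ, hδ0, hδ1⟩ : ∃ δ : ℝ, 1 < δ ∧ n + δ < s.1.re ∧ n - 1 + δ < s.2.re := by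
    obtain ⟨δ, h1, h2⟩ := exists_between
      (show (1 : ℝ) < min (s.1.re - n) (s.2.re - (n - 1)) from
        lt_min (by linarith) (by linarith))
    exact ⟨δ, h1, by linarith [h2.trans_le (min_le_left _ _)],
      by linarith [h2.trans_le (min_le_right _ _)]⟩
  have hs : s ∈ domainOmega n δ := ⟨hδ0, hδ1⟩
  have hδpos : 0 < δ := by linarith
  obtain ⟨D, hD0, A, K, hA, hK, htop, hbad, hgood, -⟩ := exists_padic_bounds hn hd hf hsm hδpos
  have hreal : Integrable (integrandReal d f a s) :=
    integrable_integrandReal hf hsm (by omega) a (by linarith) (by linarith)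
  obtain ⟨hfin, hval⟩ := integrable_finprod_and_integral_eq_tprod
    (F := fun p : Nat.Primes ↦ integrandPadic p d f a s)
    (fun p ↦ integrable_integrandPadic p hf (htop p) hs a)
    (fun p x hx ↦ integrandPadic_eq_one p a s hx)
    (summable_localBound A K hδ hD0) (fun p ↦ by
      have h := integral_norm_integrandPadic_sub_one p hf (htop p) hs a
      rw [abs_of_nonneg h.1]
      exact h.2.trans (le_localBound hA (hbad p) (hgood p)))
    (multipliable_fourierPadic hn hd hf hsm hδpos ha hs)
  have hfun : integrandAdelic d f a s = fun x : AdelicPoints n ↦ integrandReal d f a s x.1 *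
      ∏ᶠ p : Nat.Primes, integrandPadic p d f a s (x.2 p) := funext (integrandAdelic_eq a s)
  rw [hfun]
  refine ⟨hreal.mul_prod hfin, ?_⟩
  rw [fourierEuler, fourierReal]
  simp only [fourierPadic]
  rw [← hval]
  exact integral_prod_mul (integrandReal d f a s)
    fun x : FiniteAdelicPoints n ↦ ∏ᶠ p : Nat.Primes, integrandPadic p d f a s (x p)

end GlobalFourier

end BlowupHeight

theorem mainTheorem6 (n d : ℕ) (hn : 3 ≤ n) (hd : 2 ≤ d)
    (f : MvPolynomial (Fin n) ℤ) (hf : f.IsHomogeneous d)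
    (hcop : BlowupHeight.HasCoprimeCoeffs f)
    (hsm : BlowupHeight.IsSmoothHypersurface f)
    (ε : ℝ) (hε : 0 < ε) :
    (∀ a : Fin n → ℤ, a ≠ 0 →
      -- the global Fourier transform converges absolutely and is the Euler product
      (∀ s : ℂ × ℂ, (n : ℝ) + 1 < s.1.re → (n : ℝ) < s.2.re →
        MeasureTheory.Integrable (BlowupHeight.integrandAdelic d f a s) ∧
        ∫ x : BlowupHeight.AdelicPoints n, BlowupHeight.integrandAdelic d f a s x =
          BlowupHeight.fourierEuler d f a s) ∧
      -- on the whole domain the local transforms and their product converge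
      (∀ s ∈ BlowupHeight.domainOmega n ε,
        MeasureTheory.Integrable (BlowupHeight.integrandReal d f a s) ∧
        (∀ p : Nat.Primes,
          MeasureTheory.Integrable (BlowupHeight.integrandPadic p d f a s)) ∧
        Multipliable (fun p : Nat.Primes ↦ BlowupHeight.fourierPadic p d f a s)) ∧
      DifferentiableOn ℂ (BlowupHeight.fourierEuler d f a) (BlowupHeight.domainOmega n ε)) ∧
    ∃ ν : ℝ, ∀ R : ℝ, ∃ C : ℝ, 0 < C ∧
      ∀ a : Fin n → ℤ, a ≠ 0 → ∀ s ∈ BlowupHeight.domainOmega n ε,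
        s.1.re ≤ R → s.2.re ≤ R →
          ‖BlowupHeight.fourierEuler d f a s‖ ≤
            C * (1 + ‖(s.1.im, s.2.im)‖) ^ ν * (1 + ‖a‖) ^ (-(n : ℝ) - 1) := by
  refine ⟨fun a ha ↦ ⟨fun s hs0 hs1 ↦
    BlowupHeight.integrable_integrandAdelic_and_integral_eq hn hd hf hsm ha hs0 hs1,
    fun s hs ↦ ⟨?_, fun p ↦ ?_, BlowupHeight.multipliable_fourierPadic hn hd hf hsm hε ha hs⟩,
    BlowupHeight.differentiableOn_fourierEuler hn hd hf hsm hε ha⟩,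
    BlowupHeight.exists_norm_fourierEuler_le hn hd hf hsm hε⟩
  · exact BlowupHeight.integrable_integrandReal hf hsm (by omega) a (by linarith [hs.1])
      (by linarith [hs.2])
  · obtain ⟨_, _, _, _, _, _, htop, -⟩ := BlowupHeight.exists_padic_bounds hn hd hf hsm hε
    exact BlowupHeight.integrable_integrandPadic p hf (htop p) hs a
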